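/- **Setting.** Let $M=\langle\mathcal X,\mathcal A,H,p,r\rangle$ be a finite-horizon MDP with horizon $H\ge 1$, compact metric state space $\mathcal X$, finite nonempty action set $\mathcal A$ of size $A$, measurable reward function $r:\mathcal X\times\mathcal A\to[0,1]$ and stochastic kernel $p(\cdot\mid x,a)$. For a randomised Markovian policy $\pi=(\pi_t)_{t\in[H]}$ let $V_1^\pi(x)=\mathbb E_x^\pi\big[\sum_{t=1}^H r(x_t,a_t)\big]$ and $V_1^*(x)=\sup_\pi V_1^\pi(x)$. Call $M$ $(L,\alpha)$-Hölder ($L,\alpha\ge 0$) if $|r(x,a)-r(x',a)|\le L\,d(x,x')^\alpha$ and $\|p(\cdot|x,a)-p(\cdot|x',a)\|_{\rm tvd}\le L\,d(x,x')^\alpha$ for all $x,x',a$. Let $\mathcal S_n\subset\mathcal X$ be a finite $\frac1n$-net with a measurable nearest-neighbour map $Q:\mathcal X\to\mathcal S_n$, and put $\lambda=Ln^{-\alpha}$. A sampling oracle $\mathcal C_p$ returns, on input $(x,a)$, an independent sample from $p(\cdot|x,a)$. **Backward induction** with accuracy $\varepsilon$ and failure probability $\delta'$. Let $J=\max\{0,\lceil\log_2(H/\varepsilon)\rceil\}$,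 and for $j\in[J]$ let $\epsilon_j=H/2^j$, $m_j=\big\lceil\frac{128H^3}{\min\{\epsilon_j^2,1\}}\ln\frac{16H|\mathcal S_n|AJ}{\delta'}\big\rceil$, $\ell_j=\big\lceil 512H^2\ln\frac{4H|\mathcal S_n|AJ}{\delta'}\big\rceil$, $\theta_j=\frac1{m_j}\ln\frac{16H|\mathcal S_n|AJ}{\delta'}$. All functions $u^{(j)}_t$ and decision rules $\pi^{(j)}_t$ depend on $x$ only through $Q(x)$. Start with $u_t^{(0)}\equiv0$ and $\pi^{(0)}$ arbitrary; $u^{(j)}_{H+1}\equiv 0$ for all $j$. In epoch $j=1,\dots,J$: (i) for each $(s,a)\in\mathcal S_n\times\mathcal A$ draw $m_j$ samples from $p(\cdot|s,a)$; for every $t$ let $\tilde\mu_t(s,a)$, $\tilde\sigma_t(s,a)$ be the empirical mean and variance of $u_t^{(j-1)}$ on them, and $\hat\mu_t=\tilde\mu_t-\sqrt{2\theta_j\tilde\sigma_t}-\big(\tfrac23\theta_j+2(2\theta_j)^{3/4}+\lambda\big)H$; (ii) for $t=H,H-1,\dots,1$: for each $(s,a)$ draw $\ell_j$ new samples from $p(\cdot|s,a)$,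 let $\hat\beta_{t+1}(s,a)$ be the empirical mean of $u_{t+1}^{(j)}-u_{t+1}^{(j-1)}$ on them minus $\frac{\epsilon_j}{4H}+\frac32\lambda H$, and let $v(s)=\max_a\{r(s,a)+\hat\mu_{t+1}(s,a)+\hat\beta_{t+1}(s,a)\}-\lambda$; if $v(s)\le u_t^{(j-1)}(s)$ keep $u_t^{(j)}(s)=u_t^{(j-1)}(s)$ and $\pi^{(j)}_t(s)=\pi_t^{(j-1)}(s)$, otherwise put $u_t^{(j)}(s)=v(s)$ and let $\pi_t^{(j)}(s)$ be a maximising action. The output is $\pi^{(J)}$; the number of calls to $\mathcal C_p$ is $\sum_{j=1}^J|\mathcal S_n|A(m_j+H\ell_j)$. **Online algorithm** over $K\ge1$ episodes ($T=HK$ steps), with $\delta\in(0,1)$ and a constant $c>0$. Let $N=\lfloor\log_2K\rfloor+1$ and $\Lambda=\log\frac{2H|\mathcal S_n|AN}{\delta}$. At the beginning of episode $k\in[K]$, if $k$ is a power of two, $\pi^{(k)}$ is the output of backward induction, run on fresh samples with accuracy $c\sqrt{\frac{H^2|\mathcal S_n|A}{k}\Lambda}$ and failure probability $\delta/N$; otherwise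 $\pi^{(k)}=\pi^{(k-1)}$. Then an episode of length $H$ is played with $\pi^{(k)}$ from an initial state $x^{(k)}_1$, which may be random and chosen in an arbitrary way. The regret is $\operatorname{Regret}_H(T)=\sum_{k=1}^K\big(V_1^*(x_1^{(k)})-V_1^{\pi^{(k)}}(x_1^{(k)})\big)$. **Theorem.** Below, $\widetilde O(f)$ means at most $C\,(1+\log(1+\log T))^q f$ with constants $C,q$ that depend only on $c$ (and on what is named explicitly). 1. If $M$ is $(L,\alpha)$-Hölder, then for every $n\ge1$, with probability at least $1-\delta$, $$\operatorname{Regret}_H(T)\le\widetilde O\Big(\sqrt{H|\mathcal S_n|AT\log\tfrac{H|\mathcal S_n|A}{\delta}}+HTLn^{-\alpha}\Big).$$ 2. Let $\mathcal X=[0,1]^D$, $D\ge1$, with the Euclidean metric. There are $\frac1n$-nets with $|\mathcal S_n|=O_D(n^D)$ for all $n\ge 1$. If $M$ is $(L,\alpha)$-Hölder, $n=\lceil T^{1/(D+2\alpha)}\rceil$ and $|\mathcal S_n|\le Bn^D$, then with probability at least $1-\delta$, with constants depending only on $c,D,B,L$, $$\operatorname{Regret}_H(T)\le\widetilde O\Big(T^{\frac{D+\alpha}{D+2\alpha}}\Big(H+\sqrt{HA\log\tfrac{HAT}{\delta}}\Big)\Big).$$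 3. If $\mathcal X=\mathcal S$ is an arbitrary finite set with $S$ elements (no Hölder assumption), and the algorithm is run with $\mathcal S_n=\mathcal S$, $Q=\mathrm{id}$, $\lambda=0$, then with probability at least $1-\delta$, $$\operatorname{Regret}_H(T)\le\widetilde O\Big(\sqrt{HSAT\log\tfrac{HSA}{\delta}}\Big).$$ 4. The number of calls to $\mathcal C_p$ made by the update in episode $k\le K$ is at most $C(1+\log(1+\log k))^q\big(Hk+H^3|\mathcal S_n|A(1+\log H)\Lambda\big)$ with $C,q$ depending only on $c$; so it is $O(Hk)$ up to $\operatorname{poly}\log\log$ factors as soon as $k\ge H^2|\mathcal S_n|A(1+\log H)\Lambda$. -/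

import Mathlib

open MeasureTheory ProbabilityTheory

universe u v w

noncomputable section

namespace OnlineMDP

/-! ### Finite-horizon Markov decision processes -/

/-- A finite-horizon MDP `⟨X, A, H, p, r⟩`: horizon `H ≥ 1`, stochastic kernel `p(· | x, a)`, and
measurable reward function `r : X × A → [0, 1]`. -/
structure MDP (X : Type u) (A : Type v) [MeasurableSpace X] [MeasurableSpace A] where
  H : ℕ
  H_pos : 1 ≤ H
  p : Kernel (X × A) X
  markov : IsMarkovKernel p
  r : X × A → ℝ
  r_measurable : Measurable r
  r_mem : ∀ z, r z ∈ Set.Icc (0 : ℝ) 1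

/-- A randomised Markovian decision rule: a stochastic kernel on `A` given `X`. -/
abbrev DecisionRule (X : Type u) (A : Type v) [MeasurableSpace X] [MeasurableSpace A] :=
  {d : Kernel X A // IsMarkovKernel d}

/-- A randomised Markovian policy. Time steps are counted from `0`, so that the steps of a
finite-horizon MDP are `0, …, H - 1`. -/
abbrev Policy (X : Type u) (A : Type v) [MeasurableSpace X] [MeasurableSpace A] :=
  ℕ → DecisionRule X A

variable {X : Type u} {A : Type v} [MeasurableSpace X] [MeasurableSpace A]

/-- `pathKernel M π t n x` is the joint law of the state-action pairs
`(x_t, a_t), …, (x_{t+n-1}, a_{t+n-1})` when `x_t = x`, `a_i ∼ π_i(· | x_i)` and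
`x_{i+1} ∼ p(· | x_i, a_i)`. -/
def pathKernel (M : MDP X A) (π : Policy X A) : ℕ → (n : ℕ) → Kernel X (Fin n → X × A)
  | _, 0 => Kernel.const X (Measure.dirac Fin.elim0)
  | t, n + 1 =>
      ((Kernel.id ×ₖ (π t).1) ⊗ₖ
        Kernel.prodMkLeft X ((pathKernel M π (t + 1) n) ∘ₖ M.p)).map
          (fun z => (Fin.cons z.1 z.2 : Fin (n + 1) → X × A))

/-- The expected total reward of the policy `π` from the initial state `x`. -/
def value (M : MDP X A) (π : Policy X A) (x : X) : ℝ :=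
  ∫ ω, ∑ t, M.r (ω t) ∂(pathKernel M π 0 M.H x)

/-- The optimal expected total reward: supremum over all randomised Markovian policies. -/
def optValue (M : MDP X A) (x : X) : ℝ := ⨆ π : Policy X A, value M π x

/-- Hölder continuity of rewards and, in total variation distance, of transition probabilities. -/
def IsHolder {X : Type u} {A : Type v} [MetricSpace X] [MeasurableSpace X] [MeasurableSpace A]
    (M : MDP X A) (L α : ℝ) : Prop :=
  (∀ x x' a, |M.r (x, a) - M.r (x', a)| ≤ L * dist x x' ^ α) ∧
  (∀ x x' a (B : Set X), MeasurableSet B →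
    |(M.p (x, a)).real B - (M.p (x', a)).real B| ≤ L * dist x x' ^ α)

/-! ### Discretisation of the state space -/

/-- A finite set of representative states together with a measurable quantizer onto it. -/
structure Discretization (X : Type u) [MeasurableSpace X] where
  net : Finset X
  quant : X → net
  quant_measurable : Measurable quant

/-- `net` is a `1/n`-net. -/
def IsNet {X : Type u} [MetricSpace X] (net : Finset X) (n : ℕ) : Prop :=
  ∀ x : X, ∃ s ∈ net, dist x s ≤ 1 / (n : ℝ)

/-- The representative states form a `1/n`-net and the quantizer maps every state to a nearest
element of the net. -/
def Discretization.IsNearestNeighbour {X : Type u} [MetricSpace X] [MeasurableSpace X]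
    (G : Discretization X) (n : ℕ) : Prop :=
  IsNet G.net n ∧ ∀ x : X, ∀ s ∈ G.net, dist x (G.quant x : X) ≤ dist x s

/-- The trivial discretisation of a finite state space: every state represents itself. -/
def Discretization.full (X : Type u) [MeasurableSpace X] [Fintype X] : Discretization X where
  net := Finset.univ
  quant := fun x => ⟨x, Finset.mem_univ x⟩
  quant_measurable := measurable_id.subtype_mk

/-- The deterministic policy given by a table of actions for the representative states: in state `x`
at time `t` it plays `table t (quant x)`. -/
def tablePolicy [MeasurableSingletonClass X] (G : Discretization X) (table : ℕ → G.net → A) :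
    Policy X A := fun t =>
  ⟨Kernel.deterministic (fun x => table t (G.quant x))
    ((Measurable.of_discrete (f := table t)).comp G.quant_measurable), inferInstance⟩

/-! ### The approximate backward induction algorithm under a generative model -/

/-- A maximiser of a real function on a finite non-empty type. -/
def argmax {A : Type v} [Finite A] [Nonempty A] (f : A → ℝ) : A :=
  (Finite.exists_max f).choose

/-- Empirical mean of the first `m` samples. -/
def empMean (m : ℕ) (f : ℕ → ℝ) : ℝ := (1 / (m : ℝ)) * ∑ i ∈ Finset.range m, f i

/-- The numerical parameters of the backward induction algorithm: horizon, number of representative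
states, number of actions, accuracy, failure probability. -/
structure Params where
  H : ℕ
  nS : ℕ
  nA : ℕ
  ε : ℝ
  δ : ℝ

namespace Params

/-- Number of epochs `⌈log₂ (H / ε)⌉` (no epoch if `ε ≥ H`). -/
def epochs (P : Params) : ℕ := ⌈Real.logb 2 ((P.H : ℝ) / P.ε)⌉₊

/-- Accuracy `ε_k = H / 2^k` aimed at in epoch `k`. -/
def acc (P : Params) (k : ℕ) : ℝ := (P.H : ℝ) / 2 ^ k

/-- The logarithm `ln (16 H |S| A K / δ)`, with `K` the number of epochs. -/
def logMean (P : Params) : ℝ :=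
  Real.log (16 * P.H * P.nS * P.nA * P.epochs / P.δ)

/-- Sample size `m_k`. -/
def m (P : Params) (k : ℕ) : ℕ :=
  ⌈128 * (P.H : ℝ) ^ 3 / min (P.acc k ^ 2) 1 * P.logMean⌉₊

/-- Sample size `ℓ_k`, the same in all epochs. -/
def ell (P : Params) : ℕ :=
  ⌈512 * (P.H : ℝ) ^ 2 * Real.log (4 * P.H * P.nS * P.nA * P.epochs / P.δ)⌉₊

/-- `θ_k = ln (16 H |S| A K / δ) / m_k`. -/
def theta (P : Params) (k : ℕ) : ℝ := (1 / (P.m k : ℝ)) * P.logMean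

/-- Number of calls to the sampling oracle: in every epoch `k`, every pair `(s, a)` is sampled `m_k`
times once, and `ℓ_k` times for each of the `H` time steps. -/
def numCalls (P : Params) : ℕ :=
  ∑ k ∈ Finset.Icc 1 P.epochs, P.nS * P.nA * (P.m k + P.H * P.ell)

end Params

/-- Labels of the calls to the sampling oracle: `mean k s a i` is the `i`-th sample from `p(· | s, a)`
drawn at the beginning of epoch `k`, and `diff k t s a i` is the `i`-th sample from `p(· | s, a)` drawn
at time step `t` of epoch `k`. -/
inductive Call (S : Type u) (A : Type v) where
  | mean (k : ℕ) (s : S) (a : A) (i : ℕ)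
  | diff (k t : ℕ) (s : S) (a : A) (i : ℕ)

/-- The state-action pair on which the oracle is called. -/
def Call.input {S : Type u} {A : Type v} : Call S A → S × A
  | .mean _ s a _ => (s, a)
  | .diff _ _ s a _ => (s, a)

/-- Value functions and decision rules at all time steps; both are functions of the representative
state, hence constant on the cells of the discretisation. -/
structure Iterate (S : Type u) (A : Type v) where
  val : ℕ → S → ℝ
  pol : ℕ → S → A

/-- Empirical variance of `val_t` under the `m_k` samples of epoch `k` from `p(· | s, a)`. -/
def sigmaTilde (P : Params) (G : Discretization X) (answer : Call G.net A → X)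
    (val : ℕ → G.net → ℝ) (k t : ℕ) (s : G.net) (a : A) : ℝ :=
  empMean (P.m k) (fun i => val t (G.quant (answer (.mean k s a i))) ^ 2) -
    empMean (P.m k) (fun i => val t (G.quant (answer (.mean k s a i)))) ^ 2

/-- Underestimate of the mean of `val_t` under `p(· | s, a)`; `lam` stands for `L n^{-α}`. -/
def muHat (P : Params) (lam : ℝ) (G : Discretization X) (answer : Call G.net A → X)
    (val : ℕ → G.net → ℝ) (k t : ℕ) (s : G.net) (a : A) : ℝ :=
  empMean (P.m k) (fun i => val t (G.quant (answer (.mean k s a i)))) -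
    Real.sqrt (2 * P.theta k * sigmaTilde P G answer val k t s a) -
    (2 / 3 * P.theta k + 2 * (2 * P.theta k) ^ (3 / 4 : ℝ) + lam) * P.H

/-- Underestimate of the mean of `new - old` under `p(· | s, a)`, from the `ℓ_k` samples drawn at time
step `t` of epoch `k`. -/
def betaHat (P : Params) (lam : ℝ) (G : Discretization X) (answer : Call G.net A → X)
    (new old : G.net → ℝ) (k t : ℕ) (s : G.net) (a : A) : ℝ :=
  empMean P.ell (fun i => new (G.quant (answer (.diff k t s a i))) -
      old (G.quant (answer (.diff k t s a i)))) -
    P.acc k / (4 * P.H) - 3 / 2 * lam * P.H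

section Algorithm

variable [Finite A] [Nonempty A]

/-- The backward recursion inside epoch `k`, by the number `j` of remaining time steps: the result is
the new value function and decision rule at time `H - j`. The terminal value function is `0`. -/
def backward (P : Params) (lam : ℝ) (r : X × A → ℝ) (G : Discretization X)
    (answer : Call G.net A → X) (k : ℕ) (old : Iterate G.net A) :
    ℕ → (G.net → ℝ) × (G.net → A)
  | 0 => (fun _ => 0, old.pol P.H)
  | j + 1 =>
      let t := P.H - (j + 1)
      let new := (backward P lam r G answer k old j).1
      let score : G.net → A → ℝ := fun s a =>
        r ((s : X), a) + muHat P lam G answer old.val k (t + 1) s a +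
          betaHat P lam G answer new (old.val (t + 1)) k t s a
      let cand : G.net → ℝ := fun s => score s (argmax (score s)) - lam
      open Classical in
      (fun s => if cand s ≤ old.val t s then old.val t s else cand s,
       fun s => if cand s ≤ old.val t s then old.pol t s else argmax (score s))

/-- Iterate after `k` epochs; the initial value functions vanish, the initial policy is arbitrary. -/
def iterate (P : Params) (lam : ℝ) (r : X × A → ℝ) (G : Discretization X)
    (answer : Call G.net A → X) (pol₀ : ℕ → G.net → A) : ℕ → Iterate G.net A
  | 0 => ⟨fun _ _ => 0, pol₀⟩
  | k + 1 =>
      let old := iterate P lam r G answer pol₀ k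
      ⟨fun t => (backward P lam r G answer (k + 1) old (P.H - t)).1,
       fun t => (backward P lam r G answer (k + 1) old (P.H - t)).2⟩

/-- Output (table of actions) of the approximate backward induction algorithm. -/
def backwardInduction (P : Params) (lam : ℝ) (r : X × A → ℝ) (G : Discretization X)
    (answer : Call G.net A → X) (pol₀ : ℕ → G.net → A) : ℕ → G.net → A :=
  (iterate P lam r G answer pol₀ P.epochs).pol

end Algorithm

/-! ### The online algorithm -/

/-- Number of policy updates (powers of two) among the episodes `1, …, K`. -/
def numUpdates (K : ℕ) : ℕ := Nat.log 2 K + 1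

/-- The logarithmic factor `log (2 H |S| A N / δ)`, with `N` the number of policy updates. -/
def updateLog (H nS nA K : ℕ) (δ : ℝ) : ℝ :=
  Real.log (2 * H * nS * nA * numUpdates K / δ)

/-- Parameters of the backward induction run at the beginning of episode `k`, out of `K` episodes:
accuracy `c √(H² |S| A / k · log (2 H |S| A N / δ))` and failure probability `δ / N`. -/
def updateParams (c : ℝ) (H nS nA K : ℕ) (δ : ℝ) (k : ℕ) : Params where
  H := H
  nS := nS
  nA := nA
  ε := c * Real.sqrt ((H : ℝ) ^ 2 * nS * nA / k * updateLog H nS nA K δ)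
  δ := δ / numUpdates K

/-- Policy tables used by the online algorithm in the episodes `1, 2, …, K`: recomputed in the
generative phase if the episode number is a power of two, otherwise kept. The `k`-th component of
`answers` are the answers of the sampling oracle in the generative phase of episode `k`. -/
def onlineTable [Fintype A] [Nonempty A] (c : ℝ) (H : ℕ) (r : X × A → ℝ) (lam : ℝ)
    (G : Discretization X) (K : ℕ) (δ : ℝ) (pol₀ : ℕ → G.net → A)
    (answers : ℕ → Call G.net A → X) : ℕ → (ℕ → G.net → A)
  | 0 => pol₀
  | k + 1 =>
      if k + 1 = 2 ^ Nat.log 2 (k + 1) then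
        backwardInduction (updateParams c H G.net.card (Fintype.card A) K δ (k + 1)) lam r G
          (answers (k + 1)) pol₀
      else onlineTable c H r lam G K δ pol₀ answers k

/-- The answers of the classical sampling oracle for `p`: different calls give independent answers, and
the answer to a call on `(s, a)` has law `p(· | s, a)`. -/
structure IsSamplingOracle {Ω : Type w} [MeasurableSpace Ω] (μ : Measure Ω) (M : MDP X A)
    (G : Discretization X) (answer : ℕ × Call G.net A → Ω → X) : Prop where
  measurable : ∀ i, Measurable (answer i)
  indep : iIndepFun answer μ
  law : ∀ i, μ.map (answer i) = M.p ((i.2.input.1 : X), i.2.input.2)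

/-- The finite-horizon regret over `K` episodes of the online algorithm, when the oracle answers are
`answers` and episode `k` starts in the state `init k`. -/
def regret [MeasurableSingletonClass X] [Fintype A] [Nonempty A] (c : ℝ) (M : MDP X A) (lam : ℝ)
    (G : Discretization X) (K : ℕ) (δ : ℝ) (pol₀ : ℕ → G.net → A)
    (answers : ℕ → Call G.net A → X) (init : ℕ → X) : ℝ :=
  ∑ k ∈ Finset.Icc 1 K,
    (optValue M (init k) -
      value M (tablePolicy G (onlineTable c M.H M.r lam G K δ pol₀ answers k)) (init k))

/-- The factor `(1 + log (1 + log T))^q`. -/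
def polyLogLog (q : ℕ) (T : ℝ) : ℝ := (1 + Real.log (1 + Real.log T)) ^ q

/-- The unit cube `[0,1]^D` in Euclidean space. -/
def unitCube (D : ℕ) : Set (EuclideanSpace ℝ (Fin D)) := {x | ∀ i, x i ∈ Set.Icc (0 : ℝ) 1}

end OnlineMDP

end

open OnlineMDP

/-! Everything rests on one property of the generative phase: with probability at least `1 - δ'` its
output table loses at most `ε + 8λH²` against the Bellman optimum, from every initial state at once
(`measure_backwardInduction_le`). The regret bound then follows by summation. Episode `k` plays the
table computed at the largest power of two below or equal to `k`, whose accuracy is within a factor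
`√2` of the accuracy prescribed for `k`. As `∑ 1/√k ≤ 2√K`, the statistical errors add up to order
`√(H²SAΛK) = √(HSATΛ)`, the discretisation errors to `8λHT`, and the `N` failure probabilities `δ/N`
to `δ`. Because the guarantee is uniform in the state, the initial states may be chosen in any way.

The generative phase is variance-reduced value iteration. Its value functions increase from epoch to
epoch and always satisfy the Bellman inequality of the current table (`Iterate.IsValid`), so they
are lower bounds for the value of that table and it remains to show that they are close to the
optimum. One epoch halves the statistical part of the gap (`isValid_epoch`). The mean of the old
function is estimated by `m_j` samples with an empirical Bernstein bonus, and the small increment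
`new - old` by `ℓ_j` fresh samples in every step. The algorithm subtracts its confidence widths, so
on the good event all estimates are underestimates, and the extra `λ` and `λH` pay for passing from
a representative state to an arbitrary state of its cell.

The sharp power of `H` comes from the variance. The bonus is of order `√(θ Var V)` with `V` optimal
for the remaining steps; by AM-GM it is at most `ε/(4h²) Var V` plus a multiple of `ε/h` and
discretisation terms (`bonus_le`). Instead of a total-variance argument along trajectories, the
induction carries the potential `ε/(4h²) (nV - V²)` (`gapBound`). Averaging the potential over a
transition lowers it by exactly the variance term, and one Bellman step does not decrease it
otherwise (`gap_arith`). The potential never exceeds `ε/16`, so the variances of all steps together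
cost only a fraction of `ε`.

Probability enters through one device: the functions being averaged are measurable with respect to
earlier calls, hence independent of the samples used, and can be frozen (`measure_le_of_indepFun`).
Bernstein and Hoeffding bounds for fixed functions and a union bound then give the good event.

For the number of calls, `∑ m_j` is dominated by the last epoch. Its part growing like `4^J`, about
`(H/ε)²`, yields `Hk`; the part that is constant in `j` contributes `H³SA` per epoch, and the number
of epochs is controlled by `log H` plus a term absorbed into `Hk`. -/

noncomputable section

namespace OnlineMDP

section

/-! ### Policy values, Bellman's recursion and certificates for table policies -/

section Mdp

variable {X : Type u} {A : Type v} [MeasurableSpace X] [MeasurableSpace A]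

theorem integrable_of_abs_le {Y : Type*} [MeasurableSpace Y] {ν : Measure Y} [IsFiniteMeasure ν]
    {f : Y → ℝ} (hf : Measurable f) {b : ℝ} (hb : ∀ y, |f y| ≤ b) : Integrable f ν :=
  Integrable.of_bound hf.aestronglyMeasurable b (ae_of_all _ hb)

theorem integral_mem_Icc {Y : Type*} [MeasurableSpace Y] {ν : Measure Y} [IsProbabilityMeasure ν]
    {f : Y → ℝ} (hf : Measurable f) {a b : ℝ} (hb : ∀ y, f y ∈ Set.Icc a b) :
    ∫ y, f y ∂ν ∈ Set.Icc a b := by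
  have hi : Integrable f ν := integrable_of_abs_le hf (b := max |a| |b|)
    (fun y => abs_le_max_abs_abs (hb y).1 (hb y).2)
  constructor
  · simpa using integral_mono (μ := ν) (integrable_const a) hi (fun y => (hb y).1)
  · simpa using integral_mono (μ := ν) hi (integrable_const b) (fun y => (hb y).2)

theorem integral_mono_of_abs_le {Y : Type*} [MeasurableSpace Y] {ν : Measure Y}
    [IsFiniteMeasure ν] {f g : Y → ℝ} (hf : Measurable f) (hg : Measurable g) {b : ℝ}
    (hfb : ∀ y, |f y| ≤ b) (hgb : ∀ y, |g y| ≤ b) (h : ∀ y, f y ≤ g y) :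
    ∫ y, f y ∂ν ≤ ∫ y, g y ∂ν :=
  integral_mono (integrable_of_abs_le hf hfb) (integrable_of_abs_le hg hgb) h

instance (M : MDP X A) : IsMarkovKernel M.p := M.markov

theorem measurable_integral_kernel (M : MDP X A) {f : X → ℝ} (hf : Measurable f) :
    Measurable fun z => ∫ y, f y ∂(M.p z) :=
  hf.stronglyMeasurable.integral_kernel.measurable

theorem measurable_finCons (n : ℕ) :
    Measurable fun z : (X × A) × (Fin n → X × A) => (Fin.cons z.1 z.2 : Fin (n + 1) → X × A) :=
  measurable_pi_iff.2 fun i => by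
    refine Fin.cases ?_ (fun j => ?_) i
    · simpa using measurable_fst
    · simp only [Fin.cons_succ]; fun_prop

theorem isMarkovKernel_pathKernel (M : MDP X A) (π : Policy X A) (t n : ℕ) :
    IsMarkovKernel (pathKernel M π t n) := by
  induction n generalizing t with
  | zero => rw [pathKernel]; infer_instance
  | succ n ih =>
    have := ih (t + 1)
    have := (π t).2
    rw [pathKernel]
    exact Kernel.IsMarkovKernel.map _ (measurable_finCons n)

/-- The expected reward of the policy `π` collected in `n` steps from time `t` on. -/
def valueFrom (M : MDP X A) (π : Policy X A) (t n : ℕ) (x : X) : ℝ :=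
  ∫ ω, ∑ i, M.r (ω i) ∂(pathKernel M π t n x)

theorem measurable_sum_reward (M : MDP X A) (n : ℕ) :
    Measurable fun ω : Fin n → X × A => ∑ i, M.r (ω i) :=
  Finset.measurable_sum _ fun i _ => M.r_measurable.comp (measurable_pi_apply i)

theorem sum_reward_mem (M : MDP X A) (n : ℕ) (ω : Fin n → X × A) :
    ∑ i, M.r (ω i) ∈ Set.Icc (0 : ℝ) n := by
  constructor
  · exact Finset.sum_nonneg fun i _ => (M.r_mem _).1
  · calc ∑ i, M.r (ω i) ≤ ∑ _i : Fin n, (1 : ℝ) := Finset.sum_le_sum fun i _ => (M.r_mem _).2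
      _ = n := by simp

theorem valueFrom_mem (M : MDP X A) (π : Policy X A) (t n : ℕ) (x : X) :
    valueFrom M π t n x ∈ Set.Icc (0 : ℝ) n := by
  have := isMarkovKernel_pathKernel M π t n
  exact integral_mem_Icc (measurable_sum_reward M n) (sum_reward_mem M n)

theorem measurable_valueFrom (M : MDP X A) (π : Policy X A) (t n : ℕ) :
    Measurable (valueFrom M π t n) :=
  (measurable_sum_reward M n).stronglyMeasurable.integral_kernel.measurable

theorem valueFrom_zero (M : MDP X A) (π : Policy X A) (t : ℕ) (x : X) :
    valueFrom M π t 0 x = 0 := by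
  simp [valueFrom]

/-- Fubini for the composition-product defining `pathKernel`: split off the first pair, integrate
the rest of the path given that pair, and use that the state marginal is a Dirac mass. This is the
only place where path measures are unfolded; afterwards values are handled by recursion alone. -/
theorem valueFrom_succ (M : MDP X A) (π : Policy X A) (t n : ℕ) (x : X) :
    valueFrom M π t (n + 1) x =
      ∫ a, (M.r (x, a) + ∫ y, valueFrom M π (t + 1) n y ∂(M.p (x, a))) ∂((π t).1 x) := by
  have hM := isMarkovKernel_pathKernel M π (t + 1) n
  have hM' := isMarkovKernel_pathKernel M π t (n + 1)
  have hπ := (π t).2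
  have hs : Measurable fun z : (X × A) × (Fin n → X × A) => M.r z.1 + ∑ i, M.r (z.2 i) :=
    (M.r_measurable.comp measurable_fst).add ((measurable_sum_reward M n).comp measurable_snd)
  have hb : ∀ z : (X × A) × (Fin n → X × A), |M.r z.1 + ∑ i, M.r (z.2 i)| ≤ 1 + n := by
    intro z
    have h1 := M.r_mem z.1
    have h2 := sum_reward_mem M n z.2
    rw [abs_of_nonneg (add_nonneg h1.1 h2.1)]
    exact add_le_add h1.2 h2.2
  have key : ∀ z : X × A, ∫ w, (M.r z + ∑ i, M.r (w i)) ∂((pathKernel M π (t + 1) n ∘ₖ M.p) z) =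
      M.r z + ∫ y, valueFrom M π (t + 1) n y ∂(M.p z) := by
    intro z
    have hi : Integrable (fun w : Fin n → X × A => ∑ i, M.r (w i))
        ((pathKernel M π (t + 1) n ∘ₖ M.p) z) :=
      integrable_of_abs_le (measurable_sum_reward M n) (b := n) fun w => by
        rw [abs_of_nonneg (sum_reward_mem M n w).1]; exact (sum_reward_mem M n w).2
    rw [integral_add (integrable_const _) hi, Kernel.integral_comp hi]
    simp [valueFrom]
  have hm : Measurable fun z : X × A => M.r z + ∫ y, valueFrom M π (t + 1) n y ∂(M.p z) :=
    M.r_measurable.add (measurable_integral_kernel M (measurable_valueFrom M π _ _))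
  rw [valueFrom, pathKernel, Kernel.map_apply _ (measurable_finCons n),
    integral_map (measurable_finCons n).aemeasurable
      (measurable_sum_reward M (n + 1)).aestronglyMeasurable]
  simp only [Fin.sum_univ_succ, Fin.cons_zero, Fin.cons_succ]
  rw [ProbabilityTheory.integral_compProd (integrable_of_abs_le hs hb)]
  simp only [Kernel.prodMkLeft_apply]
  simp_rw [key]
  rw [Kernel.prod_apply, Kernel.id_apply, Measure.dirac_prod,
    integral_map measurable_prodMk_left.aemeasurable hm.aestronglyMeasurable]

section Opt

variable [Fintype A] [Nonempty A]

/-- Optimal expected total reward in `n` steps, by Bellman's recursion. -/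
def bellman (M : MDP X A) : ℕ → X → ℝ
  | 0 => fun _ => 0
  | n + 1 => fun x => Finset.univ.sup' Finset.univ_nonempty
      fun a => M.r (x, a) + ∫ y, bellman M n y ∂(M.p (x, a))

theorem measurable_bellman (M : MDP X A) (n : ℕ) : Measurable (bellman M n) := by
  induction n with
  | zero => exact measurable_const
  | succ n ih =>
    have : bellman M (n + 1) = Finset.univ.sup' Finset.univ_nonempty
        fun a x => M.r (x, a) + ∫ y, bellman M n y ∂(M.p (x, a)) := by
      ext x; rw [Finset.sup'_apply]; rfl
    rw [this]
    exact Finset.measurable_sup' _ fun a _ =>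
      (M.r_measurable.add (measurable_integral_kernel M ih)).comp measurable_prodMk_right

theorem bellman_mem (M : MDP X A) (n : ℕ) (x : X) : bellman M n x ∈ Set.Icc (0 : ℝ) n := by
  induction n generalizing x with
  | zero => simp [bellman]
  | succ n ih =>
    have h : ∀ a, M.r (x, a) + ∫ y, bellman M n y ∂(M.p (x, a)) ∈ Set.Icc (0 : ℝ) (n + 1) := by
      intro a
      have h1 := M.r_mem (x, a)
      have h2 := integral_mem_Icc (ν := M.p (x, a)) (measurable_bellman M n) ih
      exact ⟨add_nonneg h1.1 h2.1, by linarith [h1.2, h2.2]⟩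
    push_cast
    constructor
    · obtain ⟨a⟩ := ‹Nonempty A›
      exact (h a).1.trans (Finset.le_sup'
        (fun a => M.r (x, a) + ∫ y, bellman M n y ∂(M.p (x, a))) (Finset.mem_univ a))
    · exact Finset.sup'_le Finset.univ_nonempty _ fun a _ => (h a).2

theorem abs_bellman_le (M : MDP X A) (n : ℕ) (x : X) : |bellman M n x| ≤ n := by
  rw [abs_of_nonneg (bellman_mem M n x).1]; exact (bellman_mem M n x).2

theorem le_bellman_succ (M : MDP X A) (n : ℕ) (x : X) (a : A) :
    M.r (x, a) + ∫ y, bellman M n y ∂(M.p (x, a)) ≤ bellman M (n + 1) x :=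
  Finset.le_sup' (fun a => M.r (x, a) + ∫ y, bellman M n y ∂(M.p (x, a))) (Finset.mem_univ a)

theorem exists_bellman_succ_eq (M : MDP X A) (n : ℕ) (x : X) :
    ∃ a, bellman M (n + 1) x = M.r (x, a) + ∫ y, bellman M n y ∂(M.p (x, a)) := by
  obtain ⟨a, -, h⟩ := Finset.exists_mem_eq_sup' Finset.univ_nonempty
    fun a => M.r (x, a) + ∫ y, bellman M n y ∂(M.p (x, a))
  exact ⟨a, h⟩

theorem valueFrom_le_bellman (M : MDP X A) (π : Policy X A) (t n : ℕ) (x : X) :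
    valueFrom M π t n x ≤ bellman M n x := by
  induction n generalizing t x with
  | zero => simp [valueFrom_zero, bellman]
  | succ n ih =>
    have := (π t).2
    have hV : ∀ y, |valueFrom M π (t + 1) n y| ≤ n := fun y => by
      rw [abs_of_nonneg (valueFrom_mem M π _ n y).1]; exact (valueFrom_mem M π _ n y).2
    have hm : Measurable fun a => M.r (x, a) + ∫ y, valueFrom M π (t + 1) n y ∂(M.p (x, a)) :=
      (M.r_measurable.add (measurable_integral_kernel M
        (measurable_valueFrom M π (t + 1) n))).comp measurable_prodMk_left
    rw [valueFrom_succ]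
    have hle : ∀ a, M.r (x, a) + ∫ y, valueFrom M π (t + 1) n y ∂(M.p (x, a)) ≤
        bellman M (n + 1) x := fun a =>
      le_trans (add_le_add le_rfl (integral_mono_of_abs_le (measurable_valueFrom M π _ _)
        (measurable_bellman M n) hV (abs_bellman_le M n) (ih (t + 1)))) (le_bellman_succ M n x a)
    have h0 : ∀ a, 0 ≤ M.r (x, a) + ∫ y, valueFrom M π (t + 1) n y ∂(M.p (x, a)) := fun a =>
      add_nonneg (M.r_mem _).1 (integral_nonneg fun y => (valueFrom_mem M π _ n y).1)
    exact (integral_mem_Icc hm fun a => ⟨h0 a, hle a⟩).2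

/-- Only this inequality is needed: bounding the regret against the Bellman optimum bounds it
against the supremum over policies, with no measurable selection of maximisers. -/
theorem optValue_le_bellman [Nonempty (Policy X A)] (M : MDP X A) (x : X) :
    optValue M x ≤ bellman M M.H x :=
  ciSup_le fun π => valueFrom_le_bellman M π 0 M.H x

end Opt

theorem valueFrom_tablePolicy_succ [MeasurableSingletonClass X] [MeasurableSingletonClass A]
    (M : MDP X A) (G : Discretization X)
    (table : ℕ → G.net → A) (t n : ℕ) (x : X) :
    valueFrom M (tablePolicy G table) t (n + 1) x =
      M.r (x, table t (G.quant x)) +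
        ∫ y, valueFrom M (tablePolicy G table) (t + 1) n y ∂(M.p (x, table t (G.quant x))) := by
  rw [valueFrom_succ]
  simp [tablePolicy, Kernel.deterministic_apply]

/-- A function satisfying the Bellman inequality for a table policy is a lower bound for its
value. -/
theorem le_valueFrom_tablePolicy [MeasurableSingletonClass X] [MeasurableSingletonClass A]
    (M : MDP X A) (G : Discretization X) (table : ℕ → G.net → A) (w : ℕ → X → ℝ)
    (hw : ∀ n, Measurable (w n)) (b : ℝ) (hb : ∀ n y, |w n y| ≤ b) (hw0 : ∀ x, w 0 x ≤ 0) (H : ℕ)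
    (hrec : ∀ n < H, ∀ x, w (n + 1) x ≤ M.r (x, table (H - (n + 1)) (G.quant x)) +
      ∫ y, w n y ∂(M.p (x, table (H - (n + 1)) (G.quant x)))) :
    ∀ n ≤ H, ∀ x, w n x ≤ valueFrom M (tablePolicy G table) (H - n) n x := by
  intro n
  induction n with
  | zero => intro _ x; simpa [valueFrom_zero] using hw0 x
  | succ n ih =>
    intro hn x
    rw [valueFrom_tablePolicy_succ]
    refine (hrec n hn x).trans (add_le_add le_rfl ?_)
    rw [show H - (n + 1) + 1 = H - n by omega]
    refine integral_mono_of_abs_le (hw n) (measurable_valueFrom M _ _ _) (b := max b n)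
      (fun y => (hb n y).trans (le_max_left _ _)) (fun y => ?_) (ih (by omega))
    rw [abs_of_nonneg (valueFrom_mem M _ _ n y).1]
    exact (valueFrom_mem M _ _ n y).2.trans (le_max_right _ _)

end Mdp

end

section

/-! ### Bernstein and Hoeffding inequalities for empirical means and variances -/

section Concentration

/-- The difference `h0` of the two sides has derivative `h1`, which is increasing because `(1 - x)
e^x ≤ 1` and vanishes at `0`. So `h0` has its minimum, namely `0`, at the origin. -/
theorem Real.one_sub_div_three_mul_exp_sub_le (x : ℝ) :
    (1 - x / 3) * (Real.exp x - 1 - x) ≤ x ^ 2 / 2 := by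
  let h1 : ℝ → ℝ := fun x => x + (Real.exp x - 1 - x) / 3 - (1 - x / 3) * (Real.exp x - 1)
  let h0 : ℝ → ℝ := fun x => x ^ 2 / 2 - (1 - x / 3) * (Real.exp x - 1 - x)
  have d1 : ∀ x, HasDerivAt h1 ((1 - (1 - x) * Real.exp x) / 3) x := by
    intro x
    have := ((hasDerivAt_id x).add ((((Real.hasDerivAt_exp x).sub_const 1).sub
      (hasDerivAt_id x)).div_const 3)).sub
      ((((hasDerivAt_id x).div_const 3).const_sub 1).mul ((Real.hasDerivAt_exp x).sub_const 1))
    refine this.congr_deriv ?_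
    simp only [id]; ring
  have d0 : ∀ x, HasDerivAt h0 (h1 x) x := by
    intro x
    have := (((hasDerivAt_id x).pow 2).div_const 2).sub
      ((((hasDerivAt_id x).div_const 3).const_sub 1).mul
        (((Real.hasDerivAt_exp x).sub_const 1).sub (hasDerivAt_id x)))
    refine this.congr_deriv ?_
    simp only [id, h1, Pi.sub_apply]; ring
  have m1 : Monotone h1 := monotone_of_deriv_nonneg (fun x => (d1 x).differentiableAt) fun x => by
    rw [(d1 x).deriv]
    have h := Real.add_one_le_exp (-x)
    have : (1 - x) * Real.exp x ≤ Real.exp (-x) * Real.exp x :=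
      mul_le_mul_of_nonneg_right (by linarith) (Real.exp_pos x).le
    rw [← Real.exp_add, neg_add_cancel, Real.exp_zero] at this
    linarith
  have h10 : h1 0 = 0 := by simp [h1]
  have h00 : h0 0 = 0 := by simp [h0]
  have c0 : Continuous h0 :=
    continuous_iff_continuousAt.2 fun x => (d0 x).continuousAt
  suffices 0 ≤ h0 x by simpa [h0] using this
  rcases le_total 0 x with hx | hx
  · have := monotoneOn_of_deriv_nonneg (convex_Ici (0 : ℝ)) c0.continuousOn
      (fun y _ => (d0 y).differentiableAt.differentiableWithinAt) (fun y hy => by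
        rw [interior_Ici] at hy
        rw [(d0 y).deriv, ← h10]; exact m1 (le_of_lt hy))
    rw [← h00]; exact this Set.self_mem_Ici hx hx
  · have := antitoneOn_of_deriv_nonpos (convex_Iic (0 : ℝ)) c0.continuousOn
      (fun y _ => (d0 y).differentiableAt.differentiableWithinAt) (fun y hy => by
        rw [interior_Iic] at hy
        rw [(d0 y).deriv, ← h10]; exact m1 (le_of_lt hy))
    rw [← h00]; exact this hx Set.self_mem_Iic hx

theorem Real.exp_le_one_add_add_sq {x y : ℝ} (hxy : x ≤ y) (hy : y < 3) :
    Real.exp x ≤ 1 + x + x ^ 2 / (2 * (1 - y / 3)) := by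
  have h := Real.one_sub_div_three_mul_exp_sub_le x
  have hp : 0 < 1 - y / 3 := by linarith
  have hnn : 0 ≤ Real.exp x - 1 - x := by linarith [Real.add_one_le_exp x]
  have : Real.exp x - 1 - x ≤ x ^ 2 / (2 * (1 - y / 3)) := by
    rw [le_div_iff₀ (by positivity)]
    nlinarith
  linarith

/-- The exponent in Bernstein's inequality. -/
theorem exists_bernstein_exponent {σ b θ : ℝ} (hσ : 0 ≤ σ) (hb : 0 < b) (hθ : 0 < θ) :
    ∃ t, 0 ≤ t ∧ t * b < 3 ∧
      -t * (Real.sqrt (2 * θ * σ) + 2 / 3 * θ * b) + t ^ 2 * σ / (2 * (1 - t * b / 3)) ≤ -θ := by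
  rcases hσ.eq_or_lt with rfl | hσ
  -- Without variance the general choice below would give `t * b = 3`, where the denominator
  -- vanishes. Half of that value is enough.
  · refine ⟨3 / (2 * b), by positivity, ?_, ?_⟩
    · rw [div_mul_eq_mul_div, div_lt_iff₀ (by positivity)]; nlinarith
    · simp only [mul_zero, Real.sqrt_zero, zero_add, zero_div, add_zero]
      apply le_of_eq; field_simp
  · set g := Real.sqrt (2 * θ * σ) with hg
    have hg2 : g ^ 2 = 2 * θ * σ := Real.sq_sqrt (by positivity)
    have hg0 : 0 ≤ g := Real.sqrt_nonneg _
    set e := g + 2 / 3 * θ * b with he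
    have he0 : 0 < e := by positivity
    set s := σ + b * e / 3 with hs
    have hs0 : 0 < s := by positivity
    have h1 : 1 - e / s * b / 3 = σ / s := by field_simp; rw [hs]; ring
    -- This is the usual optimal exponent for the deviation `e`: it turns `1 - t b / 3` into `σ / s`
    -- and the whole expression into `-e² / (2s)`. What remains is `2 s θ ≤ e²`, whose two sides
    -- differ by the nonnegative term `2/3 θ b g`.
    refine ⟨e / s, by positivity, ?_, ?_⟩
    · have : 0 < 1 - e / s * b / 3 := by rw [h1]; positivity
      linarith
    · rw [h1]
      have : -(e / s) * e + (e / s) ^ 2 * σ / (2 * (σ / s)) = -(e ^ 2 / (2 * s)) := by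
        field_simp; ring
      rw [this, neg_le_neg_iff, le_div_iff₀ (by positivity)]
      have : e ^ 2 = g ^ 2 + 4 / 3 * θ * b * g + (2 / 3 * θ * b) ^ 2 := by rw [he]; ring
      rw [this, hg2, hs, he]
      nlinarith [mul_nonneg (mul_nonneg hθ.le hb.le) hg0]

variable {Ω : Type*} [MeasurableSpace Ω] {μ : Measure Ω} [IsProbabilityMeasure μ]

/-- **Bernstein's inequality** for centered bounded independent random variables. -/
theorem measureReal_bernstein_le {Y : ℕ → Ω → ℝ} (hind : iIndepFun Y μ)
    (hm : ∀ i, Measurable (Y i)) {b σ θ : ℝ} (hb : 0 < b) (hσ : 0 ≤ σ) (hθ : 0 < θ)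
    (hY : ∀ i ω, |Y i ω| ≤ b) (h0 : ∀ i, ∫ ω, Y i ω ∂μ = 0) (h2 : ∀ i, ∫ ω, Y i ω ^ 2 ∂μ ≤ σ)
    (m : ℕ) :
    μ.real {ω | m * (Real.sqrt (2 * θ * σ) + 2 / 3 * θ * b) ≤ ∑ i ∈ Finset.range m, Y i ω} ≤
      Real.exp (-(m * θ)) := by
  obtain ⟨t, ht0, htb, ht⟩ := exists_bernstein_exponent hσ hb hθ
  have hp : 0 < 1 - t * b / 3 := by linarith
  have hint : ∀ i, Integrable (fun ω => Real.exp (t * Y i ω)) μ := fun i =>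
    integrable_of_abs_le ((hm i).const_mul t).exp (b := Real.exp (t * b)) fun ω => by
      rw [abs_of_pos (Real.exp_pos _), Real.exp_le_exp]
      exact mul_le_mul_of_nonneg_left (le_of_abs_le (hY i ω)) ht0
  have hmgf : ∀ i, mgf (Y i) μ t ≤ Real.exp (t ^ 2 * σ / (2 * (1 - t * b / 3))) := by
    intro i
    have hi1 : Integrable (Y i) μ := integrable_of_abs_le (hm i) (hY i)
    have hi2 : Integrable (fun ω => Y i ω ^ 2) μ :=
      integrable_of_abs_le ((hm i).pow_const 2) (b := b ^ 2) fun ω => by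
        rw [abs_pow]; exact pow_le_pow_left₀ (abs_nonneg _) (hY i ω) 2
    have hi3 : Integrable (fun ω => 1 + t * Y i ω) μ := (integrable_const 1).add (hi1.const_mul t)
    calc mgf (Y i) μ t
        ≤ ∫ ω, (1 + t * Y i ω + t ^ 2 / (2 * (1 - t * b / 3)) * Y i ω ^ 2) ∂μ := by
          refine integral_mono (hint i)
            (hi3.add (hi2.const_mul _)) fun ω => ?_
          have := Real.exp_le_one_add_add_sq
            (mul_le_mul_of_nonneg_left (le_of_abs_le (hY i ω)) ht0) htb
          calc _ ≤ _ := this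
            _ = _ := by ring
      _ = 1 + t ^ 2 / (2 * (1 - t * b / 3)) * ∫ ω, Y i ω ^ 2 ∂μ := by
          rw [integral_add hi3 (hi2.const_mul _),
            integral_add (integrable_const 1) (hi1.const_mul t), integral_const_mul,
            integral_const_mul, h0 i]
          simp
      _ ≤ 1 + t ^ 2 / (2 * (1 - t * b / 3)) * σ := by
          have : 0 ≤ t ^ 2 / (2 * (1 - t * b / 3)) := by positivity
          linarith [mul_le_mul_of_nonneg_left (h2 i) this]
      _ ≤ _ := by
          have := Real.add_one_le_exp (t ^ 2 * σ / (2 * (1 - t * b / 3)))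
          calc _ = t ^ 2 * σ / (2 * (1 - t * b / 3)) + 1 := by ring
            _ ≤ _ := this
  have hsum := measure_ge_le_exp_mul_mgf (μ := μ) (X := ∑ i ∈ Finset.range m, Y i)
    (m * (Real.sqrt (2 * θ * σ) + 2 / 3 * θ * b)) ht0
    (hind.integrable_exp_mul_sum hm fun i _ => hint i)
  simp only [Finset.sum_apply] at hsum
  refine hsum.trans ?_
  rw [hind.mgf_sum hm]
  calc _ ≤ Real.exp (-t * (m * (Real.sqrt (2 * θ * σ) + 2 / 3 * θ * b))) *
        ∏ i ∈ Finset.range m, Real.exp (t ^ 2 * σ / (2 * (1 - t * b / 3))) :=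
        mul_le_mul_of_nonneg_left
          (Finset.prod_le_prod (fun i _ => mgf_nonneg) fun i _ => hmgf i) (Real.exp_pos _).le
    _ = Real.exp (m * (-t * (Real.sqrt (2 * θ * σ) + 2 / 3 * θ * b) +
          t ^ 2 * σ / (2 * (1 - t * b / 3)))) := by
        rw [Finset.prod_const, Finset.card_range, ← Real.exp_nat_mul, ← Real.exp_add]
        congr 1; ring
    _ ≤ _ := by
        rw [Real.exp_le_exp]
        have := mul_le_mul_of_nonneg_left ht (Nat.cast_nonneg (α := ℝ) m)
        linarith

/-- Two-sided bound for the deviation of an empirical mean, from one-sided bounds for sums. -/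
theorem measureReal_lt_abs_empMean_sub_le {W : ℕ → Ω → ℝ} {e d p : ℝ} {m : ℕ} (hm : 1 ≤ m)
    (h1 : μ.real {ω | m * d ≤ ∑ i ∈ Finset.range m, (W i ω - e)} ≤ p)
    (h2 : μ.real {ω | m * d ≤ ∑ i ∈ Finset.range m, (-(W i ω - e))} ≤ p) :
    μ.real {ω | d < |empMean m (fun i => W i ω) - e|} ≤ 2 * p := by
  have hm' : (0 : ℝ) < m := by exact_mod_cast hm
  have hsub : {ω | d < |empMean m (fun i => W i ω) - e|} ⊆
      {ω | m * d ≤ ∑ i ∈ Finset.range m, (W i ω - e)} ∪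
        {ω | m * d ≤ ∑ i ∈ Finset.range m, (-(W i ω - e))} := by
    intro ω hω
    have heq : ∑ i ∈ Finset.range m, (W i ω - e) = m * (empMean m (fun i => W i ω) - e) := by
      rw [Finset.sum_sub_distrib, empMean, mul_sub, ← mul_assoc, mul_one_div_cancel hm'.ne']
      simp
    simp only [Set.mem_union, Set.mem_ofPred_eq, Finset.sum_neg_distrib, heq] at hω ⊢
    rcases lt_abs.1 hω with h | h
    · left; exact mul_le_mul_of_nonneg_left h.le hm'.le
    · right; rw [← mul_neg]; exact mul_le_mul_of_nonneg_left h.le hm'.le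
  calc _ ≤ _ := measureReal_mono hsub
    _ ≤ _ := measureReal_union_le _ _
    _ ≤ _ := by linarith

theorem measureReal_bernstein_empMean_le {W : ℕ → Ω → ℝ} (hind : iIndepFun W μ)
    (hm : ∀ i, Measurable (W i)) {b σ θ e : ℝ} (hb : 0 < b) (hσ : 0 ≤ σ) (hθ : 0 < θ)
    (hW : ∀ i ω, W i ω ∈ Set.Icc 0 b) (he : ∀ i, ∫ ω, W i ω ∂μ = e)
    (h2 : ∀ i, ∫ ω, W i ω ^ 2 ∂μ - e ^ 2 ≤ σ) {m : ℕ} (hm1 : 1 ≤ m) :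
    μ.real {ω | Real.sqrt (2 * θ * σ) + 2 / 3 * θ * b < |empMean m (fun i => W i ω) - e|} ≤
      2 * Real.exp (-(m * θ)) := by
  have heb : e ∈ Set.Icc 0 b := by rw [← he 0]; exact integral_mem_Icc (hm 0) (hW 0)
  have hab : ∀ i ω, |W i ω - e| ≤ b := fun i ω => by
    have h1 := hW i ω
    rw [abs_le]; constructor <;> linarith [h1.1, h1.2, heb.1, heb.2]
  have hi : ∀ i, Integrable (W i) μ := fun i => Integrable.of_mem_Icc 0 b (hm i).aemeasurable
    (ae_of_all _ (hW i))
  have hi2 : ∀ i, Integrable (fun ω => W i ω ^ 2) μ := fun i =>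
    integrable_of_abs_le ((hm i).pow_const 2) (b := b ^ 2) fun ω => by
      rw [abs_pow]
      exact pow_le_pow_left₀ (abs_nonneg _) (by rw [abs_of_nonneg (hW i ω).1]; exact (hW i ω).2) 2
  have h0 : ∀ i, ∫ ω, (W i ω - e) ∂μ = 0 := fun i => by
    rw [integral_sub (hi i) (integrable_const _), he i]; simp
  have hsq : ∀ i, ∫ ω, (W i ω - e) ^ 2 ∂μ ≤ σ := fun i => by
    have : ∀ ω, (W i ω - e) ^ 2 = W i ω ^ 2 - 2 * e * W i ω + e ^ 2 := fun ω => by ring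
    simp_rw [this]
    have hi3 : Integrable (fun ω => W i ω ^ 2 - 2 * e * W i ω) μ :=
      (hi2 i).sub ((hi i).const_mul _)
    rw [integral_add hi3 (integrable_const _),
      integral_sub (hi2 i) ((hi i).const_mul _), integral_const_mul, he i]
    simp only [integral_const, probReal_univ, smul_eq_mul]
    linarith [h2 i]
  refine measureReal_lt_abs_empMean_sub_le hm1 ?_ ?_
  · exact measureReal_bernstein_le (Y := fun i ω => W i ω - e)
      (hind.comp (fun _ x => x - e) fun _ => measurable_id.sub_const e)
      (fun i => (hm i).sub_const e) hb hσ hθ hab h0 hsq m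
  · exact measureReal_bernstein_le (Y := fun i ω => -(W i ω - e))
      (hind.comp (fun _ x => -(x - e)) fun _ => (measurable_id.sub_const e).neg)
      (fun i => ((hm i).sub_const e).neg) hb hσ hθ (fun i ω => by rw [abs_neg]; exact hab i ω)
      (fun i => by rw [integral_neg, h0 i, neg_zero]) (fun i => by simpa only [neg_sq] using hsq i) m

/-- **Hoeffding's inequality** for the empirical mean. -/
theorem measureReal_hoeffding_empMean_le {W : ℕ → Ω → ℝ} (hind : iIndepFun W μ)
    (hm : ∀ i, Measurable (W i)) {b θ e : ℝ} (hb : 0 < b) (hθ : 0 ≤ θ)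
    (hW : ∀ i ω, W i ω ∈ Set.Icc 0 b) (he : ∀ i, ∫ ω, W i ω ∂μ = e) {m : ℕ} (hm1 : 1 ≤ m) :
    μ.real {ω | b * Real.sqrt (θ / 2) < |empMean m (fun i => W i ω) - e|} ≤
      2 * Real.exp (-(m * θ)) := by
  have hm' : (0 : ℝ) < m := by exact_mod_cast hm1
  have hexp : Real.exp (-(m * (b * Real.sqrt (θ / 2))) ^ 2 /
      (2 * m * ((‖b - 0‖₊ / 2) ^ 2 : NNReal))) = Real.exp (-(m * θ)) := by
    congr 1
    push_cast
    rw [sub_zero, Real.norm_of_nonneg hb.le, mul_pow, mul_pow,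
      Real.sq_sqrt (by positivity)]
    field_simp
  have hs : ∀ i, HasSubgaussianMGF (fun ω => W i ω - e) ((‖b - 0‖₊ / 2) ^ 2) μ := fun i => by
    have := hasSubgaussianMGF_of_mem_Icc (μ := μ) (X := W i) (a := 0) (b := b)
      (hm i).aemeasurable (ae_of_all _ (hW i))
    rwa [he i] at this
  refine measureReal_lt_abs_empMean_sub_le hm1 ?_ ?_
  · rw [← hexp]
    exact HasSubgaussianMGF.measure_sum_range_ge_le_of_iIndepFun
      (hind.comp (fun _ x => x - e) fun _ => measurable_id.sub_const e)
      (fun i _ => hs i) (by positivity)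
  · rw [← hexp]
    exact HasSubgaussianMGF.measure_sum_range_ge_le_of_iIndepFun
      (hind.comp (fun _ x => -(x - e)) fun _ => (measurable_id.sub_const e).neg)
      (fun i _ => (hs i).neg) (by positivity)

/-- Simultaneous concentration of the empirical mean and the empirical variance. -/
theorem measureReal_empMean_empVar_le {W : ℕ → Ω → ℝ} (hind : iIndepFun W μ)
    (hm : ∀ i, Measurable (W i)) {b σ θ e : ℝ} (hb : 0 < b) (hθ : 0 < θ)
    (hW : ∀ i ω, W i ω ∈ Set.Icc 0 b) (he : ∀ i, ∫ ω, W i ω ∂μ = e)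
    (h2 : ∀ i, ∫ ω, W i ω ^ 2 ∂μ - e ^ 2 = σ) {m : ℕ} (hm1 : 1 ≤ m) :
    μ.real {ω | ¬ (|empMean m (fun i => W i ω) - e| ≤ Real.sqrt (2 * θ * σ) + 2 / 3 * θ * b ∧
      |empMean m (fun i => W i ω ^ 2) - empMean m (fun i => W i ω) ^ 2 - σ| ≤
        4 * b ^ 2 * Real.sqrt (2 * θ))} ≤ 6 * Real.exp (-(m * θ)) := by
  have hm' : (0 : ℝ) < m := by exact_mod_cast hm1
  have heb : e ∈ Set.Icc 0 b := by rw [← he 0]; exact integral_mem_Icc (hm 0) (hW 0)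
  have hσ : 0 ≤ σ := by
    have := variance_nonneg (W 0) μ
    rwa [variance_eq_sub (memLp_of_bounded (ae_of_all _ (hW 0)) (hm 0).aestronglyMeasurable 2),
      he 0, show (∫ ω, (W 0 ^ 2) ω ∂μ) - e ^ 2 = σ from h2 0] at this
  have hsub : {ω | ¬ (|empMean m (fun i => W i ω) - e| ≤ Real.sqrt (2 * θ * σ) + 2 / 3 * θ * b ∧
      |empMean m (fun i => W i ω ^ 2) - empMean m (fun i => W i ω) ^ 2 - σ| ≤
        4 * b ^ 2 * Real.sqrt (2 * θ))} ⊆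
      {ω | Real.sqrt (2 * θ * σ) + 2 / 3 * θ * b < |empMean m (fun i => W i ω) - e|} ∪
      ({ω | b * Real.sqrt (θ / 2) < |empMean m (fun i => W i ω) - e|} ∪
      {ω | b ^ 2 * Real.sqrt (θ / 2) < |empMean m (fun i => W i ω ^ 2) - (σ + e ^ 2)|}) := by
    intro ω hω
    by_contra hc
    simp only [Set.mem_union, Set.mem_ofPred_eq, not_or, not_lt] at hc hω
    obtain ⟨c1, c2, c3⟩ := hc
    refine hω ⟨c1, ?_⟩
    set x := empMean m (fun i => W i ω)
    set z := empMean m (fun i => W i ω ^ 2)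
    have hx : x ∈ Set.Icc 0 b := by
      have hle : ∑ i ∈ Finset.range m, W i ω ≤ m * b := by
        calc _ ≤ ∑ i ∈ Finset.range m, b := Finset.sum_le_sum fun i _ => (hW i ω).2
          _ = _ := by simp
      refine ⟨mul_nonneg (by positivity) (Finset.sum_nonneg fun i _ => (hW i ω).1), ?_⟩
      simp only [x, empMean]
      rw [one_div, inv_mul_le_iff₀ hm']
      exact hle
    have hs : Real.sqrt (2 * θ) = 2 * Real.sqrt (θ / 2) := by
      rw [show 2 * θ = 2 ^ 2 * (θ / 2) by ring, Real.sqrt_mul (by norm_num),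
        Real.sqrt_sq (by norm_num)]
    have hsn := Real.sqrt_nonneg (θ / 2)
    -- The squared mean inherits at most `2b` times the Hoeffding error of the mean. Together with
    -- the error of the second moment this is `3 b² √(θ/2)`, well below the claimed `8 b² √(θ/2)`.
    have hsq : |x ^ 2 - e ^ 2| ≤ 2 * b * (b * Real.sqrt (θ / 2)) := by
      rw [show x ^ 2 - e ^ 2 = (x + e) * (x - e) by ring, abs_mul]
      refine mul_le_mul ?_ c2 (abs_nonneg _) (by positivity)
      rw [abs_of_nonneg (add_nonneg hx.1 heb.1)]; linarith [hx.2, heb.2]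
    rw [hs]
    have : z - x ^ 2 - σ = (z - (σ + e ^ 2)) - (x ^ 2 - e ^ 2) := by ring
    rw [this]
    refine (abs_sub _ _).trans ?_
    nlinarith [mul_nonneg (sq_nonneg b) hsn]
  have hW2 : ∀ i ω, W i ω ^ 2 ∈ Set.Icc 0 (b ^ 2) := fun i ω =>
    ⟨sq_nonneg _, pow_le_pow_left₀ (hW i ω).1 (hW i ω).2 2⟩
  have p1 := measureReal_bernstein_empMean_le hind hm hb hσ hθ hW he (fun i => (h2 i).le) hm1
  have p2 := measureReal_hoeffding_empMean_le hind hm hb hθ.le hW he hm1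
  have p3 := measureReal_hoeffding_empMean_le (W := fun i ω => W i ω ^ 2) (e := σ + e ^ 2)
    (hind.comp (fun _ x => x ^ 2) fun _ => measurable_id.pow_const 2)
    (fun i => (hm i).pow_const 2) (pow_pos hb 2) hθ.le hW2 (fun i => by linarith [h2 i]) hm1
  calc _ ≤ _ := measureReal_mono hsub
    _ ≤ _ := measureReal_union_le _ _
    _ ≤ _ := add_le_add le_rfl (measureReal_union_le _ _)
    _ ≤ _ := by linarith

end Concentration

end

section

/-! ### Means and variances under total variation perturbations -/

section TotalVariation

variable {X : Type*} [MeasurableSpace X]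

/-- Layer-cake formula: both integrals are integrals over `t ∈ (0, b]` of the mass of the superlevel
set `{t < f}`, and these masses differ by at most `lam` for every `t`. -/
theorem integral_le_integral_add_of_tv {ν₁ ν₂ : Measure X} [IsProbabilityMeasure ν₁]
    [IsProbabilityMeasure ν₂] {lam : ℝ}
    (h : ∀ B, MeasurableSet B → |ν₁.real B - ν₂.real B| ≤ lam) {f : X → ℝ} (hf : Measurable f)
    {b : ℝ} (hb : ∀ x, f x ∈ Set.Icc 0 b) (hb0 : 0 ≤ b) :
    ∫ x, f x ∂ν₁ ≤ ∫ x, f x ∂ν₂ + lam * b := by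
  have key : ∀ ν : Measure X, [IsProbabilityMeasure ν] →
      ∫ x, f x ∂ν = ∫ t in Set.Ioc 0 b, ν.real {x | t < f x} := by
    intro ν _
    rw [(Integrable.of_mem_Icc 0 b hf.aemeasurable
      (ae_of_all _ hb)).integral_eq_integral_meas_lt (ae_of_all _ fun x => (hb x).1)]
    refine setIntegral_eq_of_subset_of_forall_sdiff_eq_zero
      (measurableSet_Ioi (a := (0 : ℝ))) Set.Ioc_subset_Ioi_self fun t ht => ?_
    have : {x | t < f x} = ∅ := by
      ext x
      simp only [Set.mem_ofPred_eq, Set.mem_empty_iff_false, iff_false, not_lt]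
      simp only [Set.mem_sdiff, Set.mem_Ioi, Set.mem_Ioc, not_and, not_le] at ht
      exact (hb x).2.trans (ht.2 ht.1).le
    rw [this]; simp
  have hint : ∀ ν : Measure X, [IsProbabilityMeasure ν] →
      IntegrableOn (fun t : ℝ => ν.real {x | t < f x}) (Set.Ioc 0 b) := by
    intro ν _
    have hanti : Antitone fun t : ℝ => ν.real {x | t < f x} := fun s t hst =>
      measureReal_mono fun x (hx : t < f x) => lt_of_le_of_lt hst hx
    exact integrable_of_abs_le (b := 1) hanti.measurable fun t => by
      rw [abs_of_nonneg measureReal_nonneg]; exact measureReal_le_one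
  rw [key ν₁, key ν₂]
  have h2 : ∫ _t in Set.Ioc 0 b, lam = lam * b := by
    simp [hb0, mul_comm]
  rw [← h2, ← integral_add (hint ν₂) (integrable_const _)]
  refine integral_mono (hint ν₁) ((hint ν₂).add (integrable_const _)) fun t => ?_
  have := h {x | t < f x} (measurableSet_lt measurable_const hf)
  linarith [le_of_abs_le this]

/-- Variance of a function, as second moment minus squared mean. -/
def integralVar (ν : Measure X) (f : X → ℝ) : ℝ := ∫ x, f x ^ 2 ∂ν - (∫ x, f x ∂ν) ^ 2

variable {ν : Measure X} [IsProbabilityMeasure ν] {f g : X → ℝ} {b : ℝ}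

theorem integrable_mul_of_mem_Icc (hf : Measurable f) (hg : Measurable g)
    (hfb : ∀ x, f x ∈ Set.Icc 0 b) (hgb : ∀ x, g x ∈ Set.Icc 0 b) :
    Integrable (fun x => f x * g x) ν :=
  integrable_of_abs_le (hf.mul hg) (b := b * b) fun x => by
    rw [abs_of_nonneg (mul_nonneg (hfb x).1 (hgb x).1)]
    exact mul_le_mul (hfb x).2 (hgb x).2 (hgb x).1 ((hfb x).1.trans (hfb x).2)

theorem integrable_sq_of_mem_Icc (hf : Measurable f) (hfb : ∀ x, f x ∈ Set.Icc 0 b) :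
    Integrable (fun x => f x ^ 2) ν := by
  simpa only [sq] using integrable_mul_of_mem_Icc hf hf hfb hfb

theorem integral_sq_sub_const (hf : Measurable f) (hfb : ∀ x, f x ∈ Set.Icc 0 b) (c : ℝ) :
    ∫ x, (f x - c) ^ 2 ∂ν = integralVar ν f + (∫ x, f x ∂ν - c) ^ 2 := by
  have hi : Integrable f ν := Integrable.of_mem_Icc 0 b hf.aemeasurable (ae_of_all _ hfb)
  have hi2 : Integrable (fun x => f x ^ 2) ν := integrable_sq_of_mem_Icc hf hfb
  have h3 : Integrable (fun x => f x ^ 2 - 2 * c * f x) ν := hi2.sub (hi.const_mul _)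
  have : ∀ x, (f x - c) ^ 2 = f x ^ 2 - 2 * c * f x + c ^ 2 := fun x => by ring
  simp_rw [this]
  rw [integral_add h3 (integrable_const _), integral_sub hi2 (hi.const_mul _), integral_const_mul,
    integralVar]
  simp only [integral_const, probReal_univ, smul_eq_mul]
  ring

theorem integralVar_nonneg (hf : Measurable f) (hfb : ∀ x, f x ∈ Set.Icc 0 b) :
    0 ≤ integralVar ν f := by
  have h := integral_sq_sub_const (ν := ν) hf hfb (∫ x, f x ∂ν)
  rw [sub_self] at h
  have : 0 ≤ ∫ x, (f x - ∫ x, f x ∂ν) ^ 2 ∂ν := integral_nonneg fun x => sq_nonneg _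
  linarith [h]

/-- Popoviciu's inequality. -/
theorem integralVar_le (hf : Measurable f) (hfb : ∀ x, f x ∈ Set.Icc 0 b) :
    integralVar ν f ≤ (b / 2) ^ 2 := by
  have h := integral_sq_sub_const (ν := ν) hf hfb (b / 2)
  have h2 : ∫ x, (f x - b / 2) ^ 2 ∂ν ≤ (b / 2) ^ 2 :=
    (integral_mem_Icc (ν := ν) ((hf.sub_const _).pow_const 2) (a := 0) (b := (b / 2) ^ 2)
      fun x => ⟨sq_nonneg _, by have := hfb x; nlinarith [this.1, this.2]⟩).2
  nlinarith [sq_nonneg (∫ x, f x ∂ν - b / 2)]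

/-- The variance is the least second moment about a constant. Centring both measures at the
`ν₂`-mean reduces the claim to the comparison of integrals of the single function `(f - c)²`, which
takes values in `[0, b²]`. -/
theorem integralVar_le_add_of_tv {ν₂ : Measure X} [IsProbabilityMeasure ν₂] {lam : ℝ}
    (h : ∀ B, MeasurableSet B → |ν.real B - ν₂.real B| ≤ lam) (hf : Measurable f)
    (hfb : ∀ x, f x ∈ Set.Icc 0 b) :
    integralVar ν f ≤ integralVar ν₂ f + lam * b ^ 2 := by
  set c := ∫ x, f x ∂ν₂
  have hc : c ∈ Set.Icc 0 b := integral_mem_Icc hf hfb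
  have h1 := integral_sq_sub_const (ν := ν) hf hfb c
  have h2 := integral_sq_sub_const (ν := ν₂) hf hfb c
  have h3 := integral_le_integral_add_of_tv h (f := fun x => (f x - c) ^ 2)
    ((hf.sub_const c).pow_const 2) (b := b ^ 2) (fun x => ⟨sq_nonneg _, by
      have := hfb x
      rw [← sq_abs (f x - c)]
      refine pow_le_pow_left₀ (abs_nonneg _) (abs_le.2 ⟨?_, ?_⟩) 2 <;>
        linarith [this.1, this.2, hc.1, hc.2]⟩) (sq_nonneg b)
  have h4 : (∫ x, f x ∂ν₂ - c) ^ 2 = 0 := by simp [c]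
  nlinarith [sq_nonneg (∫ x, f x ∂ν - c)]

/-- Minkowski's inequality for standard deviations. -/
theorem sqrt_integralVar_sub_le (hf : Measurable f) (hg : Measurable g)
    (hfb : ∀ x, f x ∈ Set.Icc 0 b) (hgb : ∀ x, g x ∈ Set.Icc 0 b) :
    Real.sqrt (integralVar ν fun x => f x - g x) ≤
      Real.sqrt (integralVar ν f) + Real.sqrt (integralVar ν g) := by
  have hif : Integrable f ν := Integrable.of_mem_Icc 0 b hf.aemeasurable (ae_of_all _ hfb)
  have hig : Integrable g ν := Integrable.of_mem_Icc 0 b hg.aemeasurable (ae_of_all _ hgb)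
  have hff : Integrable (fun x => f x ^ 2) ν := integrable_sq_of_mem_Icc hf hfb
  have hgg : Integrable (fun x => g x ^ 2) ν := integrable_sq_of_mem_Icc hg hgb
  have hfg : Integrable (fun x => f x * g x) ν := integrable_mul_of_mem_Icc hf hg hfb hgb
  -- `k` is the covariance. The variance of `f - s g` is a nonnegative quadratic in `s`, so its
  -- discriminant is nonpositive: this is Cauchy–Schwarz for `k`, and `s = 1` gives the claim.
  set k := ∫ x, f x * g x ∂ν - (∫ x, f x ∂ν) * ∫ x, g x ∂ν with hk
  have hvar : ∀ s : ℝ, integralVar ν (fun x => f x - s * g x) =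
      integralVar ν g * s ^ 2 - 2 * k * s + integralVar ν f := by
    intro s
    have e1 : ∀ x, (f x - s * g x) ^ 2 = f x ^ 2 - 2 * s * (f x * g x) + s ^ 2 * g x ^ 2 :=
      fun x => by ring
    have e2 : Integrable (fun x => f x ^ 2 - 2 * s * (f x * g x)) ν := hff.sub (hfg.const_mul _)
    rw [integralVar]
    simp_rw [e1]
    rw [integral_add e2 (hgg.const_mul _), integral_sub hff (hfg.const_mul _),
      integral_sub hif (hig.const_mul _), integral_const_mul, integral_const_mul,
      integral_const_mul, hk, integralVar, integralVar]
    ring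
  have hnn : ∀ s : ℝ, 0 ≤ integralVar ν (fun x => f x - s * g x) := by
    intro s
    have hm : Measurable fun x => f x - s * g x := hf.sub (hg.const_mul s)
    have hb' : ∀ x, |f x - s * g x| ≤ b + |s| * b := fun x => by
      refine (abs_sub _ _).trans (add_le_add ?_ ?_)
      · rw [abs_of_nonneg (hfb x).1]; exact (hfb x).2
      · rw [abs_mul, abs_of_nonneg (hgb x).1]
        exact mul_le_mul_of_nonneg_left (hgb x).2 (abs_nonneg s)
    have hv := variance_nonneg (fun x => f x - s * g x) ν
    rwa [variance_eq_sub (memLp_of_bounded (a := -(b + |s| * b)) (b := b + |s| * b)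
      (ae_of_all _ fun x => abs_le.1 (hb' x)) hm.aestronglyMeasurable 2)] at hv
  have hdisc : discrim (integralVar ν g) (-2 * k) (integralVar ν f) ≤ 0 :=
    discrim_le_zero fun s => by
      have := hnn s
      rw [hvar s] at this
      linarith
  have hF := integralVar_nonneg (ν := ν) hf hfb
  have hG := integralVar_nonneg (ν := ν) hg hgb
  have hk2 : -k ≤ Real.sqrt (integralVar ν f) * Real.sqrt (integralVar ν g) := by
    rw [← Real.sqrt_mul hF]
    apply Real.le_sqrt_of_sq_le
    rw [discrim] at hdisc
    nlinarith
  rw [Real.sqrt_le_left (by positivity)]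
  have h1 := hvar 1
  simp only [one_mul] at h1
  rw [h1, add_sq, Real.sq_sqrt hF, Real.sq_sqrt hG]
  linarith

end TotalVariation

/-! ### Real inequalities behind the Bernstein bonus -/

section Scalars

/-- No sign is imposed on `x`, which spares a proof that empirical variances are nonnegative. -/
theorem Real.sqrt_add_le_sqrt_add_sqrt (x : ℝ) {y : ℝ} (hy : 0 ≤ y) :
    Real.sqrt (x + y) ≤ Real.sqrt x + Real.sqrt y := by
  rw [Real.sqrt_le_left (by positivity), add_sq, Real.sq_sqrt hy]
  have h1 : x ≤ Real.sqrt x ^ 2 := by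
    rcases le_total 0 x with h | h
    · rw [Real.sq_sqrt h]
    · exact h.trans (sq_nonneg _)
  have := mul_nonneg (Real.sqrt_nonneg x) (Real.sqrt_nonneg y)
  nlinarith

theorem rpow_three_quarters_sq {x : ℝ} (hx : 0 ≤ x) :
    (x ^ (3 / 4 : ℝ)) ^ 2 = x * Real.sqrt x := by
  rw [← Real.rpow_natCast, ← Real.rpow_mul hx, Real.sqrt_eq_rpow]
  nth_rewrite 2 [← Real.rpow_one x]
  rw [← Real.rpow_add' hx (by norm_num)]
  norm_num

/-- Subadditivity of the square root: `2θ` times the variance error `4h²√(2θ)` is the square of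
`2(2θ)^(3/4) h`. This is the origin of the term with exponent `3/4` in `muHat`. -/
theorem abs_sqrt_sub_sqrt_le {θ σ τ h : ℝ} (hθ : 0 ≤ θ) (hh : 0 ≤ h)
    (hστ : |τ - σ| ≤ 4 * h ^ 2 * Real.sqrt (2 * θ)) :
    |Real.sqrt (2 * θ * τ) - Real.sqrt (2 * θ * σ)| ≤ 2 * (2 * θ) ^ (3 / 4 : ℝ) * h := by
  have hx : 0 ≤ (2 * θ) ^ (3 / 4 : ℝ) := Real.rpow_nonneg (by positivity) _
  have hq : Real.sqrt (2 * θ * (4 * h ^ 2 * Real.sqrt (2 * θ))) =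
      2 * (2 * θ) ^ (3 / 4 : ℝ) * h := by
    rw [show 2 * θ * (4 * h ^ 2 * Real.sqrt (2 * θ)) = (2 * (2 * θ) ^ (3 / 4 : ℝ) * h) ^ 2 by
      rw [mul_pow, mul_pow, rpow_three_quarters_sq (by positivity)]; ring]
    exact Real.sqrt_sq (by positivity)
  have key : ∀ a b : ℝ, a - b ≤ 4 * h ^ 2 * Real.sqrt (2 * θ) →
      Real.sqrt (2 * θ * a) - Real.sqrt (2 * θ * b) ≤ 2 * (2 * θ) ^ (3 / 4 : ℝ) * h := by
    intro a b hab
    have h1 : 2 * θ * a ≤ 2 * θ * b + 2 * θ * (4 * h ^ 2 * Real.sqrt (2 * θ)) := by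
      nlinarith
    have h2 := (Real.sqrt_le_sqrt h1).trans
      (Real.sqrt_add_le_sqrt_add_sqrt (2 * θ * b) (by positivity))
    rw [hq] at h2
    linarith
  rw [abs_le] at hστ ⊢
  constructor
  · linarith [key σ τ (by linarith [hστ.1])]
  · exact key τ σ hστ.2

/-- Bound for the statistical error in one step, in terms of the conditional variance `σV` of the
optimal value function. -/
theorem bonus_le {h ε θ lam σV σs : ℝ} (hh : 1 ≤ h) (hε : 0 < ε) (hθ : 0 < θ)
    (hθ' : θ ≤ min (ε ^ 2) 1 / (128 * h ^ 3)) (hlam : 0 ≤ lam) (hσV : 0 ≤ σV)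
    (hs : Real.sqrt σs ≤ Real.sqrt σV + (2 * ε + 8 * lam * h ^ 2) / 2 + Real.sqrt lam * h) :
    2 * Real.sqrt (2 * θ * σs) + (4 / 3 * θ + 4 * (2 * θ) ^ (3 / 4 : ℝ)) * h ≤
      ε / (4 * h ^ 2) * σV + (1 / 16 + 1 / 4 + 1 / 64 + 1 / 96 + 2 / 11) * (ε / h) +
        2 * lam * h := by
  have h0 : 0 < h := by linarith
  set q := Real.sqrt (2 * θ) with hq
  set x := (2 * θ) ^ (3 / 4 : ℝ) with hx
  set r := Real.sqrt h with hr
  set e := min ε 1 with he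
  set v := Real.sqrt σV with hv
  set l := Real.sqrt lam with hl
  have q0 : 0 < q := Real.sqrt_pos.2 (by positivity)
  have x0 : 0 ≤ x := Real.rpow_nonneg (by positivity) _
  have r1 : 1 ≤ r := Real.one_le_sqrt.2 hh
  have e0 : 0 < e := lt_min hε one_pos
  have e1 : e ≤ 1 := min_le_right _ _
  have eε : e ≤ ε := min_le_left _ _
  have l0 : 0 ≤ l := Real.sqrt_nonneg _
  have q2 : q ^ 2 = 2 * θ := Real.sq_sqrt (by positivity)
  have r2 : r ^ 2 = h := Real.sq_sqrt h0.le
  have v2 : v ^ 2 = σV := Real.sq_sqrt hσV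
  have l2 : l ^ 2 = lam := Real.sq_sqrt hlam
  have e2 : min (ε ^ 2) 1 = e ^ 2 := by
    rcases le_total ε 1 with h | h
    · rw [he, min_eq_left h, min_eq_left (by nlinarith)]
    · rw [he, min_eq_right h, min_eq_right (by nlinarith)]; ring
  have x2 : x ^ 2 = q ^ 3 := by
    rw [hx, rpow_three_quarters_sq (by positivity), ← hq, ← q2]; ring
  -- The choice of `m_j` in the form used throughout: `√(2θ) ≤ min(ε, 1) / (8 h^(3/2))`.
  have hq1 : q * (8 * (r * h)) ≤ e := by
    refine le_of_sq_le_sq ?_ e0.le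
    rw [e2, le_div_iff₀ (by positivity)] at hθ'
    calc (q * (8 * (r * h))) ^ 2 = q ^ 2 * (64 * (r ^ 2 * h ^ 2)) := by ring
      _ = θ * (128 * h ^ 3) := by rw [q2, r2]; ring
      _ ≤ e ^ 2 := hθ'
  have hqr : q * r ≤ ε / (8 * h) := by
    rw [le_div_iff₀ (by positivity)]; linarith
  have hqh : q ≤ 1 / (8 * h) := by
    rw [le_div_iff₀ (by positivity)]
    have : q * (8 * h) ≤ q * (8 * (r * h)) := by
      refine mul_le_mul_of_nonneg_left ?_ q0.le
      nlinarith
    linarith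
  have hqh' : q ≤ ε / (8 * h) := by
    have : q * 1 ≤ q * r := mul_le_mul_of_nonneg_left r1 q0.le
    linarith
  -- Since `x = q^(3/2)`, fourth powers are compared. The constant `22` works because `22⁴ = 234256
  -- ≤ 8⁶ = 262144`, and `e ≤ 1` lets `e⁶` be replaced by `e⁴`.
  have hx1 : x ≤ e / (22 * h ^ 2) := by
    refine le_of_sq_le_sq (le_of_sq_le_sq ?_ (sq_nonneg _)) (by positivity)
    have h6 : (q * (8 * (r * h))) ^ 6 ≤ e ^ 6 := pow_le_pow_left₀ (by positivity) hq1 6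
    have h6' : (q * (8 * (r * h))) ^ 6 = q ^ 6 * 262144 * h ^ 9 := by
      calc _ = q ^ 6 * 262144 * ((r ^ 2) ^ 3 * h ^ 6) := by ring
        _ = _ := by rw [r2]; ring
    have h4 : (x ^ 2) ^ 2 = q ^ 6 := by rw [x2]; ring
    rw [h4, ← pow_mul, div_pow, le_div_iff₀ (by positivity)]
    have h8 : h ^ 8 ≤ h ^ 9 := pow_le_pow_right₀ hh (by norm_num)
    have he6 : e ^ 6 ≤ e ^ (2 * 2) := pow_le_pow_of_le_one e0.le e1 (by norm_num)
    have hq6 : 0 ≤ q ^ 6 := by positivity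
    calc q ^ 6 * (22 * h ^ 2) ^ (2 * 2) = q ^ 6 * 234256 * h ^ 8 := by ring
      _ ≤ q ^ 6 * 262144 * h ^ 9 := by
        refine mul_le_mul (mul_le_mul_of_nonneg_left (by norm_num) hq6) h8 (by positivity)
          (by positivity)
      _ ≤ _ := by linarith
  -- AM-GM with weight `√h` trades the standard deviation for the variance, with the coefficient
  -- that the potential in `gapBound` can pay for.
  have t1 : q * v ≤ ε / (8 * h ^ 2) * σV + 1 / 32 * (ε / h) := by
    have a1 : v ≤ σV / r + r / 4 := by
      rw [← v2, div_add_div _ _ (by positivity) (by norm_num), le_div_iff₀ (by positivity)]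
      nlinarith [sq_nonneg (2 * v - r)]
    have a2 : q / r ≤ ε / (8 * h ^ 2) := by
      rw [div_le_div_iff₀ (by positivity) (by positivity)]
      have : q * (8 * (r * h)) * r ≤ ε * r := mul_le_mul_of_nonneg_right (hq1.trans eε) (by positivity)
      calc q * (8 * h ^ 2) = q * (8 * (r * h)) * r := by
            rw [← r2]; ring
        _ ≤ _ := this
    calc q * v ≤ q * (σV / r + r / 4) := mul_le_mul_of_nonneg_left a1 q0.le
      _ = q / r * σV + q * r / 4 := by field_simp
      _ ≤ ε / (8 * h ^ 2) * σV + ε / (8 * h) / 4 :=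
        add_le_add (mul_le_mul_of_nonneg_right a2 hσV) (by linarith)
      _ = _ := by field_simp; ring
  have t2 : q * (2 * ε + 8 * lam * h ^ 2) ≤ 1 / 4 * (ε / h) + lam * h := by
    calc _ ≤ 1 / (8 * h) * (2 * ε + 8 * lam * h ^ 2) :=
          mul_le_mul_of_nonneg_right hqh (by positivity)
      _ = _ := by field_simp; ring
  have hq2 : q ^ 2 * h ≤ 1 / 64 * (ε / h) := by
    calc q ^ 2 * h = q * q * h := by ring
      _ ≤ 1 / (8 * h) * (ε / (8 * h)) * h :=
          mul_le_mul_of_nonneg_right (mul_le_mul hqh hqh' q0.le (by positivity)) h0.le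
      _ = _ := by field_simp; norm_num
  have t3 : 2 * (q * (l * h)) ≤ 1 / 64 * (ε / h) + lam * h := by
    have : 2 * (q * l) ≤ q ^ 2 + lam := by
      have := sq_nonneg (q - l)
      rw [← l2]; linarith
    have := mul_le_mul_of_nonneg_right this h0.le
    linarith
  have t4 : 4 / 3 * θ * h ≤ 1 / 96 * (ε / h) := by
    have : θ = q ^ 2 / 2 := by rw [q2]; ring
    rw [this]; linarith
  have t5 : 4 * x * h ≤ 2 / 11 * (ε / h) := by
    calc 4 * x * h ≤ 4 * (ε / (22 * h ^ 2)) * h := by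
          have : x ≤ ε / (22 * h ^ 2) := hx1.trans (by gcongr)
          gcongr
      _ = _ := by field_simp; norm_num
  have hs' : Real.sqrt (2 * θ * σs) = q * Real.sqrt σs := Real.sqrt_mul (by positivity) _
  have t0 : q * Real.sqrt σs ≤ q * (v + (2 * ε + 8 * lam * h ^ 2) / 2 + l * h) :=
    mul_le_mul_of_nonneg_left hs q0.le
  have t6 : 2 * (ε / (8 * h ^ 2) * σV) = ε / (4 * h ^ 2) * σV := by field_simp; ring
  rw [hs']
  linarith

end Scalars

end

section

/-! ### Good events, invariants and one-step estimates for an epoch -/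

section Epoch

variable {X : Type u} {A : Type v} [MeasurableSpace X] [MeasurableSpace A]

/-- The discretisation error of `G` for the data of `M` is at most `lam`. -/
structure Discretization.IsApprox (G : Discretization X) (M : MDP X A) (lam : ℝ) : Prop where
  quant_self : ∀ s : G.net, G.quant s = s
  reward : ∀ x a, |M.r (x, a) - M.r (G.quant x, a)| ≤ lam
  kernel : ∀ x a (B : Set X), MeasurableSet B →
    |(M.p (x, a)).real B - (M.p (G.quant x, a)).real B| ≤ lam

/-- Expected value of a function of the representative state after one transition. -/
def netMean (M : MDP X A) (G : Discretization X) (f : G.net → ℝ) (z : X × A) : ℝ :=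
  ∫ y, f (G.quant y) ∂(M.p z)

/-- Variance of a function of the representative state after one transition. -/
def netVar (M : MDP X A) (G : Discretization X) (f : G.net → ℝ) (z : X × A) : ℝ :=
  integralVar (M.p z) fun y => f (G.quant y)

section Net

variable [MeasurableSingletonClass X] {M : MDP X A} {G : Discretization X} {lam : ℝ}

theorem Discretization.measurable_comp_quant (G : Discretization X) (f : G.net → ℝ) :
    Measurable fun x => f (G.quant x) :=
  (Measurable.of_discrete (f := f)).comp G.quant_measurable

theorem integrable_comp_quant (f : G.net → ℝ) (ν : Measure X) [IsFiniteMeasure ν] :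
    Integrable (fun y => f (G.quant y)) ν :=
  integrable_of_abs_le (G.measurable_comp_quant f) (b := ∑ s, |f s|) fun _ =>
    Finset.single_le_sum (f := fun s => |f s|) (fun _ _ => abs_nonneg _) (Finset.mem_univ _)

theorem netMean_mono {f g : G.net → ℝ} (h : ∀ s, f s ≤ g s) (z : X × A) :
    netMean M G f z ≤ netMean M G g z :=
  integral_mono (integrable_comp_quant f _) (integrable_comp_quant g _) fun _ => h _

theorem netMean_sub (f g : G.net → ℝ) (z : X × A) :
    netMean M G (fun s => f s - g s) z = netMean M G f z - netMean M G g z :=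
  integral_sub (integrable_comp_quant f _) (integrable_comp_quant g _)

theorem Discretization.IsApprox.netMean_le (hG : G.IsApprox M lam) {f : G.net → ℝ} {b : ℝ}
    (hf : ∀ s, f s ∈ Set.Icc 0 b) (x : X) (a : A) :
    netMean M G f (x, a) ≤ netMean M G f (G.quant x, a) + lam * b :=
  integral_le_integral_add_of_tv (hG.kernel x a) (G.measurable_comp_quant f) (fun _ => hf _)
    ((hf (G.quant x)).1.trans (hf (G.quant x)).2)

theorem Discretization.IsApprox.netMean_quant_le (hG : G.IsApprox M lam) {f : G.net → ℝ} {b : ℝ}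
    (hf : ∀ s, f s ∈ Set.Icc 0 b) (x : X) (a : A) :
    netMean M G f (G.quant x, a) ≤ netMean M G f (x, a) + lam * b :=
  integral_le_integral_add_of_tv (fun B hB => by rw [abs_sub_comm]; exact hG.kernel x a B hB)
    (G.measurable_comp_quant f) (fun _ => hf _) ((hf (G.quant x)).1.trans (hf (G.quant x)).2)

theorem Discretization.IsApprox.netVar_quant_le (hG : G.IsApprox M lam) {f : G.net → ℝ} {b : ℝ}
    (hf : ∀ s, f s ∈ Set.Icc 0 b) (x : X) (a : A) :
    netVar M G f (G.quant x, a) ≤ netVar M G f (x, a) + lam * b ^ 2 :=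
  integralVar_le_add_of_tv (fun B hB => by rw [abs_sub_comm]; exact hG.kernel x a B hB)
    (G.measurable_comp_quant f) (fun _ => hf _)

end Net

/-- The samples of epoch `k` from `p(· | s, a)` estimate mean and variance of `u` accurately. -/
def MeanGood (P : Params) (M : MDP X A) (G : Discretization X) (answer : Call G.net A → X)
    (u : G.net → ℝ) (k : ℕ) (s : G.net) (a : A) : Prop :=
  |empMean (P.m k) (fun i => u (G.quant (answer (.mean k s a i)))) - netMean M G u (s, a)| ≤
      Real.sqrt (2 * P.theta k * netVar M G u (s, a)) + 2 / 3 * P.theta k * P.H ∧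
    |empMean (P.m k) (fun i => u (G.quant (answer (.mean k s a i))) ^ 2) -
        empMean (P.m k) (fun i => u (G.quant (answer (.mean k s a i)))) ^ 2 -
        netVar M G u (s, a)| ≤ 4 * (P.H : ℝ) ^ 2 * Real.sqrt (2 * P.theta k)

/-- The bound for the increments of the value functions in epoch `k`. -/
def Params.incr (P : Params) (lam : ℝ) (k : ℕ) : ℝ := 2 * P.acc k + 8 * lam * (P.H : ℝ) ^ 2

/-- The samples of step `t` in epoch `k` from `p(· | s, a)` estimate the mean of `f` accurately. -/
def DiffGood (P : Params) (lam : ℝ) (M : MDP X A) (G : Discretization X)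
    (answer : Call G.net A → X) (f : G.net → ℝ) (k t : ℕ) (s : G.net) (a : A) : Prop :=
  |empMean P.ell (fun i => f (G.quant (answer (.diff k t s a i)))) - netMean M G f (s, a)| ≤
    P.incr lam k / (32 * P.H)

/-- All estimates in epoch `k`, started from `old`, are accurate. -/
def EpochGood [Finite A] [Nonempty A] (P : Params) (lam : ℝ) (M : MDP X A) (G : Discretization X)
    (answer : Call G.net A → X) (k : ℕ) (old : Iterate G.net A) : Prop :=
  ∀ n < P.H, ∀ s a,
    ((∀ s', old.val (P.H - (n + 1) + 1) s' ∈ Set.Icc (0 : ℝ) P.H) →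
      MeanGood P M G answer (old.val (P.H - (n + 1) + 1)) k s a) ∧
    ((∀ s', (backward P lam M.r G answer k old n).1 s' - old.val (P.H - (n + 1) + 1) s' ∈
        Set.Icc 0 (P.incr lam k)) →
      DiffGood P lam M G answer (fun s' => (backward P lam M.r G answer k old n).1 s' -
        old.val (P.H - (n + 1) + 1) s') k (P.H - (n + 1)) s a)

/-- The score of the action `a` in step `n + 1` of the backward recursion. -/
def score [Finite A] [Nonempty A] (P : Params) (lam : ℝ) (r : X × A → ℝ) (G : Discretization X)
    (answer : Call G.net A → X) (k : ℕ) (old : Iterate G.net A) (n : ℕ) (s : G.net) (a : A) : ℝ :=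
  r ((s : X), a) + muHat P lam G answer old.val k (P.H - (n + 1) + 1) s a +
    betaHat P lam G answer (backward P lam r G answer k old n).1
      (old.val (P.H - (n + 1) + 1)) k (P.H - (n + 1)) s a

theorem le_argmax {A : Type v} [Finite A] [Nonempty A] (f : A → ℝ) (a : A) : f a ≤ f (argmax f) :=
  (Finite.exists_max f).choose_spec a

section Backward

variable [Finite A] [Nonempty A] {P : Params} {lam : ℝ} {r : X × A → ℝ} {G : Discretization X}
  {answer : Call G.net A → X} {k : ℕ} {old : Iterate G.net A}

theorem backward_succ_fst (n : ℕ) (s : G.net) :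
    (backward P lam r G answer k old (n + 1)).1 s =
      max (old.val (P.H - (n + 1)) s)
        (score P lam r G answer k old n s (argmax (score P lam r G answer k old n s)) - lam) := by
  simp only [backward]
  split_ifs with h
  · rw [max_eq_left]; exact h
  · exact (max_eq_right (le_of_not_ge h)).symm

/-- In either case the value is tied to the action actually stored in the table: the old pair is
kept, or the value is the score of the new action minus `lam`. That is what makes the value function
a certificate for the table. -/
theorem backward_succ_cases (n : ℕ) (s : G.net) :
    ((backward P lam r G answer k old (n + 1)).1 s = old.val (P.H - (n + 1)) s ∧
      (backward P lam r G answer k old (n + 1)).2 s = old.pol (P.H - (n + 1)) s) ∨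
    (backward P lam r G answer k old (n + 1)).1 s = score P lam r G answer k old n s
      ((backward P lam r G answer k old (n + 1)).2 s) - lam := by
  simp only [backward]
  split_ifs with h
  · exact Or.inl ⟨rfl, rfl⟩
  · exact Or.inr rfl

end Backward

/-- Properties of the iterate that are preserved by the epochs of the algorithm: its value functions
are underestimates certified by its policy, and are close to the optimal value functions. -/
structure Iterate.IsValid [Fintype A] [Nonempty A] {G : Discretization X} (it : Iterate G.net A)
    (M : MDP X A) (lam ε : ℝ) : Prop where
  nonneg : ∀ t s, 0 ≤ it.val t s
  terminal : ∀ s, it.val M.H s = 0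
  policy_le : ∀ n < M.H, ∀ x, it.val (M.H - (n + 1)) (G.quant x) ≤
    M.r (x, it.pol (M.H - (n + 1)) (G.quant x)) +
      netMean M G (it.val (M.H - (n + 1) + 1)) (x, it.pol (M.H - (n + 1)) (G.quant x))
  gap : ∀ n ≤ M.H, ∀ x,
    bellman M n x - it.val (M.H - n) (G.quant x) ≤ ε + 8 * lam * (M.H : ℝ) ^ 2

section Step

variable [MeasurableSingletonClass X] [Fintype A] [Nonempty A] {P : Params} {M : MDP X A}
  {G : Discretization X} {lam : ℝ} {answer : Call G.net A → X} {k : ℕ} {old : Iterate G.net A}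

theorem netMean_le_integral_bellman {f : G.net → ℝ} {n : ℕ}
    (hf : ∀ x, f (G.quant x) ≤ bellman M n x) (z : X × A) :
    netMean M G f z ≤ ∫ y, bellman M n y ∂(M.p z) :=
  integral_mono (integrable_comp_quant f _)
    (integrable_of_abs_le (measurable_bellman M n) (abs_bellman_le M n)) hf

theorem Iterate.IsValid.le_bellman {ε : ℝ} (h : old.IsValid M lam ε) :
    ∀ n ≤ M.H, ∀ x, old.val (M.H - n) (G.quant x) ≤ bellman M n x := by
  intro n
  induction n with
  | zero => intro _ x; simp [h.terminal, bellman]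
  | succ n ih =>
    intro hn x
    refine (h.policy_le n hn x).trans (le_trans (add_le_add le_rfl ?_) (le_bellman_succ M n x _))
    rw [show M.H - (n + 1) + 1 = M.H - n by omega]
    exact netMean_le_integral_bellman (ih (by omega)) _

/-- The subtracted terms are an upper bound for the Bernstein width, with the true variance replaced
by the empirical one. So the estimate errs on the low side, by at most twice the width apart from
the `lam` term. The spare `lam * P.H` on the low side is used later for the change of state. -/
theorem muHat_bounds {u : ℕ → G.net → ℝ} {t : ℕ} {s : G.net} {a : A} (hθ : 0 ≤ P.theta k)
    (h : MeanGood P M G answer (u t) k s a) :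
    muHat P lam G answer u k t s a ≤ netMean M G (u t) (s, a) - lam * P.H ∧
    netMean M G (u t) (s, a) - 2 * Real.sqrt (2 * P.theta k * netVar M G (u t) (s, a)) -
      (4 / 3 * P.theta k + 4 * (2 * P.theta k) ^ (3 / 4 : ℝ)) * P.H - lam * P.H ≤
      muHat P lam G answer u k t s a := by
  obtain ⟨h1, h2⟩ := h
  have h3 := abs_sqrt_sub_sqrt_le hθ (Nat.cast_nonneg P.H) h2
  rw [abs_le] at h1 h3
  simp only [muHat, sigmaTilde]
  constructor <;> nlinarith [h1.1, h1.2, h3.1, h3.2]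

/-- The Hoeffding width `incr / (32H)` equals `ε/(16H) + λH/4`, less than the subtracted `ε/(4H) +
3λH/2`. Adding the two gives the coefficients `5/16` and `7/4` of the lower bound. -/
theorem betaHat_bounds {w o : G.net → ℝ} {t : ℕ} {s : G.net} {a : A} (hH : 1 ≤ P.H)
    (hlam : 0 ≤ lam) (hacc : 0 ≤ P.acc k)
    (h : DiffGood P lam M G answer (fun s' => w s' - o s') k t s a) :
    betaHat P lam G answer w o k t s a ≤ netMean M G w (s, a) - netMean M G o (s, a) ∧
    netMean M G w (s, a) - netMean M G o (s, a) - 5 / 16 * (P.acc k / P.H) - 7 / 4 * lam * P.H ≤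
      betaHat P lam G answer w o k t s a := by
  have hH' : (1 : ℝ) ≤ P.H := by exact_mod_cast hH
  have e : P.incr lam k / (32 * P.H) = 1 / 16 * (P.acc k / P.H) + 1 / 4 * lam * P.H := by
    rw [Params.incr]; field_simp; ring
  have e2 : P.acc k / (4 * P.H) = 1 / 4 * (P.acc k / P.H) := by field_simp
  have hn : 0 ≤ P.acc k / P.H := by positivity
  have hn2 : 0 ≤ lam * P.H := by positivity
  rw [DiffGood, netMean_sub, e, abs_le] at h
  simp only [betaHat]
  rw [e2]
  constructor <;> linarith [h.1, h.2]

/-- The potential `n v - v²` does not decrease under a Bellman step: the difference of the sides is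
`r(1 - r) + r(n - pv) + pv(1 - r)`. -/
theorem gap_arith {n r pv : ℝ} (hr : r ∈ Set.Icc (0 : ℝ) 1) (hpv : pv ∈ Set.Icc (0 : ℝ) n) :
    n * pv - pv ^ 2 ≤ (n + 1) * (r + pv) - (r + pv) ^ 2 := by
  nlinarith [mul_nonneg hr.1 (sub_nonneg.2 hr.2), mul_nonneg hr.1 (sub_nonneg.2 hpv.2),
    mul_nonneg hpv.1 (sub_nonneg.2 hr.2)]

/-- The error added in one step of the backward recursion with accuracy `ε`. -/
def stepError (h ε lam : ℝ) : ℝ :=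
  (1 / 16 + 1 / 4 + 1 / 64 + 1 / 96 + 2 / 11 + 5 / 16) * (ε / h) + 31 / 4 * lam * h

/-- The bound for the suboptimality of the value function with `n` remaining steps. -/
def gapBound (h ε lam : ℝ) (n : ℕ) (v : ℝ) : ℝ :=
  n * stepError h ε lam + ε / (4 * h ^ 2) * (n * v - v ^ 2)

/-- The potential is at most `h²/4`, hence costs at most `ε/16`. The `ε`-coefficients of `h` steps
sum to less than `15/16`, and `31/4 < 8`, so an epoch reaches its target accuracy. -/
theorem gapBound_le {h ε lam v : ℝ} {n : ℕ} (hn : (n : ℝ) ≤ h) (hh : 1 ≤ h) (hε : 0 ≤ ε)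
    (hlam : 0 ≤ lam) : gapBound h ε lam n v ≤ ε + 8 * lam * h ^ 2 := by
  have h0 : 0 < h := by linarith
  have hs : 0 ≤ stepError h ε lam := by unfold stepError; positivity
  have h1 : n * stepError h ε lam ≤ h * stepError h ε lam := mul_le_mul_of_nonneg_right hn hs
  have h2 : n * v - v ^ 2 ≤ h ^ 2 / 4 := by
    have : (n : ℝ) ^ 2 ≤ h ^ 2 := pow_le_pow_left₀ (by positivity) hn 2
    nlinarith [sq_nonneg (2 * v - n)]
  have h3 : ε / (4 * h ^ 2) * (n * v - v ^ 2) ≤ ε / (4 * h ^ 2) * (h ^ 2 / 4) :=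
    mul_le_mul_of_nonneg_left h2 (by positivity)
  have h4 : ε / (4 * h ^ 2) * (h ^ 2 / 4) = ε / 16 := by field_simp; norm_num
  have h5 : h * stepError h ε lam =
      (1 / 16 + 1 / 4 + 1 / 64 + 1 / 96 + 2 / 11 + 5 / 16) * ε + 31 / 4 * lam * h ^ 2 := by
    rw [stepError]; field_simp
  have h6 : 0 ≤ lam * h ^ 2 := by positivity
  rw [gapBound]
  linarith

/-- Standard deviation of the old value function at a representative state. -/
theorem sqrt_netVar_le (hG : G.IsApprox M lam) (hlam : 0 ≤ lam) {o : G.net → ℝ} {n : ℕ} {h D : ℝ}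
    (hn : (n : ℝ) ≤ h) (hD0 : 0 ≤ D) (ho : ∀ s, o s ∈ Set.Icc 0 h)
    (hle : ∀ x, o (G.quant x) ≤ bellman M n x)
    (hD : ∀ x, bellman M n x - o (G.quant x) ≤ D) (x : X) (a : A) :
    Real.sqrt (netVar M G o (G.quant x, a)) ≤
      Real.sqrt (integralVar (M.p (x, a)) (bellman M n)) + D / 2 + Real.sqrt lam * h := by
  have hh : 0 ≤ h := (Nat.cast_nonneg n).trans hn
  have hm := measurable_bellman M n
  have hmo := G.measurable_comp_quant o
  have h1 : Real.sqrt (netVar M G o (G.quant x, a)) ≤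
      Real.sqrt (netVar M G o (x, a)) + Real.sqrt lam * h := by
    refine (Real.sqrt_le_sqrt (hG.netVar_quant_le ho x a)).trans
      ((Real.sqrt_add_le_sqrt_add_sqrt _ (by positivity)).trans (le_of_eq ?_))
    rw [Real.sqrt_mul hlam, Real.sqrt_sq hh]
  -- The old function is written as `V - (V - o)`. The gap `V - o` has range `[0, D]`, so Popoviciu
  -- bounds its standard deviation by `D/2`; `max h D` is merely a common range for both functions.
  have h2 := sqrt_integralVar_sub_le (ν := M.p (x, a)) (b := max h D) hm (hm.sub hmo)
    (fun y => ⟨(bellman_mem M n y).1, ((bellman_mem M n y).2.trans hn).trans (le_max_left _ _)⟩)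
    (fun y => ⟨sub_nonneg.2 (hle y), (hD y).trans (le_max_right _ _)⟩)
  have h3 : Real.sqrt (integralVar (M.p (x, a)) fun y => bellman M n y - o (G.quant y)) ≤ D / 2 := by
    rw [Real.sqrt_le_left (by positivity)]
    exact integralVar_le (hm.sub hmo) fun y => ⟨sub_nonneg.2 (hle y), hD y⟩
  have h4 : (fun y => bellman M n y - (bellman M n y - o (G.quant y))) = fun y => o (G.quant y) := by
    ext y; ring
  simp only [Pi.sub_apply] at h2
  rw [h4] at h2
  rw [netVar] at h1 ⊢
  have h2' : Real.sqrt (integralVar (M.p (x, a)) fun y => o (G.quant y)) ≤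
    Real.sqrt (integralVar (M.p (x, a)) (bellman M n)) +
      Real.sqrt (integralVar (M.p (x, a)) fun y => bellman M n y - o (G.quant y)) := h2
  have h1' : Real.sqrt (integralVar (M.p (G.quant x, a)) fun y => o (G.quant y)) ≤
    Real.sqrt (integralVar (M.p (x, a)) fun y => o (G.quant y)) + Real.sqrt lam * h := h1
  linarith

end Step

end Epoch

end

section

/-! ### One epoch halves the statistical error -/

section EpochStep

variable {X : Type u} {A : Type v} [MeasurableSpace X] [MeasurableSpace A]
  [MeasurableSingletonClass X] [Fintype A] [Nonempty A] {P : Params} {M : MDP X A}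
  {G : Discretization X} {lam : ℝ} {answer : Call G.net A → X} {k : ℕ} {old : Iterate G.net A}

/-- The invariant of the induction inside an epoch, with `n` remaining time steps. -/
structure BackwardValid (P : Params) (lam : ℝ) (M : MDP X A) (G : Discretization X)
    (answer : Call G.net A → X) (k : ℕ) (old : Iterate G.net A) (n : ℕ) : Prop where
  mono : ∀ s, old.val (P.H - n) s ≤ (backward P lam M.r G answer k old n).1 s
  le_bellman : ∀ x, (backward P lam M.r G answer k old n).1 (G.quant x) ≤ bellman M n x
  gap : ∀ x, bellman M n x - (backward P lam M.r G answer k old n).1 (G.quant x) ≤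
    gapBound P.H (P.acc k) lam n (bellman M n x)

/-- The assumptions on the parameters of epoch `k`. -/
structure Params.EpochOK (P : Params) (k : ℕ) : Prop where
  H_pos : 1 ≤ P.H
  acc_pos : 0 < P.acc k
  theta_pos : 0 < P.theta k
  theta_le : P.theta k ≤ min (P.acc k ^ 2) 1 / (128 * (P.H : ℝ) ^ 3)

/-- The old mean cancels: `muHat` estimates the mean of the old function and `betaHat` that of `new
- old`, so their sum estimates the mean of the new one. -/
theorem score_bounds (hG : G.IsApprox M lam) (hlam : 0 ≤ lam) (hPH : P.H = M.H)
    (hP : P.EpochOK k) (hold : old.IsValid M lam (2 * P.acc k))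
    (hgood : EpochGood P lam M G answer k old) {n : ℕ} (hn : n < P.H)
    (hv : BackwardValid P lam M G answer k old n) (s : G.net) (a : A) :
    score P lam M.r G answer k old n s a ≤
      M.r (s, a) + netMean M G (backward P lam M.r G answer k old n).1 (s, a) - lam * P.H ∧
    M.r (s, a) + netMean M G (backward P lam M.r G answer k old n).1 (s, a) -
        (2 * Real.sqrt (2 * P.theta k * netVar M G (old.val (P.H - n)) (s, a)) +
          (4 / 3 * P.theta k + 4 * (2 * P.theta k) ^ (3 / 4 : ℝ)) * P.H) -
        5 / 16 * (P.acc k / P.H) - 11 / 4 * lam * P.H ≤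
      score P lam M.r G answer k old n s a := by
  have ht : P.H - (n + 1) + 1 = P.H - n := by omega
  obtain ⟨g1, g2⟩ := hgood n hn s a
  rw [ht] at g1 g2
  have hle : ∀ s : G.net, old.val (P.H - n) s ≤ bellman M n s := fun s => by
    have := hold.le_bellman n (by omega) s
    rwa [hG.quant_self, ← hPH] at this
  have hnH : (n : ℝ) ≤ P.H := by exact_mod_cast hn.le
  have m1 := muHat_bounds (lam := lam) hP.theta_pos.le (g1 fun s' => ⟨hold.nonneg _ _,
    (hle s').trans ((bellman_mem M n _).2.trans hnH)⟩)
  -- The new function lies between the old one and the optimum, so the increment is at most the gap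
  -- left by the previous epoch, which is `incr`.
  have m2 := betaHat_bounds hP.H_pos hlam hP.acc_pos.le (g2 fun s' => ⟨sub_nonneg.2 (hv.mono s'), by
    have h1 := hv.le_bellman s'
    have h2 := hold.gap n (by omega) s'
    rw [hG.quant_self] at h1 h2
    rw [Params.incr, hPH]
    rw [← hPH] at h2 ⊢
    linarith⟩)
  rw [score, ht]
  constructor
  · linarith [m1.1, m2.1]
  · linarith [m1.2, m2.2]

/-- Where the old action is kept, its certificate survives because the next value function only
grew. Where it is replaced, the score is an underestimate at the representative state, and the
subtracted `lam` and `lam * P.H` cover the change of reward and of kernel from there to `x`. -/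
theorem backward_policy_le (hG : G.IsApprox M lam) (hlam : 0 ≤ lam) (hPH : P.H = M.H)
    (hP : P.EpochOK k) (hold : old.IsValid M lam (2 * P.acc k))
    (hgood : EpochGood P lam M G answer k old) {n : ℕ} (hn : n < P.H)
    (hv : BackwardValid P lam M G answer k old n) (x : X) :
    (backward P lam M.r G answer k old (n + 1)).1 (G.quant x) ≤
      M.r (x, (backward P lam M.r G answer k old (n + 1)).2 (G.quant x)) +
        netMean M G (backward P lam M.r G answer k old n).1
          (x, (backward P lam M.r G answer k old (n + 1)).2 (G.quant x)) := by
  rcases backward_succ_cases (P := P) (lam := lam) (r := M.r) (G := G) (answer := answer) (k := k)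
    (old := old) n (G.quant x) with ⟨h1, h2⟩ | h1
  · rw [h1, h2, hPH]
    refine (hold.policy_le n (by omega) x).trans (add_le_add le_rfl (netMean_mono (fun s => ?_) _))
    rw [show M.H - (n + 1) + 1 = M.H - n by omega, ← hPH]
    exact hv.mono s
  · rw [h1]
    set a := (backward P lam M.r G answer k old (n + 1)).2 (G.quant x)
    have hs := (score_bounds hG hlam hPH hP hold hgood hn hv (G.quant x) a).1
    have hr := abs_le.1 (hG.reward x a)
    have hnH : (n : ℝ) ≤ P.H := by exact_mod_cast hn.le
    have hm := hG.netMean_quant_le (f := (backward P lam M.r G answer k old n).1) (b := P.H)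
      (fun s => ⟨(hold.nonneg _ _).trans (hv.mono s), by
        have := hv.le_bellman s
        rw [hG.quant_self] at this
        exact this.trans ((bellman_mem M n _).2.trans hnH)⟩) x a
    linarith [hr.1]

theorem backwardValid_succ (hG : G.IsApprox M lam) (hlam : 0 ≤ lam) (hPH : P.H = M.H)
    (hP : P.EpochOK k) (hold : old.IsValid M lam (2 * P.acc k))
    (hgood : EpochGood P lam M G answer k old) {n : ℕ} (hn : n < P.H)
    (hv : BackwardValid P lam M G answer k old n) :
    BackwardValid P lam M G answer k old (n + 1) where
  mono s := by rw [backward_succ_fst]; exact le_max_left _ _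
  le_bellman x := (backward_policy_le hG hlam hPH hP hold hgood hn hv x).trans
    ((add_le_add le_rfl (netMean_le_integral_bellman hv.le_bellman _)).trans
      (le_bellman_succ M n x _))
  gap x := by
    -- The comparison uses an optimal action at `x` itself; the maximal score at the representative
    -- state is at least the score of this action.
    obtain ⟨a, ha⟩ := exists_bellman_succ_eq M n x
    set w := (backward P lam M.r G answer k old n).1 with hw
    have hh1 : (1 : ℝ) ≤ P.H := by exact_mod_cast hP.H_pos
    have hnH : (n : ℝ) ≤ P.H := by exact_mod_cast hn.le
    set h := (P.H : ℝ) with hh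
    have hb := bellman_mem M n
    have hmb := measurable_bellman M n
    have hwb : ∀ s, w s ∈ Set.Icc 0 h := fun s => ⟨(hold.nonneg _ _).trans (hv.mono s), by
      have := hv.le_bellman s
      rw [hG.quant_self] at this
      exact this.trans ((hb _).2.trans hnH)⟩
    have hob : ∀ s, old.val (P.H - n) s ∈ Set.Icc 0 h := fun s =>
      ⟨hold.nonneg _ _, (hv.mono s).trans (hwb s).2⟩
    have hlow : score P lam M.r G answer k old n (G.quant x) a - lam ≤
        (backward P lam M.r G answer k old (n + 1)).1 (G.quant x) := by
      rw [backward_succ_fst]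
      refine le_trans ?_ (le_max_right _ _)
      linarith [le_argmax (score P lam M.r G answer k old n (G.quant x)) a]
    have hs := (score_bounds hG hlam hPH hP hold hgood hn hv (G.quant x) a).2
    have hr := abs_le.1 (hG.reward x a)
    have hm := hG.netMean_le hwb x a
    have hsd := sqrt_netVar_le hG hlam (o := old.val (P.H - n)) (D := 2 * P.acc k + 8 * lam * h ^ 2)
      hnH (by have := hP.acc_pos; positivity) hob
      (fun y => by rw [hPH]; exact hold.le_bellman n (by omega) y)
      (fun y => by rw [hh, hPH]; exact hold.gap n (by omega) y) x a
    have hbon := bonus_le hh1 hP.acc_pos hP.theta_pos hP.theta_le hlam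
      (integralVar_nonneg (ν := M.p (x, a)) hmb hb) hsd
    have hib : Integrable (bellman M n) (M.p (x, a)) :=
      integrable_of_abs_le hmb (abs_bellman_le M n)
    have hib2 : Integrable (fun y => bellman M n y ^ 2) (M.p (x, a)) :=
      integrable_sq_of_mem_Icc hmb hb
    -- The induction hypothesis is integrated before the potential is bounded. The second moment
    -- appearing here, compared with the squared mean, releases exactly the variance charged by
    -- `hbon`.
    have hint : ∫ y, bellman M n y ∂(M.p (x, a)) - netMean M G w (x, a) ≤
        n * stepError h (P.acc k) lam + P.acc k / (4 * h ^ 2) *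
          (n * (∫ y, bellman M n y ∂(M.p (x, a))) - ∫ y, bellman M n y ^ 2 ∂(M.p (x, a))) := by
      rw [netMean, ← integral_sub hib (integrable_comp_quant w _)]
      have e1 : Integrable (fun y => n * bellman M n y - bellman M n y ^ 2) (M.p (x, a)) :=
        (hib.const_mul _).sub hib2
      refine (integral_mono (hib.sub (integrable_comp_quant w _))
        ((integrable_const (n * stepError h (P.acc k) lam)).add
          (e1.const_mul (P.acc k / (4 * h ^ 2)))) hv.gap).trans (le_of_eq ?_)
      have e2 := integral_add (integrable_const (n * stepError h (P.acc k) lam))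
        (e1.const_mul (P.acc k / (4 * h ^ 2)))
      simp only [Pi.add_apply]
      rw [e2, integral_const, integral_const_mul, integral_sub (hib.const_mul _) hib2,
        integral_const_mul]
      simp
    have hpv := integral_mem_Icc (ν := M.p (x, a)) hmb hb
    have hga := gap_arith (M.r_mem (x, a)) hpv
    have hga' := mul_le_mul_of_nonneg_left hga
      (show 0 ≤ P.acc k / (4 * h ^ 2) by have := hP.acc_pos; positivity)
    have hlh : lam ≤ lam * h := le_mul_of_one_le_right hlam hh1
    rw [gapBound, ha]
    rw [integralVar] at hbon
    rw [stepError] at hint ⊢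
    push_cast
    -- Balance of the discretisation terms, in units of `lam * h`: `11/4` from the score, `2` from
    -- the bonus, and at most `1` each from the kernel, the reward and the `lam` subtracted from the
    -- maximal score. Together they are the `31/4` of `stepError`.
    linarith [hr.2]

theorem backwardValid (hG : G.IsApprox M lam) (hlam : 0 ≤ lam) (hPH : P.H = M.H)
    (hP : P.EpochOK k) (hold : old.IsValid M lam (2 * P.acc k))
    (hgood : EpochGood P lam M G answer k old) :
    ∀ n ≤ P.H, BackwardValid P lam M G answer k old n := by
  intro n
  induction n with
  | zero =>
    intro _
    refine ⟨fun s => ?_, fun x => ?_, fun x => ?_⟩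
    · rw [Nat.sub_zero, hPH, hold.terminal]; simp [backward]
    · simp [backward, bellman]
    · simp [backward, bellman, gapBound]
  | succ n ih => exact fun hn => backwardValid_succ hG hlam hPH hP hold hgood hn (ih (by omega))

/-- One epoch of the algorithm halves the statistical error. -/
theorem isValid_epoch (hG : G.IsApprox M lam) (hlam : 0 ≤ lam) (hPH : P.H = M.H)
    (hP : P.EpochOK k) (hold : old.IsValid M lam (2 * P.acc k))
    (hgood : EpochGood P lam M G answer k old) :
    Iterate.IsValid (⟨fun t => (backward P lam M.r G answer k old (P.H - t)).1,
      fun t => (backward P lam M.r G answer k old (P.H - t)).2⟩ : Iterate G.net A)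
      M lam (P.acc k) := by
  have hv := backwardValid hG hlam hPH hP hold hgood
  refine ⟨fun t s => ?_, fun s => ?_, fun n hn x => ?_, fun n hn x => ?_⟩
  · exact (hold.nonneg _ _).trans ((hv (P.H - t) (Nat.sub_le _ _)).mono s)
  · simp [hPH, backward]
  · have := backward_policy_le hG hlam hPH hP hold hgood (n := n) (by omega) (hv n (by omega)) x
    simp only
    rwa [show P.H - (M.H - (n + 1)) = n + 1 by omega, show P.H - (M.H - (n + 1) + 1) = n by omega]
  · have h1 := (hv n (by omega)).gap x
    simp only
    rw [show P.H - (M.H - n) = n by omega, ← hPH]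
    exact h1.trans (gapBound_le (by exact_mod_cast hPH ▸ hn) (by exact_mod_cast hP.H_pos)
      hP.acc_pos.le hlam)

theorem isValid_init (M : MDP X A) (hlam : 0 ≤ lam) (pol₀ : ℕ → G.net → A) :
    Iterate.IsValid (⟨fun _ _ => 0, pol₀⟩ : Iterate G.net A) M lam M.H := by
  refine ⟨fun _ _ => le_rfl, fun _ => rfl, fun n _ x => ?_, fun n hn x => ?_⟩
  · simpa [netMean] using (M.r_mem _).1
  · have : (n : ℝ) ≤ M.H := by exact_mod_cast hn
    have h2 : 0 ≤ 8 * lam * (M.H : ℝ) ^ 2 := by positivity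
    simp only [sub_zero]
    linarith [(bellman_mem M n x).2]

theorem isValid_iterate (hG : G.IsApprox M lam) (hlam : 0 ≤ lam) (hPH : P.H = M.H)
    (pol₀ : ℕ → G.net → A) {J : ℕ} (hP : ∀ k < J, P.EpochOK (k + 1))
    (hgood : ∀ k < J, EpochGood P lam M G answer (k + 1) (iterate P lam M.r G answer pol₀ k)) :
    (iterate P lam M.r G answer pol₀ J).IsValid M lam (P.acc J) := by
  induction J with
  | zero => simpa [iterate, Params.acc, hPH] using isValid_init M hlam pol₀
  | succ J ih =>
    refine isValid_epoch hG hlam hPH (hP J (by omega)) ?_ (hgood J (by omega))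
    have h := ih (fun k hk => hP k (by omega)) (fun k hk => hgood k (by omega))
    have e : 2 * P.acc (J + 1) = P.acc J := by
      simp only [Params.acc, pow_succ]; field_simp
    rw [e]; exact h

variable [MeasurableSingletonClass A]

/-- The policy of a valid iterate is nearly optimal. -/
theorem Iterate.IsValid.bellman_sub_value_le {ε : ℝ} (h : old.IsValid M lam ε) (x : X) :
    bellman M M.H x - value M (tablePolicy G old.pol) x ≤ ε + 8 * lam * (M.H : ℝ) ^ 2 := by
  have h1 := le_valueFrom_tablePolicy M G old.pol (fun n x => old.val (M.H - n) (G.quant x))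
    -- Validity gives no uniform upper bound at all times, but `M.H - n` is always one of the
    -- finitely many times up to `M.H`, so a crude sum serves as the bound.
    (fun n => G.measurable_comp_quant _) (∑ n ∈ Finset.range (M.H + 1), ∑ s, |old.val n s|)
    (fun n y => by
      have a1 : |old.val (M.H - n) (G.quant y)| ≤ ∑ s, |old.val (M.H - n) s| :=
        Finset.single_le_sum (f := fun s => |old.val (M.H - n) s|) (fun _ _ => abs_nonneg _)
          (Finset.mem_univ _)
      refine a1.trans (Finset.single_le_sum (f := fun n => ∑ s, |old.val n s|)
        (fun _ _ => Finset.sum_nonneg fun _ _ => abs_nonneg _) (Finset.mem_range.2 (by omega))))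
    (fun x => by simp [h.terminal]) M.H (fun n hn x => by
      have := h.policy_le n hn x
      rwa [show M.H - (n + 1) + 1 = M.H - n by omega] at this) M.H le_rfl x
  have h2 := h.gap M.H le_rfl x
  simp only [Nat.sub_self] at h1 h2
  have h3 : value M (tablePolicy G old.pol) x = valueFrom M (tablePolicy G old.pol) 0 M.H x := rfl
  rw [h3]
  linarith

end EpochStep

end

section

/-! ### Measurability of the value functions in the oracle answers -/

section Measurability

variable {X : Type u} {A : Type v} [MeasurableSpace X] [MeasurableSpace A]

theorem measurable_apply_countable {Ω S : Type*} {mΩ : MeasurableSpace Ω} [MeasurableSpace S]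
    [Countable S] [MeasurableSingletonClass S] {f : Ω → S → ℝ}
    (hf : ∀ s, Measurable fun ω => f ω s) {g : Ω → S} (hg : Measurable g) :
    Measurable fun ω => f ω (g ω) :=
  (measurable_from_prod_countable_left (f := fun z : Ω × S => f z.1 z.2) hf).comp
    (measurable_id.prodMk hg)

theorem measurable_empMean {Ω : Type*} {mΩ : MeasurableSpace Ω} {m : ℕ} {f : Ω → ℕ → ℝ}
    (hf : ∀ i, Measurable fun ω => f ω i) : Measurable fun ω => empMean m (f ω) := by
  simp only [empMean]
  exact (Finset.measurable_sum _ fun i _ => hf i).const_mul _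

/-- Only the maximal score must be measurable, and it is a finite supremum; the chosen maximiser
never has to be. -/
theorem apply_argmax_eq_sup' {A : Type v} [Fintype A] [Nonempty A] (f : A → ℝ) :
    f (argmax f) = Finset.univ.sup' Finset.univ_nonempty f :=
  le_antisymm (Finset.le_sup' f (Finset.mem_univ _))
    (Finset.sup'_le _ _ fun a _ => le_argmax f a)

variable [MeasurableSingletonClass X] [Fintype A] [Nonempty A] {P : Params} {lam : ℝ}
  {r : X × A → ℝ} {G : Discretization X} {Ω : Type*} {mΩ : MeasurableSpace Ω}
  {answer : Ω → Call G.net A → X} {k : ℕ}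

/-- The σ-algebra on `Ω` is arbitrary, and measurability is assumed only of the answers used so far:
later it is the σ-algebra generated by the earlier calls. With `n` steps done, only samples of times
from `P.H - n` on have been used. -/
theorem measurable_backward_fst {old : Ω → Iterate G.net A}
    (hold : ∀ t s, Measurable fun ω => (old ω).val t s)
    (hmean : ∀ s a i, Measurable fun ω => G.quant (answer ω (.mean k s a i))) (n : ℕ)
    (hdiff : ∀ t, P.H - n ≤ t → ∀ s a i,
      Measurable fun ω => G.quant (answer ω (.diff k t s a i))) (s : G.net) :
    Measurable fun ω => (backward P lam r G (answer ω) k (old ω) n).1 s := by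
  induction n generalizing s with
  | zero => exact measurable_const
  | succ n ih =>
    have ih' := ih fun t ht => hdiff t (by omega)
    simp only [backward_succ_fst]
    refine (hold _ s).max (Measurable.sub_const ?_ lam)
    simp only [apply_argmax_eq_sup']
    have e : (fun ω => Finset.univ.sup' Finset.univ_nonempty
        (score P lam r G (answer ω) k (old ω) n s)) = Finset.univ.sup' Finset.univ_nonempty
        (fun a ω => score P lam r G (answer ω) k (old ω) n s a) := by
      ext ω; rw [Finset.sup'_apply]
    rw [e]
    refine Finset.measurable_sup' _ fun a _ => ?_
    have h1 : ∀ i, Measurable fun ω =>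
        (old ω).val (P.H - (n + 1) + 1) (G.quant (answer ω (.mean k s a i))) := fun i =>
      measurable_apply_countable (hold _) (hmean s a i)
    have h2 : ∀ i, Measurable fun ω =>
        (backward P lam r G (answer ω) k (old ω) n).1
          (G.quant (answer ω (.diff k (P.H - (n + 1)) s a i))) -
        (old ω).val (P.H - (n + 1) + 1) (G.quant (answer ω (.diff k (P.H - (n + 1)) s a i))) :=
      fun i => (measurable_apply_countable ih' (hdiff _ le_rfl s a i)).sub
        (measurable_apply_countable (hold _) (hdiff _ le_rfl s a i))
    simp only [score, muHat, sigmaTilde, betaHat]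
    refine ((measurable_const.add ((((measurable_empMean h1).sub ?_)).sub_const _)).add
      (((measurable_empMean h2).sub_const _).sub_const _))
    exact (((measurable_empMean fun i => (h1 i).pow_const 2).sub
      ((measurable_empMean h1).pow_const 2)).const_mul _).sqrt

theorem measurable_iterate_val {pol₀ : ℕ → G.net → A}
    (hmean : ∀ k' ≤ k, ∀ s a i, Measurable fun ω => G.quant (answer ω (.mean k' s a i)))
    (hdiff : ∀ k' ≤ k, ∀ t s a i,
      Measurable fun ω => G.quant (answer ω (.diff k' t s a i))) (t : ℕ) (s : G.net) :
    Measurable fun ω => (iterate P lam r G (answer ω) pol₀ k).val t s := by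
  induction k generalizing t s with
  | zero => exact measurable_const
  | succ k ih =>
    exact measurable_backward_fst (old := fun ω => iterate P lam r G (answer ω) pol₀ k)
      (ih (fun k' hk => hmean k' (by omega)) fun k' hk => hdiff k' (by omega))
      (hmean _ le_rfl) _ (fun t _ => hdiff _ le_rfl t) s

/-- As a finite sum the mean is linear in the values of `f`, so its measurability for random `f` is
immediate. -/
theorem netMean_eq_sum (M : MDP X A) (G : Discretization X) (f : G.net → ℝ) (z : X × A) :
    netMean M G f z = ∑ s, (M.p z).real (G.quant ⁻¹' {s}) * f s := by
  have h1 : netMean M G f z = ∫ s, f s ∂((M.p z).map G.quant) :=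
    (integral_map G.quant_measurable.aemeasurable
      (Measurable.of_discrete (f := f)).aestronglyMeasurable).symm
  have : IsProbabilityMeasure ((M.p z).map G.quant) :=
    Measure.isProbabilityMeasure_map G.quant_measurable.aemeasurable
  rw [h1, integral_fintype (Integrable.of_finite)]
  refine Finset.sum_congr rfl fun s _ => ?_
  rw [map_measureReal_apply G.quant_measurable (measurableSet_singleton s), smul_eq_mul]

theorem measurable_netMean (M : MDP X A) {f : Ω → G.net → ℝ}
    (hf : ∀ s, Measurable fun ω => f ω s) (z : X × A) :
    Measurable fun ω => netMean M G (f ω) z := by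
  simp only [netMean_eq_sum]
  exact Finset.measurable_sum _ fun s _ => (hf s).const_mul _

theorem measurable_netVar (M : MDP X A) {f : Ω → G.net → ℝ}
    (hf : ∀ s, Measurable fun ω => f ω s) (z : X × A) :
    Measurable fun ω => netVar M G (f ω) z := by
  exact (measurable_netMean M (fun s => (hf s).pow_const 2) z).sub
    ((measurable_netMean M hf z).pow_const 2)

end Measurability

/-! ### Freezing independent random functions -/

section Freezing

variable {Ω E F : Type*} {mΩ : MeasurableSpace Ω} [MeasurableSpace E] [MeasurableSpace F]
  {μ : Measure Ω} [IsProbabilityMeasure μ]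

/-- A bound for the probability of an event about `(Y, Z)` that holds for all fixed values of `Y`
holds for `Y` independent of `Z`. -/
theorem measure_le_of_indepFun {Y : Ω → E} {Z : Ω → F} (hY : Measurable Y) (hZ : Measurable Z)
    (h : IndepFun Y Z μ) {B : Set (E × F)} (hB : MeasurableSet B) {c : ENNReal}
    (hc : ∀ y, μ {ω | (y, Z ω) ∈ B} ≤ c) : μ {ω | (Y ω, Z ω) ∈ B} ≤ c := by
  have h1 : μ {ω | (Y ω, Z ω) ∈ B} = ((μ.map Y).prod (μ.map Z)) B := by
    rw [← (indepFun_iff_map_prod_eq_prod_map_map hY.aemeasurable hZ.aemeasurable).1 h,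
      Measure.map_apply (hY.prodMk hZ) hB]
    rfl
  have := Measure.isProbabilityMeasure_map (μ := μ) hY.aemeasurable
  have := Measure.isProbabilityMeasure_map (μ := μ) hZ.aemeasurable
  rw [h1, Measure.prod_apply hB]
  calc ∫⁻ y, μ.map Z (Prod.mk y ⁻¹' B) ∂(μ.map Y) ≤ ∫⁻ _y, c ∂(μ.map Y) := by
        refine lintegral_mono fun y => ?_
        rw [Measure.map_apply hZ (measurable_prodMk_left hB)]
        exact hc y
    _ = c := by simp

/-- Block independence: quantities generated by disjoint sets of calls are independent. -/
theorem indepFun_of_disjoint {ι β : Type*} [mβ : MeasurableSpace β] {q : ι → Ω → β}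
    (hq : ∀ i, Measurable (q i)) (hind : iIndepFun q μ) {S T : Set ι} (hST : Disjoint S T)
    {Y : Ω → E} {Z : Ω → F} (hY : Measurable[⨆ i ∈ S, mβ.comap (q i)] Y)
    (hZ : Measurable[⨆ i ∈ T, mβ.comap (q i)] Z) : IndepFun Y Z μ := by
  rw [IndepFun_iff_Indep]
  exact indep_of_indep_of_le_left (indep_of_indep_of_le_right
    (indep_iSup_of_disjoint (fun i => (hq i).comap_le) hind hST) hZ.comap_le) hY.comap_le

end Freezing

end

section

/-! ### Elementary properties of sample sizes and logarithms -/

section Params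

variable {P : Params} {k : ℕ}

/-- Admissible parameters with at least one epoch. -/
structure Params.Admissible (P : Params) : Prop where
  H_pos : 1 ≤ P.H
  nS_pos : 1 ≤ P.nS
  nA_pos : 1 ≤ P.nA
  epochs_pos : 1 ≤ P.epochs
  δ_pos : 0 < P.δ
  δ_lt : P.δ < 1

namespace Params.Admissible

theorem one_le_prod (h : P.Admissible) : (1 : ℝ) ≤ P.H * P.nS * P.nA * P.epochs := by
  have h1 : (1 : ℝ) ≤ P.H := by exact_mod_cast h.H_pos
  have h2 : (1 : ℝ) ≤ P.nS := by exact_mod_cast h.nS_pos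
  have h3 : (1 : ℝ) ≤ P.nA := by exact_mod_cast h.nA_pos
  have h4 : (1 : ℝ) ≤ P.epochs := by exact_mod_cast h.epochs_pos
  exact one_le_mul_of_one_le_of_one_le (one_le_mul_of_one_le_of_one_le
    (one_le_mul_of_one_le_of_one_le h1 h2) h3) h4

theorem one_lt_arg (h : P.Admissible) {b : ℝ} (hb : 1 ≤ b) :
    1 < b * P.H * P.nS * P.nA * P.epochs / P.δ := by
  rw [lt_div_iff₀ h.δ_pos, one_mul]
  have := h.one_le_prod
  have := h.δ_lt
  calc P.δ < 1 := h.δ_lt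
    _ ≤ b * (P.H * P.nS * P.nA * P.epochs) := one_le_mul_of_one_le_of_one_le hb h.one_le_prod
    _ = _ := by ring

theorem logMean_pos (h : P.Admissible) : 0 < P.logMean :=
  Real.log_pos (h.one_lt_arg (by norm_num))

theorem acc_pos (h : P.Admissible) (k : ℕ) : 0 < P.acc k := by
  have : (0 : ℝ) < P.H := by exact_mod_cast h.H_pos
  unfold Params.acc; positivity

theorem m_pos (h : P.Admissible) (k : ℕ) : 1 ≤ P.m k := by
  have h1 : (0 : ℝ) < P.H := by exact_mod_cast h.H_pos
  have h2 := h.logMean_pos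
  have h3 := h.acc_pos k
  exact Nat.one_le_iff_ne_zero.2 (Nat.ceil_pos.2 (by positivity)).ne'

theorem m_mul_theta (h : P.Admissible) (k : ℕ) : P.m k * P.theta k = P.logMean := by
  have : (P.m k : ℝ) ≠ 0 := by exact_mod_cast Nat.one_le_iff_ne_zero.1 (h.m_pos k)
  rw [Params.theta]; field_simp

theorem epochOK (h : P.Admissible) (k : ℕ) : P.EpochOK k where
  H_pos := h.H_pos
  acc_pos := h.acc_pos k
  theta_pos := by
    have h1 : (0 : ℝ) < P.m k := by exact_mod_cast h.m_pos k
    have h2 := h.logMean_pos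
    unfold Params.theta; positivity
  theta_le := by
    have h0 : (0 : ℝ) < P.H := by exact_mod_cast h.H_pos
    have h1 : (0 : ℝ) < P.m k := by exact_mod_cast h.m_pos k
    have h2 : 0 < min (P.acc k ^ 2) 1 := lt_min (pow_pos (h.acc_pos k) 2) one_pos
    have h3 : 128 * (P.H : ℝ) ^ 3 / min (P.acc k ^ 2) 1 * P.logMean ≤ P.m k := Nat.le_ceil _
    rw [div_mul_eq_mul_div, div_le_iff₀ h2] at h3
    rw [Params.theta, le_div_iff₀ (by positivity), one_div, mul_assoc,
      inv_mul_le_iff₀ h1]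
    linarith

theorem exp_neg_logMean (h : P.Admissible) :
    Real.exp (-P.logMean) = P.δ / (16 * P.H * P.nS * P.nA * P.epochs) := by
  rw [Real.exp_neg, Params.logMean, Real.exp_log (one_pos.trans (h.one_lt_arg (by norm_num))),
    inv_div]

theorem ell_pos (h : P.Admissible) : 1 ≤ P.ell := by
  have h1 : (0 : ℝ) < P.H := by exact_mod_cast h.H_pos
  have h2 := Real.log_pos (h.one_lt_arg (b := 4) (by norm_num))
  exact Nat.one_le_iff_ne_zero.2 (Nat.ceil_pos.2 (by positivity)).ne'

theorem exp_neg_ell_le (h : P.Admissible) :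
    Real.exp (-(P.ell * (1 / (512 * (P.H : ℝ) ^ 2)))) ≤
      P.δ / (4 * P.H * P.nS * P.nA * P.epochs) := by
  have h1 : (0 : ℝ) < P.H := by exact_mod_cast h.H_pos
  have h2 := one_pos.trans (h.one_lt_arg (b := 4) (by norm_num))
  rw [← inv_div (4 * P.H * P.nS * P.nA * P.epochs : ℝ), ← Real.exp_log h2, ← Real.exp_neg,
    Real.exp_le_exp, neg_le_neg_iff, mul_one_div, le_div_iff₀ (by positivity), mul_comm]
  exact Nat.le_ceil _

end Params.Admissible

end Params

/-! ### Probability of the good event of one run -/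

section Probability

variable {X : Type u} {A : Type v} [MeasurableSpace X] [MeasurableSpace A]

/-- Independent answers with the right laws, in a single run of the backward induction. -/
structure IsRunOracle {Ω : Type w} [MeasurableSpace Ω] (μ : Measure Ω) (M : MDP X A)
    (G : Discretization X) (answer : Call G.net A → Ω → X) : Prop where
  measurable : ∀ i, Measurable (answer i)
  indep : iIndepFun answer μ
  law : ∀ i, μ.map (answer i) = M.p ((i.input.1 : X), i.input.2)

variable [MeasurableSingletonClass X] [Fintype A] [Nonempty A] {P : Params} {lam : ℝ}
  {M : MDP X A} {G : Discretization X} {Ω : Type w} [MeasurableSpace Ω] {μ : Measure Ω}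
  [IsProbabilityMeasure μ] {answer : Call G.net A → Ω → X}

namespace IsRunOracle

theorem measurable_quant (h : IsRunOracle μ M G answer) (c : Call G.net A) :
    Measurable fun ω => G.quant (answer c ω) := G.quant_measurable.comp (h.measurable c)

theorem indep_quant (h : IsRunOracle μ M G answer) :
    iIndepFun (fun c ω => G.quant (answer c ω)) μ :=
  h.indep.comp (fun _ => G.quant) fun _ => G.quant_measurable

theorem integral_quant (h : IsRunOracle μ M G answer) (c : Call G.net A) (f : G.net → ℝ) :
    ∫ ω, f (G.quant (answer c ω)) ∂μ = netMean M G f ((c.input.1 : X), c.input.2) := by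
  rw [netMean, ← h.law c, integral_map (h.measurable c).aemeasurable
    (G.measurable_comp_quant f).aestronglyMeasurable]

end IsRunOracle

theorem measurable_of_forall_apply {Ω ι β : Type*} {mΩ : MeasurableSpace Ω} [MeasurableSpace β]
    {Y : Ω → ι → β} (h : ∀ i, Measurable fun ω => Y ω i) : Measurable Y :=
  measurable_pi_iff.2 h

theorem measurableSet_forall_mem_Icc {Ω S : Type*} {mΩ : MeasurableSpace Ω} [Countable S]
    {f : Ω → S → ℝ} (hf : ∀ s, Measurable fun ω => f ω s) (a b : ℝ) :
    MeasurableSet {ω | ∀ s, f ω s ∈ Set.Icc a b} := by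
  have : {ω | ∀ s, f ω s ∈ Set.Icc a b} = ⋂ s, (fun ω => f ω s) ⁻¹' Set.Icc a b := by
    ext ω; simp
  rw [this]
  exact MeasurableSet.iInter fun s => hf s measurableSet_Icc

theorem measure_not_meanGood_le (h : IsRunOracle μ M G answer) (hP : P.Admissible) {k : ℕ}
    {s : G.net} {a : A} {Y : Ω → G.net → ℝ} (hY : Measurable Y)
    (hind : IndepFun Y (fun ω (i : ℕ) => G.quant (answer (.mean k s a i) ω)) μ) :
    μ {ω | ¬ ((∀ s', Y ω s' ∈ Set.Icc (0 : ℝ) P.H) →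
      MeanGood P M G (fun c => answer c ω) (Y ω) k s a)} ≤
      ENNReal.ofReal (6 * (P.δ / (16 * P.H * P.nS * P.nA * P.epochs))) := by
  have hH : (0 : ℝ) < P.H := by exact_mod_cast hP.H_pos
  -- The bad event as a set of pairs (function, samples), so that the function can be frozen. The
  -- range condition stands as a premise inside the event: a frozen function outside the range makes
  -- the event empty, so no conditioning is needed.
  let B : Set ((G.net → ℝ) × (ℕ → G.net)) := {z | ¬ ((∀ s', z.1 s' ∈ Set.Icc (0 : ℝ) P.H) →
    |empMean (P.m k) (fun i => z.1 (z.2 i)) - netMean M G z.1 (s, a)| ≤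
      Real.sqrt (2 * P.theta k * netVar M G z.1 (s, a)) + 2 / 3 * P.theta k * P.H ∧
    |empMean (P.m k) (fun i => z.1 (z.2 i) ^ 2) - empMean (P.m k) (fun i => z.1 (z.2 i)) ^ 2 -
        netVar M G z.1 (s, a)| ≤ 4 * (P.H : ℝ) ^ 2 * Real.sqrt (2 * P.theta k))}
  have hcoord : ∀ s', Measurable fun z : (G.net → ℝ) × (ℕ → G.net) => z.1 s' := fun s' =>
    (measurable_pi_apply s').comp measurable_fst
  have heval : ∀ i, Measurable fun z : (G.net → ℝ) × (ℕ → G.net) => z.1 (z.2 i) := fun i =>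
    measurable_apply_countable hcoord ((measurable_pi_apply i).comp measurable_snd)
  have hmean := measurable_empMean (m := P.m k) heval
  have hmean2 := measurable_empMean (m := P.m k) fun i => (heval i).pow_const 2
  have hnm := measurable_netMean (G := G) M hcoord (s, a)
  have hnv := measurable_netVar (G := G) M hcoord (s, a)
  have hB : MeasurableSet B := by
    refine MeasurableSet.compl (MeasurableSet.imp ?_ (MeasurableSet.inter ?_ ?_))
    · exact measurableSet_forall_mem_Icc hcoord _ _
    · exact measurableSet_le (hmean.sub hnm).abs ((hnv.const_mul _).sqrt.add_const _)
    · exact measurableSet_le ((hmean2.sub (hmean.pow_const 2)).sub hnv).abs measurable_const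
  refine measure_le_of_indepFun hY (measurable_pi_iff.2 fun i => h.measurable_quant _) hind hB
    fun y => ?_
  by_cases hy : ∀ s', y s' ∈ Set.Icc (0 : ℝ) P.H
  · have hW := measureReal_empMean_empVar_le (μ := μ)
      (W := fun i ω => y (G.quant (answer (.mean k s a i) ω))) (b := P.H) (θ := P.theta k)
      (e := netMean M G y (s, a)) (σ := netVar M G y (s, a)) (m := P.m k)
      ((h.indep_quant.precomp (g := fun i => Call.mean k s a i)
        (fun i j hij => by simpa using hij)).comp (fun _ => y) fun _ => Measurable.of_discrete)
      (fun i => (Measurable.of_discrete (f := y)).comp (h.measurable_quant _)) hH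
      (hP.epochOK k).theta_pos (fun i ω => hy _) (fun i => h.integral_quant _ y)
      (fun i => by rw [h.integral_quant (.mean k s a i) (fun s => y s ^ 2)]; rfl) (hP.m_pos k)
    rw [hP.m_mul_theta, hP.exp_neg_logMean] at hW
    rw [← ofReal_measureReal]
    refine ENNReal.ofReal_le_ofReal (le_trans (measureReal_mono fun ω hω => ?_) hW)
    exact fun hc => hω fun _ => hc
  · have : {ω | (y, fun i : ℕ => G.quant (answer (.mean k s a i) ω)) ∈ B} = ∅ := by
      ext ω
      simp only [B, Set.mem_ofPred_eq, Set.mem_empty_iff_false, iff_false, not_not]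
      exact fun hc => absurd hc hy
    rw [this]; simp

theorem measure_not_diffGood_le (h : IsRunOracle μ M G answer) (hP : P.Admissible)
    (hlam : 0 ≤ lam) {k t : ℕ}
    {s : G.net} {a : A} {Y : Ω → G.net → ℝ} (hY : Measurable Y)
    (hind : IndepFun Y (fun ω (i : ℕ) => G.quant (answer (.diff k t s a i) ω)) μ) :
    μ {ω | ¬ ((∀ s', Y ω s' ∈ Set.Icc 0 (P.incr lam k)) →
      DiffGood P lam M G (fun c => answer c ω) (Y ω) k t s a)} ≤
      ENNReal.ofReal (2 * (P.δ / (4 * P.H * P.nS * P.nA * P.epochs))) := by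
  have hH : (0 : ℝ) < P.H := by exact_mod_cast hP.H_pos
  have hD : 0 < P.incr lam k := by
    have := hP.acc_pos k
    unfold Params.incr; positivity
  let B : Set ((G.net → ℝ) × (ℕ → G.net)) := {z | ¬ ((∀ s', z.1 s' ∈ Set.Icc 0 (P.incr lam k)) →
    |empMean P.ell (fun i => z.1 (z.2 i)) - netMean M G z.1 (s, a)| ≤
      P.incr lam k / (32 * P.H))}
  have hcoord : ∀ s', Measurable fun z : (G.net → ℝ) × (ℕ → G.net) => z.1 s' := fun s' =>
    (measurable_pi_apply s').comp measurable_fst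
  have heval : ∀ i, Measurable fun z : (G.net → ℝ) × (ℕ → G.net) => z.1 (z.2 i) := fun i =>
    measurable_apply_countable hcoord ((measurable_pi_apply i).comp measurable_snd)
  have hB : MeasurableSet B := by
    refine MeasurableSet.compl (MeasurableSet.imp ?_ ?_)
    · exact measurableSet_forall_mem_Icc hcoord _ _
    · exact measurableSet_le ((measurable_empMean heval).sub
        (measurable_netMean (G := G) M hcoord (s, a))).abs measurable_const
  refine measure_le_of_indepFun hY (measurable_pi_iff.2 fun i => h.measurable_quant _) hind hB
    fun y => ?_
  by_cases hy : ∀ s', y s' ∈ Set.Icc 0 (P.incr lam k)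
  · have hW := measureReal_hoeffding_empMean_le (μ := μ)
      (W := fun i ω => y (G.quant (answer (.diff k t s a i) ω))) (b := P.incr lam k)
      (θ := 1 / (512 * (P.H : ℝ) ^ 2)) (e := netMean M G y (s, a)) (m := P.ell)
      ((h.indep_quant.precomp (g := fun i => Call.diff k t s a i)
        (fun i j hij => by simpa using hij)).comp (fun _ => y) fun _ => Measurable.of_discrete)
      (fun i => (Measurable.of_discrete (f := y)).comp (h.measurable_quant _)) hD
      (by positivity) (fun i ω => hy _) (fun i => h.integral_quant _ y) hP.ell_pos
    -- The constant `512 = 32² / 2` of `ℓ_j` is what makes the Hoeffding width exactly `incr /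
    -- (32H)`.
    have e : P.incr lam k * Real.sqrt (1 / (512 * (P.H : ℝ) ^ 2) / 2) =
        P.incr lam k / (32 * P.H) := by
      rw [show 1 / (512 * (P.H : ℝ) ^ 2) / 2 = (1 / (32 * P.H)) ^ 2 by field_simp; norm_num,
        Real.sqrt_sq (by positivity), mul_one_div]
    rw [e] at hW
    rw [← ofReal_measureReal]
    refine ENNReal.ofReal_le_ofReal ((le_trans (measureReal_mono fun ω hω => ?_) hW).trans
      (mul_le_mul_of_nonneg_left hP.exp_neg_ell_le (by norm_num)))
    by_contra hc
    exact hω fun _ => not_lt.1 hc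
  · have : {ω | (y, fun i : ℕ => G.quant (answer (.diff k t s a i) ω)) ∈ B} = ∅ := by
      ext ω
      simp only [B, Set.mem_ofPred_eq, Set.mem_empty_iff_false, iff_false, not_not]
      exact fun hc => absurd hc hy
    rw [this]; simp

/-- The calls made before the samples `mean (k + 1) s a i`. -/
def Call.beforeMean {S : Type u} {A : Type v} (k : ℕ) : Set (Call S A) :=
  {c | match c with
    | .mean k' _ _ _ => k' ≤ k
    | .diff k' _ _ _ _ => k' ≤ k}

/-- The calls made in the epochs up to `k` or in the steps from `t` on of epoch `k + 1`. -/
def Call.beforeDiff {S : Type u} {A : Type v} (k t : ℕ) : Set (Call S A) :=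
  {c | match c with
    | .mean k' _ _ _ => k' ≤ k + 1
    | .diff k' t' _ _ _ => k' ≤ k ∨ (k' = k + 1 ∧ t ≤ t')}

theorem measurable_of_mem {Ω ι β : Type*} [mβ : MeasurableSpace β] {q : ι → Ω → β} {S : Set ι}
    {i : ι} (hi : i ∈ S) : Measurable[⨆ i ∈ S, mβ.comap (q i)] (q i) :=
  (comap_measurable (q i)).mono (le_iSup₂_of_le i hi le_rfl) le_rfl

/-- The old function depends only on earlier epochs, and the increment additionally on the mean
samples of this epoch and the later time steps, so each is independent of the samples that test it.
The mean samples are shared by all time steps, which is harmless because the steps are combined by a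
union bound. -/
theorem measure_not_epochGood_step_le (h : IsRunOracle μ M G answer) (hP : P.Admissible)
    (hlam : 0 ≤ lam) (pol₀ : ℕ → G.net → A) (k : ℕ) {n : ℕ} (hn : n < P.H) (s : G.net) (a : A) :
    let old := fun ω => iterate P lam M.r G (fun c => answer c ω) pol₀ k
    let new := fun ω => (backward P lam M.r G (fun c => answer c ω) (k + 1) (old ω) n).1
    μ {ω | ¬ (((∀ s', (old ω).val (P.H - (n + 1) + 1) s' ∈ Set.Icc (0 : ℝ) P.H) →
          MeanGood P M G (fun c => answer c ω) ((old ω).val (P.H - (n + 1) + 1)) (k + 1) s a) ∧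
        ((∀ s', new ω s' - (old ω).val (P.H - (n + 1) + 1) s' ∈ Set.Icc 0 (P.incr lam (k + 1))) →
          DiffGood P lam M G (fun c => answer c ω)
            (fun s' => new ω s' - (old ω).val (P.H - (n + 1) + 1) s') (k + 1) (P.H - (n + 1)) s a))}
      ≤ ENNReal.ofReal (P.δ / (P.H * P.nS * P.nA * P.epochs)) := by
  intro old new
  have hprod := hP.one_le_prod
  have hδ := hP.δ_pos
  have holdS : ∀ (S : Set (Call G.net A)), Call.beforeMean k ⊆ S → ∀ t s',
      Measurable[⨆ c ∈ S, MeasurableSpace.comap (fun ω => G.quant (answer c ω)) inferInstance]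
        fun ω => (old ω).val t s' := by
    intro S hS t s'
    refine measurable_iterate_val (answer := fun ω c => answer c ω) (fun k' hk s a i => ?_)
      (fun k' hk t s a i => ?_) t s'
    · exact measurable_of_mem (q := fun c ω => G.quant (answer c ω)) (hS hk)
    · exact measurable_of_mem (q := fun c ω => G.quant (answer c ω)) (hS hk)
  have hsub : Call.beforeMean (S := G.net) (A := A) k ⊆ Call.beforeDiff k (P.H - n) := by
    rintro (⟨k', s, a, i⟩ | ⟨k', t, s, a, i⟩) hc
    · exact Nat.le_succ_of_le hc
    · exact Or.inl hc
  have hnewS : ∀ s', Measurable[⨆ c ∈ Call.beforeDiff k (P.H - n),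
      MeasurableSpace.comap (fun ω => G.quant (answer c ω)) inferInstance]
        fun ω => new ω s' := by
    intro s'
    refine measurable_backward_fst (answer := fun ω c => answer c ω) (old := old)
      (fun t s => holdS _ hsub t s) (fun s a i => ?_) n (fun t ht s a i => ?_) s'
    · exact measurable_of_mem (q := fun c ω => G.quant (answer c ω)) (le_refl (k + 1))
    · exact measurable_of_mem (q := fun c ω => G.quant (answer c ω)) (Or.inr ⟨rfl, ht⟩)
  have hle : ∀ S : Set (Call G.net A), (⨆ c ∈ S, MeasurableSpace.comap
      (fun ω => G.quant (answer c ω)) inferInstance) ≤ (inferInstance : MeasurableSpace Ω) :=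
    fun S => iSup₂_le fun c _ => (h.measurable_quant c).comap_le
  have m1 : Measurable[⨆ c ∈ Call.beforeMean k,
      MeasurableSpace.comap (fun ω => G.quant (answer c ω)) inferInstance]
        fun ω => (old ω).val (P.H - (n + 1) + 1) :=
    measurable_of_forall_apply fun s' => holdS _ le_rfl _ s'
  have m2 : Measurable[⨆ c ∈ Call.beforeDiff k (P.H - n),
      MeasurableSpace.comap (fun ω => G.quant (answer c ω)) inferInstance]
        fun ω s' => new ω s' - (old ω).val (P.H - (n + 1) + 1) s' :=
    measurable_of_forall_apply fun s' => (hnewS s').sub (holdS _ hsub _ s')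
  have p1 := measure_not_meanGood_le (k := k + 1) (s := s) (a := a) h hP (m1.mono (hle _) le_rfl)
    (indepFun_of_disjoint h.measurable_quant h.indep_quant
      (S := Call.beforeMean k) (T := {c | ∃ i, c = Call.mean (k + 1) s a i})
      (by
        rw [Set.disjoint_left]
        rintro c hc ⟨i, rfl⟩
        exact absurd (show k + 1 ≤ k from hc) (by omega)) m1
      (measurable_of_forall_apply fun i =>
        measurable_of_mem (q := fun c ω => G.quant (answer c ω)) ⟨i, rfl⟩))
  -- The current samples carry time `P.H - (n + 1)`. This is strictly before `P.H - n`, despite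
  -- truncated subtraction, because `n < P.H`.
  have p2 := measure_not_diffGood_le (k := k + 1) (t := P.H - (n + 1)) (s := s) (a := a) h hP hlam
    (m2.mono (hle _) le_rfl)
    (indepFun_of_disjoint h.measurable_quant h.indep_quant
      (S := Call.beforeDiff k (P.H - n))
      (T := {c | ∃ i, c = Call.diff (k + 1) (P.H - (n + 1)) s a i})
      (by
        rw [Set.disjoint_left]
        rintro c hc ⟨i, rfl⟩
        rcases (show k + 1 ≤ k ∨ (k + 1 = k + 1 ∧ P.H - n ≤ P.H - (n + 1)) from hc) with h | h <;>
          omega) m2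
      (measurable_of_forall_apply fun i =>
        measurable_of_mem (q := fun c ω => G.quant (answer c ω)) ⟨i, rfl⟩))
  refine (measure_mono fun ω hω => ?_).trans ((measure_union_le _ _).trans
    ((add_le_add p1 p2).trans ?_))
  · simp only [Set.mem_union, Set.mem_ofPred_eq, not_and_or] at hω ⊢
    exact hω
  · rw [← ENNReal.ofReal_add (by positivity) (by positivity)]
    refine ENNReal.ofReal_le_ofReal ?_
    have e : ∀ b : ℝ, 0 < b → P.δ / (b * P.H * P.nS * P.nA * P.epochs) =
        1 / b * (P.δ / (P.H * P.nS * P.nA * P.epochs)) := by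
      intro b hb
      rw [div_mul_div_comm, one_mul]
      congr 1
      ring
    -- The two failure probabilities are `6/16` and `2/4` of the target, together `7/8` of it.
    rw [e 16 (by norm_num), e 4 (by norm_num)]
    have : 0 ≤ P.δ / (P.H * P.nS * P.nA * P.epochs) := by positivity
    linarith

/-- With probability at least `1 - δ`, all estimates in a run of the algorithm are accurate. -/
theorem measure_not_epochGood_le (h : IsRunOracle μ M G answer) (hP : P.Admissible)
    (hS : P.nS = G.net.card) (hA : P.nA = Fintype.card A)
    (hlam : 0 ≤ lam) (pol₀ : ℕ → G.net → A) :
    μ {ω | ¬ ∀ k < P.epochs, EpochGood P lam M G (fun c => answer c ω) (k + 1)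
      (iterate P lam M.r G (fun c => answer c ω) pol₀ k)} ≤ ENNReal.ofReal P.δ := by
  let B : (Fin P.epochs × Fin P.H × G.net × A) → Set Ω := fun z => {ω | ¬
    (((∀ s', (iterate P lam M.r G (fun c => answer c ω) pol₀ z.1).val
        (P.H - (z.2.1 + 1) + 1) s' ∈ Set.Icc (0 : ℝ) P.H) →
      MeanGood P M G (fun c => answer c ω) ((iterate P lam M.r G (fun c => answer c ω) pol₀ z.1).val
        (P.H - (z.2.1 + 1) + 1)) (z.1 + 1) z.2.2.1 z.2.2.2) ∧
    ((∀ s', (backward P lam M.r G (fun c => answer c ω) (z.1 + 1)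
        (iterate P lam M.r G (fun c => answer c ω) pol₀ z.1) z.2.1).1 s' -
        (iterate P lam M.r G (fun c => answer c ω) pol₀ z.1).val (P.H - (z.2.1 + 1) + 1) s' ∈
        Set.Icc 0 (P.incr lam (z.1 + 1))) →
      DiffGood P lam M G (fun c => answer c ω) (fun s' =>
        (backward P lam M.r G (fun c => answer c ω) (z.1 + 1)
        (iterate P lam M.r G (fun c => answer c ω) pol₀ z.1) z.2.1).1 s' -
        (iterate P lam M.r G (fun c => answer c ω) pol₀ z.1).val (P.H - (z.2.1 + 1) + 1) s')
        (z.1 + 1) (P.H - (z.2.1 + 1)) z.2.2.1 z.2.2.2))}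
  have hB : ∀ z, μ (B z) ≤ ENNReal.ofReal (P.δ / (P.H * P.nS * P.nA * P.epochs)) := fun z =>
    measure_not_epochGood_step_le h hP hlam pol₀ z.1 z.2.1.2 z.2.2.1 z.2.2.2
  refine (measure_mono (t := ⋃ z, B z) fun ω hω => ?_).trans ((measure_iUnion_fintype_le _ _).trans
    ((Finset.sum_le_sum fun z _ => hB z).trans ?_))
  · by_contra hc
    refine hω fun k hk n hn s a => ?_
    by_contra hc'
    exact hc (Set.mem_iUnion.2 ⟨(⟨k, hk⟩, ⟨n, hn⟩, s, a), hc'⟩)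
  · have hprod := hP.one_le_prod
    rw [Finset.sum_const, nsmul_eq_mul, Finset.card_univ, Fintype.card_prod, Fintype.card_prod,
      Fintype.card_prod, Fintype.card_fin, Fintype.card_fin, Fintype.card_coe, ← hS, ← hA,
      ← ENNReal.ofReal_natCast, ← ENNReal.ofReal_mul (by positivity)]
    refine ENNReal.ofReal_le_ofReal (le_of_eq ?_)
    have h0 : (P.H * P.nS * P.nA * P.epochs : ℝ) ≠ 0 := by positivity
    rw [mul_div_assoc', div_eq_iff h0]
    push_cast
    ring

end Probability

end

section

/-! ### Guarantee for the output of backward induction -/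

section Run

theorem Params.acc_epochs_le {P : Params} (hε : 0 < P.ε) : P.acc P.epochs ≤ P.ε := by
  rcases Nat.eq_zero_or_pos P.H with h0 | h0
  · simp [Params.acc, h0, hε.le]
  have hH : (0 : ℝ) < P.H := by exact_mod_cast h0
  have h1 : Real.logb 2 (P.H / P.ε) ≤ P.epochs := Nat.le_ceil _
  rw [Real.logb_le_iff_le_rpow (by norm_num) (by positivity), Real.rpow_natCast,
    div_le_iff₀ hε] at h1
  rw [Params.acc, div_le_iff₀ (by positivity)]
  linarith

variable {X : Type u} {A : Type v} [MeasurableSpace X] [MeasurableSpace A]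
  [MeasurableSingletonClass X] [Fintype A] [Nonempty A] {P : Params} {lam : ℝ}
  {M : MDP X A} {G : Discretization X} {Ω : Type w} [MeasurableSpace Ω] {μ : Measure Ω}
  [IsProbabilityMeasure μ]

/-- The parameters fit the problem. -/
structure Params.Fits (P : Params) (M : MDP X A) (G : Discretization X) : Prop where
  H_eq : P.H = M.H
  nS_eq : P.nS = G.net.card
  nA_eq : P.nA = Fintype.card A
  ε_pos : 0 < P.ε
  δ_pos : 0 < P.δ
  δ_lt : P.δ < 1

theorem Params.Fits.admissible (hP : P.Fits M G) (hne : G.net.Nonempty) (hJ : 1 ≤ P.epochs) :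
    P.Admissible where
  H_pos := hP.H_eq ▸ M.H_pos
  nS_pos := hP.nS_eq ▸ Finset.card_pos.2 hne
  nA_pos := hP.nA_eq ▸ Fintype.card_pos
  epochs_pos := hJ
  δ_pos := hP.δ_pos
  δ_lt := hP.δ_lt

/-- The output of the backward induction is nearly optimal with high probability. -/
theorem measure_backwardInduction_le [MeasurableSingletonClass A] (hP : P.Fits M G)
    (hne : G.net.Nonempty) (hG : G.IsApprox M lam) (hlam : 0 ≤ lam)
    {answer : Call G.net A → Ω → X} (h : IsRunOracle μ M G answer) (pol₀ : ℕ → G.net → A) :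
    μ {ω | ¬ ∀ x, bellman M M.H x - value M (tablePolicy G
      (backwardInduction P lam M.r G (fun c => answer c ω) pol₀)) x ≤
        P.ε + 8 * lam * (M.H : ℝ) ^ 2} ≤ ENNReal.ofReal P.δ := by
  have hgood : ∀ ω, (∀ k < P.epochs, EpochGood P lam M G (fun c => answer c ω) (k + 1)
      (iterate P lam M.r G (fun c => answer c ω) pol₀ k)) →
      ∀ x, bellman M M.H x - value M (tablePolicy G
        (backwardInduction P lam M.r G (fun c => answer c ω) pol₀)) x ≤
          P.ε + 8 * lam * (M.H : ℝ) ^ 2 := fun ω hω x => by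
    have hv := isValid_iterate hG hlam hP.H_eq pol₀
      (fun k hk => (hP.admissible hne (by omega)).epochOK (k + 1)) hω
    have := hv.bellman_sub_value_le x
    have := Params.acc_epochs_le hP.ε_pos
    rw [backwardInduction]
    linarith
  -- Without epochs the arguments of the logarithms vanish and the parameters are not admissible.
  -- But then `ε ≥ H`, and the initial iterate already satisfies the bound surely.
  rcases Nat.eq_zero_or_pos P.epochs with h0 | h0
  · refine le_of_eq_of_le ?_ zero_le
    convert measure_empty (μ := μ)
    ext ω
    simp only [Set.mem_ofPred_eq, Set.mem_empty_iff_false, iff_false, not_not]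
    exact hgood ω fun k hk => by omega
  · refine (measure_mono fun ω hω => ?_).trans
      (measure_not_epochGood_le h (hP.admissible hne h0) hP.nS_eq hP.nA_eq hlam pol₀)
    exact fun hc => hω (hgood ω hc)

end Run

/-! ### From accuracy of the updates to regret -/

section Online

variable {X : Type u} {A : Type v} [MeasurableSpace X] [MeasurableSpace A]
  [Fintype A] [Nonempty A] {lam c δ : ℝ}
  {M : MDP X A} {G : Discretization X} {K : ℕ}

theorem onlineTable_eq (c : ℝ) (H : ℕ) (r : X × A → ℝ) (lam : ℝ)
    (G : Discretization X) (K : ℕ) (δ : ℝ) (pol₀ : ℕ → G.net → A)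
    (answers : ℕ → Call G.net A → X) {k : ℕ} (hk : 1 ≤ k) :
    onlineTable c H r lam G K δ pol₀ answers k =
      backwardInduction (updateParams c H G.net.card (Fintype.card A) K δ (2 ^ Nat.log 2 k)) lam r G
          (answers (2 ^ Nat.log 2 k)) pol₀ := by
  induction k with
  | zero => omega
  | succ k ih =>
    rw [onlineTable]
    split_ifs with h
    · rw [← h]
    · have hk0 : k ≠ 0 := by rintro rfl; simp at h
      rw [ih (by omega)]
      have h1 : 2 ^ Nat.log 2 (k + 1) ≤ k := by
        have := Nat.pow_log_le_self 2 (Nat.succ_ne_zero k)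
        simp only [Nat.succ_eq_add_one] at this
        omega
      have h2 : Nat.log 2 (k + 1) = Nat.log 2 k :=
        le_antisymm (Nat.le_log_of_pow_le (by norm_num) h1) (Nat.log_mono_right (Nat.le_succ k))
      rw [h2]

theorem sum_inv_sqrt_le (K : ℕ) :
    ∑ k ∈ Finset.Icc 1 K, 1 / Real.sqrt k ≤ 2 * Real.sqrt K := by
  induction K with
  | zero => simp
  | succ K ih =>
    rw [Finset.sum_Icc_succ_top (by omega)]
    have h1 : Real.sqrt K ^ 2 = K := Real.sq_sqrt (by positivity)
    have h2 : Real.sqrt ((K + 1 : ℕ) : ℝ) ^ 2 = K + 1 := by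
      rw [Real.sq_sqrt (by positivity)]; push_cast; rfl
    have h3 : 0 < Real.sqrt ((K + 1 : ℕ) : ℝ) := Real.sqrt_pos.2 (by positivity)
    have h4 := Real.sqrt_nonneg K
    have h5 : 1 / Real.sqrt ((K + 1 : ℕ) : ℝ) ≤
        2 * (Real.sqrt ((K + 1 : ℕ) : ℝ) - Real.sqrt K) := by
      rw [div_le_iff₀ h3]
      nlinarith [sq_nonneg (Real.sqrt ((K + 1 : ℕ) : ℝ) - Real.sqrt K)]
    linarith

theorem one_lt_updateLog_arg {H nS nA : ℕ} (hH : 1 ≤ H) (hS : 1 ≤ nS) (hA : 1 ≤ nA)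
    (hδ : 0 < δ) (hδ1 : δ < 1) : 2 ≤ 2 * H * nS * nA * numUpdates K / δ := by
  have h1 : (1 : ℝ) ≤ H := by exact_mod_cast hH
  have h2 : (1 : ℝ) ≤ nS := by exact_mod_cast hS
  have h3 : (1 : ℝ) ≤ nA := by exact_mod_cast hA
  have h4 : (1 : ℝ) ≤ numUpdates K := by simp [numUpdates]
  rw [le_div_iff₀ hδ]
  have h5 := one_le_mul_of_one_le_of_one_le (one_le_mul_of_one_le_of_one_le
    (one_le_mul_of_one_le_of_one_le h1 h2) h3) h4
  calc 2 * δ ≤ 2 * (H * nS * nA * numUpdates K) := by linarith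
    _ = _ := by ring

theorem log_two_le_updateLog {H nS nA : ℕ} (hH : 1 ≤ H) (hS : 1 ≤ nS) (hA : 1 ≤ nA)
    (hδ : 0 < δ) (hδ1 : δ < 1) : Real.log 2 ≤ updateLog H nS nA K δ :=
  Real.log_le_log (by norm_num) (one_lt_updateLog_arg hH hS hA hδ hδ1)

theorem updateLog_pos {H nS nA : ℕ} (hH : 1 ≤ H) (hS : 1 ≤ nS) (hA : 1 ≤ nA)
    (hδ : 0 < δ) (hδ1 : δ < 1) : 0 < updateLog H nS nA K δ :=
  (Real.log_pos (by norm_num)).trans_le (log_two_le_updateLog hH hS hA hδ hδ1)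

theorem IsSamplingOracle.isRunOracle {Ω : Type w} [MeasurableSpace Ω] {μ : Measure Ω}
    {answer : ℕ × Call G.net A → Ω → X} (h : IsSamplingOracle μ M G answer) (k : ℕ) :
    IsRunOracle μ M G fun j => answer (k, j) where
  measurable j := h.measurable _
  indep := h.indep.precomp (g := fun j => (k, j)) fun i j hij => by simpa using hij
  law j := h.law (k, j)

variable [MeasurableSingletonClass X] [MeasurableSingletonClass A]

/-- If all `N` updates succeed, the regret bound is deterministic and holds for all choices of
initial states. Hence `init` may depend on the answers and need not be measurable. -/
theorem measure_regret_le_updateLog (hc : 0 < c) (hne : G.net.Nonempty)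
    (hG : G.IsApprox M lam) (hlam : 0 ≤ lam) (hδ : 0 < δ) (hδ1 : δ < 1)
    (pol₀ : ℕ → G.net → A) {Ω : Type w} [MeasurableSpace Ω] {μ : Measure Ω} [IsProbabilityMeasure μ]
    {answer : ℕ × Call G.net A → Ω → X} (h : IsSamplingOracle μ M G answer) (init : ℕ → Ω → X) :
    μ {ω | 3 * c * Real.sqrt ((M.H : ℝ) ^ 2 * G.net.card * Fintype.card A *
          updateLog M.H G.net.card (Fintype.card A) K δ * K) + 8 * lam * (M.H : ℝ) ^ 2 * K <
        regret c M lam G K δ pol₀ (fun k j => answer (k, j) ω) (fun k => init k ω)} ≤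
      ENNReal.ofReal δ := by
  set S := G.net.card
  set nA := Fintype.card A
  set Λ := updateLog M.H S nA K δ with hΛ
  have hS : 1 ≤ S := Finset.card_pos.2 hne
  have hA : 1 ≤ nA := Fintype.card_pos
  have hH := M.H_pos
  have hΛ0 : 0 < Λ := updateLog_pos hH hS hA hδ hδ1
  have hHr : (0 : ℝ) < M.H := by exact_mod_cast hH
  have hSr : (0 : ℝ) < S := by exact_mod_cast hS
  have hAr : (0 : ℝ) < nA := by exact_mod_cast hA
  have hN : (1 : ℝ) ≤ numUpdates K := by simp [numUpdates]
  -- Despite its name, `good i` is the failure event of the update in episode `2 ^ i`.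
  let good : ℕ → Set Ω := fun i => {ω | ¬ ∀ x, bellman M M.H x - value M (tablePolicy G
    (backwardInduction (updateParams c M.H S nA K δ (2 ^ i)) lam M.r G
      (fun j => answer (2 ^ i, j) ω) pol₀)) x ≤
        (updateParams c M.H S nA K δ (2 ^ i)).ε + 8 * lam * (M.H : ℝ) ^ 2}
  have hgood : ∀ i, μ (good i) ≤ ENNReal.ofReal (δ / numUpdates K) := fun i =>
    measure_backwardInduction_le (P := updateParams c M.H S nA K δ (2 ^ i))
      ⟨rfl, rfl, rfl, by
        simp only [updateParams, ← hΛ]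
        have : (0 : ℝ) < (2 ^ i : ℕ) := by positivity
        positivity, by simp only [updateParams]; positivity, by
        simp only [updateParams]
        exact (div_le_self hδ.le hN).trans_lt hδ1⟩ hne hG hlam (h.isRunOracle (2 ^ i)) pol₀
  refine (measure_mono (t := ⋃ i : Fin (numUpdates K), good i) fun ω hω => ?_).trans
    ((measure_iUnion_fintype_le _ _).trans
      ((Finset.sum_le_sum (f := fun i : Fin (numUpdates K) => μ (good i))
        fun i _ => hgood i).trans (le_of_eq ?_)))
  · by_contra hcon
    simp only [Set.mem_iUnion, not_exists, good, Set.mem_ofPred_eq, not_not] at hcon hω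
    refine absurd hω (not_lt.2 ?_)
    have hnonempty : Nonempty (Policy X A) := ⟨tablePolicy G pol₀⟩
    have hterm : ∀ k ∈ Finset.Icc 1 K, optValue M (init k ω) -
        value M (tablePolicy G (onlineTable c M.H M.r lam G K δ pol₀
          (fun k j => answer (k, j) ω) k)) (init k ω) ≤
        c * Real.sqrt (2 * ((M.H : ℝ) ^ 2 * S * nA * Λ)) * (1 / Real.sqrt k) +
          8 * lam * (M.H : ℝ) ^ 2 := by
      intro k hk
      rw [Finset.mem_Icc] at hk
      have hk1 : (0 : ℝ) < k := by exact_mod_cast hk.1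
      rw [onlineTable_eq _ _ _ _ _ _ _ _ _ hk.1]
      have h1 := hcon ⟨Nat.log 2 k, Nat.lt_succ_of_le (Nat.log_mono_right hk.2)⟩ (init k ω)
      have h2 := optValue_le_bellman M (init k ω)
      have h3 : (updateParams c M.H S nA K δ (2 ^ Nat.log 2 k)).ε ≤
          c * Real.sqrt (2 * ((M.H : ℝ) ^ 2 * S * nA * Λ)) * (1 / Real.sqrt k) := by
        simp only [updateParams, ← hΛ]
        rw [mul_assoc c, mul_one_div, ← Real.sqrt_div (by positivity)]
        refine mul_le_mul_of_nonneg_left (Real.sqrt_le_sqrt ?_) hc.le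
        -- The last update is at most a factor two old; this is the price `√2` in accuracy.
        have h4 : (k : ℝ) ≤ 2 * (2 ^ Nat.log 2 k : ℕ) := by
          have := Nat.lt_pow_succ_log_self (b := 2) (by norm_num) k
          rw [pow_succ] at this
          exact_mod_cast (by omega : k ≤ 2 * 2 ^ Nat.log 2 k)
        have h5 : (0 : ℝ) < (2 ^ Nat.log 2 k : ℕ) := by positivity
        rw [div_mul_eq_mul_div, div_le_div_iff₀ h5 hk1]
        calc _ ≤ (M.H : ℝ) ^ 2 * S * nA * Λ * (2 * (2 ^ Nat.log 2 k : ℕ)) :=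
              mul_le_mul_of_nonneg_left h4 (by positivity)
          _ = _ := by ring
      linarith
    have e : Real.sqrt ((M.H : ℝ) ^ 2 * S * nA * Λ * K) =
        Real.sqrt ((M.H : ℝ) ^ 2 * S * nA * Λ) * Real.sqrt K := Real.sqrt_mul (by positivity) _
    have e2 : Real.sqrt (2 * ((M.H : ℝ) ^ 2 * S * nA * Λ)) ≤
        3 / 2 * Real.sqrt ((M.H : ℝ) ^ 2 * S * nA * Λ) := by
      rw [Real.sqrt_mul (by norm_num)]
      refine mul_le_mul_of_nonneg_right ?_ (Real.sqrt_nonneg _)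
      rw [Real.sqrt_le_left (by norm_num)]; norm_num
    rw [regret]
    refine (Finset.sum_le_sum hterm).trans ?_
    rw [Finset.sum_add_distrib, ← Finset.mul_sum, Finset.sum_const, Nat.card_Icc,
      Nat.add_sub_cancel, nsmul_eq_mul, e]
    have h6 : c * Real.sqrt (2 * ((M.H : ℝ) ^ 2 * S * nA * Λ)) *
        ∑ k ∈ Finset.Icc 1 K, 1 / Real.sqrt k ≤
        c * (3 / 2 * Real.sqrt ((M.H : ℝ) ^ 2 * S * nA * Λ)) * (2 * Real.sqrt K) :=
      mul_le_mul (mul_le_mul_of_nonneg_left e2 hc.le) (sum_inv_sqrt_le K)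
        (Finset.sum_nonneg fun _ _ => by positivity) (by positivity)
    linarith
  · have hN0 : (numUpdates K : ℝ) ≠ 0 := by positivity
    rw [Finset.sum_const, nsmul_eq_mul, Finset.card_univ, Fintype.card_fin,
      ← ENNReal.ofReal_natCast, ← ENNReal.ofReal_mul (by positivity), mul_div_cancel₀ _ hN0]

/-- With a single action there is no regret. -/
theorem regret_nonpos_of_subsingleton [Subsingleton A] (pol₀ : ℕ → G.net → A)
    (answers : ℕ → Call G.net A → X) (init : ℕ → X) :
    regret c M lam G K δ pol₀ answers init ≤ 0 := by
  refine Finset.sum_nonpos fun k _ => ?_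
  have hnonempty : Nonempty (Policy X A) := ⟨tablePolicy G pol₀⟩
  have h1 := optValue_le_bellman M (init k)
  have h2 := le_valueFrom_tablePolicy M G (onlineTable c M.H M.r lam G K δ pol₀ answers k)
    (fun n => bellman M (min n M.H)) (fun n => measurable_bellman M _) M.H (fun n y =>
      (abs_bellman_le M _ y).trans (by exact_mod_cast min_le_right _ _)) (fun x => by simp [bellman])
    M.H (fun n hn x => by
      rw [min_eq_left (by omega), min_eq_left hn.le]
      obtain ⟨a, ha⟩ := exists_bellman_succ_eq M n x
      rw [ha, Subsingleton.elim a]) M.H le_rfl (init k)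
  rw [min_self, Nat.sub_self] at h2
  have h3 : value M (tablePolicy G (onlineTable c M.H M.r lam G K δ pol₀ answers k)) (init k) =
    valueFrom M (tablePolicy G (onlineTable c M.H M.r lam G K δ pol₀ answers k)) 0 M.H (init k) :=
    rfl
  rw [h3]
  linarith

theorem log_numUpdates_le {K : ℕ} {T : ℝ} (hK : 1 ≤ K) (hT : (K : ℝ) ≤ T) :
    Real.log (numUpdates K) ≤ Real.log 2 + Real.log (1 + Real.log T) := by
  have hK' : (1 : ℝ) ≤ K := by exact_mod_cast hK
  have h0 : 0 ≤ Real.log K := Real.log_nonneg hK'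
  have h1 : Real.log K ≤ Real.log T := Real.log_le_log (by linarith) hT
  rw [← Real.log_mul (by norm_num) (by linarith)]
  refine Real.log_le_log (by simp [numUpdates]; positivity) ?_
  have h2 : (Nat.log 2 K : ℝ) * Real.log 2 ≤ Real.log K := by
    rw [← Real.log_pow]
    exact Real.log_le_log (by positivity) (by exact_mod_cast Nat.pow_log_le_self 2 (by omega))
  have h3 := Real.log_two_gt_d9
  have h4 : (0 : ℝ) ≤ Nat.log 2 K := by positivity
  rw [numUpdates]
  push_cast
  nlinarith

theorem one_le_polyLogLog_one {T : ℝ} (hT : 1 ≤ T) : 1 ≤ polyLogLog 1 T := by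
  rw [polyLogLog, pow_one]
  have := Real.log_nonneg hT
  linarith [Real.log_nonneg (show 1 ≤ 1 + Real.log T by linarith)]

/-- Two actions force `log(HSA/δ) ≥ log 2`, which absorbs the additive constants and turns the `log
log T` from `N` into a factor. With one action this logarithm can be arbitrarily close to `0`,
whereas `Λ ≥ log 2`. -/
theorem updateLog_le {H nS nA : ℕ} {T : ℝ} (hH : 1 ≤ H) (hS : 1 ≤ nS) (hA : 2 ≤ nA)
    (hδ : 0 < δ) (hδ1 : δ < 1) (hK : 1 ≤ K) (hT : (K : ℝ) ≤ T) :
    updateLog H nS nA K δ ≤ 3 * polyLogLog 1 T * Real.log (H * nS * nA / δ) := by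
  have h1 : (1 : ℝ) ≤ H := by exact_mod_cast hH
  have h2 : (1 : ℝ) ≤ nS := by exact_mod_cast hS
  have h3 : (2 : ℝ) ≤ nA := by exact_mod_cast hA
  have h4 : (1 : ℝ) ≤ numUpdates K := by simp [numUpdates]
  have h5 : (2 : ℝ) ≤ H * nS * nA := by
    have := one_le_mul_of_one_le_of_one_le h1 h2
    nlinarith
  have h6 : 2 ≤ H * nS * nA / δ := by
    rw [le_div_iff₀ hδ]; linarith
  have h7 : Real.log 2 ≤ Real.log (H * nS * nA / δ) := Real.log_le_log (by norm_num) h6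
  have h8 := log_numUpdates_le hK hT
  have hp : 0 ≤ Real.log (1 + Real.log T) := by
    have : 0 ≤ Real.log T := Real.log_nonneg (le_trans (by exact_mod_cast hK) hT)
    exact Real.log_nonneg (by linarith)
  have e : updateLog H nS nA K δ =
      Real.log 2 + Real.log (numUpdates K) + Real.log (H * nS * nA / δ) := by
    rw [updateLog, ← Real.log_mul (by norm_num) (by positivity),
      ← Real.log_mul (by positivity) (by positivity)]
    congr 1; ring
  rw [e, polyLogLog, pow_one]
  have h9 := Real.log_two_gt_d9
  nlinarith

theorem measure_regret_le (hc : 0 < c) (hG : G.IsApprox M lam) (hlam : 0 ≤ lam)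
    (hK : 1 ≤ K) {T : ℝ} (hT : T = M.H * K) (hδ : 0 < δ) (hδ1 : δ < 1) (pol₀ : ℕ → G.net → A)
    {Ω : Type w} [MeasurableSpace Ω] {μ : Measure Ω} [IsProbabilityMeasure μ]
    {answer : ℕ × Call G.net A → Ω → X} (h : IsSamplingOracle μ M G answer) (init : ℕ → Ω → X) :
    μ {ω | (6 * c + 8) * polyLogLog 1 T *
          (Real.sqrt (M.H * G.net.card * Fintype.card A * T *
            Real.log (M.H * G.net.card * Fintype.card A / δ)) + M.H * T * lam) <
        regret c M lam G K δ pol₀ (fun k j => answer (k, j) ω) (fun k => init k ω)} ≤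
      ENNReal.ofReal δ := by
  -- A probability space is nonempty, so an initial state exists and its representative lies in the
  -- net.
  have hne : G.net.Nonempty := by
    obtain ⟨ω⟩ := nonempty_of_isProbabilityMeasure μ
    exact ⟨_, (G.quant (init 0 ω)).2⟩
  have hH1 : (1 : ℝ) ≤ M.H := by exact_mod_cast M.H_pos
  have hK1 : (1 : ℝ) ≤ K := by exact_mod_cast hK
  have hKT : (K : ℝ) ≤ T := by rw [hT]; exact le_mul_of_one_le_left (by linarith) hH1
  have hT1 : 1 ≤ T := hK1.trans hKT
  have hp := one_le_polyLogLog_one hT1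
  have hTlam : 0 ≤ M.H * T * lam := by positivity
  -- A single action is treated apart because the logarithm in the bound may then be too small;
  -- there is no regret in that case.
  rcases Nat.lt_or_ge (Fintype.card A) 2 with hA | hA
  · have : Subsingleton A := Fintype.card_le_one_iff_subsingleton.1 (by omega)
    refine le_of_eq_of_le ?_ zero_le
    convert measure_empty (μ := μ)
    ext ω
    simp only [Set.mem_ofPred_eq, Set.mem_empty_iff_false, iff_false, not_lt]
    exact (regret_nonpos_of_subsingleton _ _ _).trans (by positivity)
  · refine (measure_mono fun ω hω => ?_).trans
      (measure_regret_le_updateLog (K := K) hc hne hG hlam hδ hδ1 pol₀ h init)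
    rw [Set.mem_ofPred_eq] at hω ⊢
    refine lt_of_le_of_lt ?_ hω
    have hS : 1 ≤ G.net.card := Finset.card_pos.2 hne
    have hΛ := updateLog_le M.H_pos hS hA hδ hδ1 hK hKT
    set p := polyLogLog 1 T
    set l := Real.log (M.H * G.net.card * Fintype.card A / δ)
    set W := (M.H : ℝ) * G.net.card * Fintype.card A * T with hW
    have hW0 : 0 ≤ W := by positivity
    have hl : 0 ≤ W * l := by
      refine mul_nonneg hW0 (Real.log_nonneg ?_)
      rw [le_div_iff₀ hδ]
      have h2 : (1 : ℝ) ≤ G.net.card := by exact_mod_cast hS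
      have h3 : (1 : ℝ) ≤ Fintype.card A := by exact_mod_cast (by omega : 1 ≤ Fintype.card A)
      have := one_le_mul_of_one_le_of_one_le (one_le_mul_of_one_le_of_one_le hH1 h2) h3
      linarith
    have hs : Real.sqrt ((M.H : ℝ) ^ 2 * G.net.card * Fintype.card A *
          updateLog M.H G.net.card (Fintype.card A) K δ * K) ≤ 2 * p * Real.sqrt (W * l) := by
      have e1 : 2 * p * Real.sqrt (W * l) = Real.sqrt ((2 * p) ^ 2 * (W * l)) := by
        rw [Real.sqrt_mul (sq_nonneg (2 * p)), Real.sqrt_sq (by positivity)]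
      rw [e1]
      refine Real.sqrt_le_sqrt ?_
      calc _ = W * updateLog M.H G.net.card (Fintype.card A) K δ := by rw [hW, hT]; ring
        _ ≤ W * (3 * p * l) := mul_le_mul_of_nonneg_left hΛ hW0
        _ = 3 * p * (W * l) := by ring
        _ ≤ (2 * p) ^ 2 * (W * l) := mul_le_mul_of_nonneg_right (by nlinarith) hl
    have hs0 := Real.sqrt_nonneg (W * l)
    have e2 : 8 * lam * (M.H : ℝ) ^ 2 * K = 8 * (M.H * T * lam) := by rw [hT]; ring
    rw [e2]
    have a1 : 3 * c * Real.sqrt ((M.H : ℝ) ^ 2 * G.net.card * Fintype.card A *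
        updateLog M.H G.net.card (Fintype.card A) K δ * K) ≤ 3 * c * (2 * p * Real.sqrt (W * l)) :=
      mul_le_mul_of_nonneg_left hs (by positivity)
    have a2 : 8 * (M.H * T * lam) ≤ p * (8 * (M.H * T * lam)) :=
      le_mul_of_one_le_left (by positivity) hp
    have a3 : 0 ≤ p * (8 * Real.sqrt (W * l)) := by positivity
    have a4 : 0 ≤ p * (6 * c * (M.H * T * lam)) := by positivity
    calc _ ≤ 3 * c * (2 * p * Real.sqrt (W * l)) + p * (8 * (M.H * T * lam)) := add_le_add a1 a2
      _ ≤ 3 * c * (2 * p * Real.sqrt (W * l)) + p * (8 * (M.H * T * lam)) +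
          p * (8 * Real.sqrt (W * l)) + p * (6 * c * (M.H * T * lam)) := by linarith
      _ = _ := by ring

end Online

end

section

/-! ### Number of oracle calls -/

section NumCalls

theorem sum_four_pow_le (J : ℕ) : ∑ j ∈ Finset.Icc 1 J, (4 : ℝ) ^ j ≤ 2 * 4 ^ J := by
  induction J with
  | zero => simp
  | succ J ih =>
    rw [Finset.sum_Icc_succ_top (by omega), pow_succ]
    have : (0 : ℝ) < 4 ^ J := by positivity
    linarith

theorem Params.Admissible.one_le_log {P : Params} (h : P.Admissible) {b : ℝ} (hb : 4 ≤ b) :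
    1 ≤ Real.log (b * P.H * P.nS * P.nA * P.epochs / P.δ) := by
  have h1 : (4 : ℝ) ≤ b * P.H * P.nS * P.nA * P.epochs / P.δ := by
    rw [le_div_iff₀ h.δ_pos]
    have h2 := h.one_le_prod
    have h3 := h.δ_lt
    calc 4 * P.δ ≤ b * (P.H * P.nS * P.nA * P.epochs) := by nlinarith
      _ = _ := by ring
  have h2 : Real.log 4 = 2 * Real.log 2 := by
    rw [show (4 : ℝ) = 2 ^ 2 by norm_num, Real.log_pow]; norm_num
  have h3 := Real.log_two_gt_d9
  have h4 := Real.log_le_log (by norm_num) h1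
  linarith

theorem Params.Admissible.ell_le {P : Params} (h : P.Admissible) :
    (P.ell : ℝ) ≤ 513 * (P.H : ℝ) ^ 2 * P.logMean := by
  have hH : (1 : ℝ) ≤ P.H := by exact_mod_cast h.H_pos
  have h1 := h.one_le_log (b := 4) le_rfl
  have h2 : Real.log (4 * P.H * P.nS * P.nA * P.epochs / P.δ) ≤ P.logMean := by
    refine Real.log_le_log (one_pos.trans (h.one_lt_arg (by norm_num))) ?_
    have := h.δ_pos
    gcongr
    norm_num
  have h3 : (P.ell : ℝ) ≤ 512 * (P.H : ℝ) ^ 2 *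
      Real.log (4 * P.H * P.nS * P.nA * P.epochs / P.δ) + 1 :=
    (Nat.ceil_lt_add_one (by positivity)).le
  have h4 : (1 : ℝ) ≤ (P.H : ℝ) ^ 2 := one_le_pow₀ hH
  have h5 : (P.H : ℝ) ^ 2 * Real.log (4 * P.H * P.nS * P.nA * P.epochs / P.δ) ≤
      (P.H : ℝ) ^ 2 * P.logMean := mul_le_mul_of_nonneg_left h2 (by positivity)
  have h6 := one_le_mul_of_one_le_of_one_le h4 h1
  linarith

theorem Params.Admissible.m_le {P : Params} (h : P.Admissible) (j : ℕ) :
    (P.m j : ℝ) ≤ 129 * (P.H : ℝ) ^ 3 * P.logMean * (4 ^ j / (P.H : ℝ) ^ 2 + 1) := by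
  have hH : (1 : ℝ) ≤ P.H := by exact_mod_cast h.H_pos
  have hl : 1 ≤ P.logMean := h.one_le_log (b := 16) (by norm_num)
  have hacc : P.acc j ^ 2 = (P.H : ℝ) ^ 2 / 4 ^ j := by
    rw [Params.acc, div_pow, ← pow_mul, mul_comm j, pow_mul]; norm_num
  have hpos : 0 < min (P.acc j ^ 2) 1 := lt_min (pow_pos (h.acc_pos j) 2) one_pos
  have h1 : 1 / min (P.acc j ^ 2) 1 ≤ 4 ^ j / (P.H : ℝ) ^ 2 + 1 := by
    rcases min_choice (P.acc j ^ 2) 1 with e | e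
    · rw [e, hacc, one_div_div]; linarith
    · rw [e]; have : (0 : ℝ) ≤ 4 ^ j / (P.H : ℝ) ^ 2 := by positivity
      linarith
  have h2 : (P.m j : ℝ) ≤ 128 * (P.H : ℝ) ^ 3 / min (P.acc j ^ 2) 1 * P.logMean + 1 :=
    (Nat.ceil_lt_add_one (by positivity)).le
  have h3 : 128 * (P.H : ℝ) ^ 3 / min (P.acc j ^ 2) 1 * P.logMean ≤
      128 * (P.H : ℝ) ^ 3 * P.logMean * (4 ^ j / (P.H : ℝ) ^ 2 + 1) := by
    calc _ = 128 * (P.H : ℝ) ^ 3 * P.logMean * (1 / min (P.acc j ^ 2) 1) := by ring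
      _ ≤ _ := mul_le_mul_of_nonneg_left h1 (by positivity)
  have h4 : 1 ≤ (P.H : ℝ) ^ 3 * P.logMean * (4 ^ j / (P.H : ℝ) ^ 2 + 1) :=
    one_le_mul_of_one_le_of_one_le (one_le_mul_of_one_le_of_one_le (one_le_pow₀ hH) hl)
      (le_add_of_nonneg_left (by positivity))
  linarith

/-- Bounding `1 / min(ε_j², 1)` by `4^j/H² + 1` splits `m_j` into a geometric part, dominated by the
last epoch, and a part constant in `j`. The latter joins `H ℓ_j`, whence `642 = 129 + 513`. -/
theorem Params.Admissible.numCalls_le {P : Params} (h : P.Admissible) :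
    (P.numCalls : ℝ) ≤ P.nS * P.nA * (P.H : ℝ) ^ 3 * P.logMean *
      (258 * (4 ^ P.epochs / (P.H : ℝ) ^ 2) + 642 * P.epochs) := by
  have hH : (1 : ℝ) ≤ P.H := by exact_mod_cast h.H_pos
  have hl : 1 ≤ P.logMean := h.one_le_log (b := 16) (by norm_num)
  rw [Params.numCalls]
  push_cast
  rw [← Finset.mul_sum]
  have h1 : ∀ j ∈ Finset.Icc 1 P.epochs, ((P.m j : ℝ) + P.H * P.ell) ≤
      129 * (P.H : ℝ) ^ 3 * P.logMean / (P.H : ℝ) ^ 2 * 4 ^ j +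
        642 * (P.H : ℝ) ^ 3 * P.logMean := by
    intro j _
    have a1 := h.m_le j
    have a2 : (P.H : ℝ) * P.ell ≤ P.H * (513 * (P.H : ℝ) ^ 2 * P.logMean) :=
      mul_le_mul_of_nonneg_left h.ell_le (by positivity)
    calc _ ≤ _ := add_le_add a1 a2
      _ = _ := by ring
  have h2 := Finset.sum_le_sum h1
  have e : ∑ j ∈ Finset.Icc 1 P.epochs, (129 * (P.H : ℝ) ^ 3 * P.logMean / (P.H : ℝ) ^ 2 * 4 ^ j +
      642 * (P.H : ℝ) ^ 3 * P.logMean) = 129 * (P.H : ℝ) ^ 3 * P.logMean / (P.H : ℝ) ^ 2 *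
        ∑ j ∈ Finset.Icc 1 P.epochs, 4 ^ j + P.epochs * (642 * (P.H : ℝ) ^ 3 * P.logMean) := by
    rw [Finset.sum_add_distrib, ← Finset.mul_sum, Finset.sum_const, Nat.card_Icc,
      Nat.add_sub_cancel, nsmul_eq_mul]
  rw [e] at h2
  have h3 := mul_le_mul_of_nonneg_left (sum_four_pow_le P.epochs)
    (show 0 ≤ 129 * (P.H : ℝ) ^ 3 * P.logMean / (P.H : ℝ) ^ 2 by positivity)
  calc _ ≤ (P.nS * P.nA : ℝ) * (129 * (P.H : ℝ) ^ 3 * P.logMean / (P.H : ℝ) ^ 2 *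
        (2 * 4 ^ P.epochs) + P.epochs * (642 * (P.H : ℝ) ^ 3 * P.logMean)) :=
        mul_le_mul_of_nonneg_left (h2.trans (add_le_add h3 le_rfl)) (by positivity)
    _ = _ := by ring

theorem numCalls_updateParams_le {c : ℝ} (hc : 0 < c) :
    ∃ C : ℝ, 0 < C ∧ ∃ q : ℕ, ∀ (H nS nA K : ℕ) (δ : ℝ),
      1 ≤ H → 1 ≤ nS → 1 ≤ nA → 0 < δ → δ < 1 → ∀ k : ℕ, 1 ≤ k → k ≤ K →
        ((updateParams c H nS nA K δ k).numCalls : ℝ) ≤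
          C * polyLogLog q k *
            (H * k + (H : ℝ) ^ 3 * nS * nA * (1 + Real.log H) * updateLog H nS nA K δ) := by
  set κ := 2 + |Real.log (2 / c ^ 2)| with hκ
  have hκ2 : 2 ≤ κ := le_add_of_nonneg_right (abs_nonneg _)
  have hlκ : 0 ≤ Real.log κ := Real.log_nonneg (by linarith)
  set C3 := 4 + 3 / 2 * (1 + Real.log κ) with hC3
  set C4 := 2 + 2 * |Real.log c| with hC4
  set C5 := 1032 / c ^ 2 + 642 * C4 with hC5
  have hC3p : 0 < C3 := by positivity
  have hC4p : 0 < C4 := by positivity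
  have hC5p : 0 < C5 := by positivity
  refine ⟨C3 * C5, by positivity, 1, fun H nS nA K δ hH hS hA hδ hδ1 k hk _ => ?_⟩
  set P := updateParams c H nS nA K δ k with hP
  set Λ := updateLog H nS nA K δ with hΛ
  have hlog2 := Real.log_two_gt_d9
  have hΛ2 : Real.log 2 ≤ Λ := log_two_le_updateLog hH hS hA hδ hδ1
  have hΛ0 : 0 < Λ := by linarith
  have hHr : (1 : ℝ) ≤ H := by exact_mod_cast hH
  have hSr : (1 : ℝ) ≤ nS := by exact_mod_cast hS
  have hAr : (1 : ℝ) ≤ nA := by exact_mod_cast hA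
  have hkr : (1 : ℝ) ≤ k := by exact_mod_cast hk
  have hNr : (1 : ℝ) ≤ numUpdates K := by simp [numUpdates]
  have hlogk : 0 ≤ Real.log k := Real.log_nonneg hkr
  have hlogH : 0 ≤ Real.log H := Real.log_nonneg hHr
  have hp : 1 ≤ polyLogLog 1 k := one_le_polyLogLog_one hkr
  have hpeq : polyLogLog 1 k = 1 + Real.log (1 + Real.log k) := by rw [polyLogLog, pow_one]
  set p := polyLogLog 1 (k : ℝ)
  rcases Nat.eq_zero_or_pos P.epochs with hJ0 | hJ0
  · have : (P.numCalls : ℝ) = 0 := by simp [Params.numCalls, hJ0]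
    rw [this]; positivity
  have hadm : P.Admissible := ⟨hH, hS, hA, hJ0, by simp only [hP, updateParams]; positivity, by
    simp only [hP, updateParams]
    exact (div_le_self hδ.le hNr).trans_lt hδ1⟩
  have hε : P.ε = c * Real.sqrt ((H : ℝ) ^ 2 * nS * nA / k * Λ) := rfl
  have hε0 : 0 < P.ε := by rw [hε]; positivity
  -- `y = c² (H/ε)²`. The number of epochs is about half of `log₂(y / c²)`, and `H·nS·nA·Λ·y = H k`
  -- is the leading term of the claim.
  set y := (k : ℝ) / (nS * nA * Λ) with hy
  have hy0 : 0 < y := by positivity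
  set R := (H : ℝ) / P.ε with hR
  have hR0 : 0 < R := by positivity
  have hR2 : R ^ 2 = y / c ^ 2 := by
    rw [hR, div_pow, hε, mul_pow, Real.sq_sqrt (by positivity), hy]
    field_simp
  have hJdef : P.epochs = ⌈Real.logb 2 R⌉₊ := rfl
  have hlogb : 0 < Real.logb 2 R := Nat.ceil_pos.1 (hJdef ▸ hJ0)
  have hJlt : (P.epochs : ℝ) < Real.logb 2 R + 1 := by
    rw [hJdef]; exact Nat.ceil_lt_add_one hlogb.le
  have hlogR : 0 < Real.log R := by
    have := mul_pos hlogb (show 0 < Real.log 2 by linarith)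
    rwa [Real.logb, div_mul_cancel₀ _ (by linarith)] at this
  have hlogR2 : Real.log (R ^ 2) = 2 * Real.log R := by rw [Real.log_pow]; norm_num
  have hJ1 : (P.epochs : ℝ) ≤ 1 + Real.log (R ^ 2) := by
    have : Real.logb 2 R ≤ 2 * Real.log R := by
      rw [Real.logb, div_le_iff₀ (by linarith)]; nlinarith
    rw [hlogR2]; linarith
  have h4J : (4 : ℝ) ^ P.epochs ≤ 4 * (y / c ^ 2) := by
    have h1 : (2 : ℝ) ^ (P.epochs : ℝ) ≤ 2 ^ (Real.logb 2 R + 1) :=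
      Real.rpow_le_rpow_of_exponent_le (by norm_num) hJlt.le
    rw [Real.rpow_add (by norm_num), Real.rpow_logb (by norm_num) (by norm_num) hR0,
      Real.rpow_one, Real.rpow_natCast] at h1
    calc (4 : ℝ) ^ P.epochs = (2 ^ P.epochs) ^ 2 := by
          rw [← pow_mul, mul_comm, pow_mul]; norm_num
      _ ≤ (R * 2) ^ 2 := pow_le_pow_left₀ (by positivity) h1 2
      _ = _ := by rw [mul_pow, hR2]; ring
  have hSAΛ : 1 / 2 ≤ nS * nA * Λ := by
    have : Λ ≤ nS * nA * Λ :=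
      le_mul_of_one_le_left hΛ0.le (one_le_mul_of_one_le_of_one_le hSr hAr)
    linarith
  have hyk : y ≤ 2 * k := by
    rw [hy, div_le_iff₀ (by positivity)]
    have := mul_le_mul_of_nonneg_left hSAΛ (show (0 : ℝ) ≤ 2 * k by positivity)
    linarith
  -- This bound on the number of epochs is only used inside the logarithm of `logMean`, where it
  -- costs `log log k`.
  have hJκ : (P.epochs : ℝ) ≤ κ * (1 + Real.log k) := by
    have h1 : Real.log (R ^ 2) ≤ Real.log k + |Real.log (2 / c ^ 2)| := by
      calc Real.log (R ^ 2) ≤ Real.log (k * (2 / c ^ 2)) := by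
            refine Real.log_le_log (by positivity) ?_
            rw [hR2, mul_div_assoc', mul_comm (k : ℝ)]; gcongr
        _ = Real.log k + Real.log (2 / c ^ 2) := Real.log_mul (by positivity) (by positivity)
        _ ≤ _ := by linarith [le_abs_self (Real.log (2 / c ^ 2))]
    have h2 : 0 ≤ |Real.log (2 / c ^ 2)| := abs_nonneg _
    have h3 := mul_nonneg h2 hlogk
    rw [hκ]; linarith
  have hJr : (1 : ℝ) ≤ P.epochs := by exact_mod_cast hJ0
  have hlogJ : Real.log P.epochs ≤ (1 + Real.log κ) * p := by
    have h1 := Real.log_le_log (by linarith) hJκ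
    rw [Real.log_mul (by linarith) (by linarith)] at h1
    rw [hpeq]
    have h2 : 0 ≤ Real.log (1 + Real.log k) := Real.log_nonneg (by linarith)
    have h3 := mul_nonneg hlκ h2
    linarith
  have hmean : P.logMean ≤ C3 * p * Λ := by
    have e : P.logMean = Real.log 8 + Real.log P.epochs + Λ := by
      have e0 : P.logMean = Real.log (16 * H * nS * nA * P.epochs / (δ / numUpdates K)) := rfl
      rw [e0, hΛ, updateLog, ← Real.log_mul (by norm_num) (by positivity),
        ← Real.log_mul (by positivity) (by positivity)]
      congr 1
      field_simp
      norm_num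
    have e8 : Real.log 8 = 3 * Real.log 2 := by
      rw [show (8 : ℝ) = 2 ^ 3 by norm_num, Real.log_pow]; norm_num
    have h1 : (1 + Real.log κ) * p ≤ (1 + Real.log κ) * p * (3 / 2 * Λ) :=
      le_mul_of_one_le_right (by positivity) (by linarith)
    have h2 : 4 * Λ ≤ 4 * Λ * p := le_mul_of_one_le_right (by positivity) hp
    rw [e, e8, hC3]
    linarith
  -- As a factor, `log k` epochs would be too many. Writing `log y = log(y/H²) + 2 log H` and using
  -- `log z ≤ z - 1` moves the dependence on `k` into `y/H²`, which after multiplication by `H³ nS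
  -- nA Λ` is just `H k`.
  have hJ4 : (P.epochs : ℝ) ≤ C4 * (1 + Real.log H + y / (H : ℝ) ^ 2) := by
    have h0 : 0 < y / (H : ℝ) ^ 2 := by positivity
    have h1 : Real.log (R ^ 2) = Real.log (y / (H : ℝ) ^ 2) + 2 * Real.log H - 2 * Real.log c := by
      rw [hR2, Real.log_div hy0.ne' (by positivity), Real.log_div hy0.ne' (by positivity),
        Real.log_pow, Real.log_pow]
      push_cast; ring
    have h2 := Real.log_le_sub_one_of_pos h0
    have h3 := neg_abs_le (Real.log c)
    have h4 := abs_nonneg (Real.log c)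
    have h5 := mul_nonneg h4 hlogH
    have h6 := mul_nonneg h4 h0.le
    rw [hC4]
    linarith
  have hbr : 258 * (4 ^ P.epochs / (H : ℝ) ^ 2) + 642 * P.epochs ≤
      C5 * (1 + Real.log H + y / (H : ℝ) ^ 2) := by
    have h1 : (4 : ℝ) ^ P.epochs / (H : ℝ) ^ 2 ≤ 4 * (y / c ^ 2) / (H : ℝ) ^ 2 := by gcongr
    have h2 : 258 * (4 * (y / c ^ 2) / (H : ℝ) ^ 2) = 1032 / c ^ 2 * (y / (H : ℝ) ^ 2) := by
      field_simp; norm_num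
    have h3 : 0 ≤ 1032 / c ^ 2 * (1 + Real.log H) := by positivity
    rw [hC5]
    linarith
  calc (P.numCalls : ℝ) ≤ nS * nA * (H : ℝ) ^ 3 * P.logMean *
        (258 * (4 ^ P.epochs / (H : ℝ) ^ 2) + 642 * P.epochs) := hadm.numCalls_le
    _ ≤ nS * nA * (H : ℝ) ^ 3 * (C3 * p * Λ) * (C5 * (1 + Real.log H + y / (H : ℝ) ^ 2)) := by
        refine mul_le_mul (mul_le_mul_of_nonneg_left hmean (by positivity)) hbr (by positivity)
          (by positivity)
    _ = _ := by rw [hy]; field_simp; ring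

end NumCalls

end

section

/-! ### Nets of the unit cube -/

section Cube

theorem exists_isNet_unitCube {D : ℕ} (hD : 1 ≤ D) {n : ℕ} (hn : 1 ≤ n) :
    ∃ net : Finset (unitCube D), IsNet net n ∧
      (net.card : ℝ) ≤ (2 * D : ℝ) ^ D * (n : ℝ) ^ D := by
  classical
  set N := D * n with hN
  have hN0 : 0 < N := Nat.mul_pos hD hn
  have hNr : (0 : ℝ) < N := by exact_mod_cast hN0
  let pt : (Fin D → Fin (N + 1)) → unitCube D := fun g =>
    ⟨WithLp.toLp 2 fun i => (g i : ℝ) / N, fun i => ⟨by positivity, by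
      have : ((g i : ℕ) : ℝ) ≤ N := by exact_mod_cast Nat.lt_succ_iff.1 (g i).2
      exact (div_le_one hNr).2 this⟩⟩
  refine ⟨Finset.univ.image pt, fun x => ?_, ?_⟩
  · have hx : ∀ i, x.1 i ∈ Set.Icc (0 : ℝ) 1 := x.2
    have hfl : ∀ i, ⌊x.1 i * N⌋₊ < N + 1 := fun i => by
      refine Nat.lt_succ_of_le (Nat.floor_le_of_le ?_)
      exact mul_le_of_le_one_left hNr.le (hx i).2
    refine ⟨pt fun i => ⟨⌊x.1 i * N⌋₊, hfl i⟩, Finset.mem_image_of_mem _ (Finset.mem_univ _), ?_⟩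
    rw [Subtype.dist_eq, EuclideanSpace.dist_eq]
    have hcoord : ∀ i : Fin D, dist (x.1 i) ((pt fun i => ⟨⌊x.1 i * N⌋₊, hfl i⟩).1 i) ^ 2 ≤
        (1 / (N : ℝ)) ^ 2 := fun i => by
      refine pow_le_pow_left₀ dist_nonneg ?_ 2
      have h1 := Nat.floor_le (mul_nonneg (hx i).1 hNr.le)
      have h2 := (Nat.lt_floor_add_one (x.1 i * N)).le
      have e : x.1 i - (⌊x.1 i * N⌋₊ : ℝ) / N = (x.1 i * N - ⌊x.1 i * N⌋₊) / N := by
        field_simp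
      change |x.1 i - (⌊x.1 i * N⌋₊ : ℝ) / N| ≤ 1 / N
      rw [e, abs_of_nonneg (div_nonneg (by linarith) hNr.le)]
      gcongr
      linarith
    refine (Real.sqrt_le_sqrt (Finset.sum_le_sum fun i _ => hcoord i)).trans ?_
    rw [Finset.sum_const, Finset.card_univ, Fintype.card_fin, nsmul_eq_mul,
      Real.sqrt_le_left (by positivity), hN]
    have hDr : (1 : ℝ) ≤ D := by exact_mod_cast hD
    have hnr : (1 : ℝ) ≤ n := by exact_mod_cast hn
    push_cast
    rw [div_pow, div_pow, one_pow, mul_one_div, div_le_div_iff₀ (by positivity) (by positivity),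
      mul_pow, one_mul]
    refine mul_le_mul_of_nonneg_right ?_ (by positivity)
    nlinarith
  · have h1 : (Finset.univ.image pt).card ≤ (N + 1) ^ D := by
      refine Finset.card_image_le.trans (le_of_eq ?_)
      simp
    calc ((Finset.univ.image pt).card : ℝ) ≤ ((N + 1 : ℕ) : ℝ) ^ D := by exact_mod_cast h1
      _ ≤ (2 * D * n : ℝ) ^ D := by
          refine pow_le_pow_left₀ (by positivity) ?_ D
          have : N + 1 ≤ 2 * D * n := by rw [mul_assoc, ← hN]; omega
          exact_mod_cast this
      _ = _ := by rw [mul_pow]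

end Cube

/-! ### Discretisation error and choice of the mesh -/

section Holder

variable {X : Type u} {A : Type v} [MetricSpace X] [MeasurableSpace X] [MeasurableSpace A]

theorem isApprox_of_isHolder {M : MDP X A} {L α : ℝ} (hL : 0 ≤ L) (hα : 0 ≤ α)
    (hM : IsHolder M L α) {n : ℕ} {G : Discretization X}
    (hG : G.IsNearestNeighbour n) : G.IsApprox M (L * (n : ℝ) ^ (-α)) := by
  have hd : ∀ x : X, L * dist x (G.quant x : X) ^ α ≤ L * (n : ℝ) ^ (-α) := fun x => by
    obtain ⟨s, hs, hxs⟩ := hG.1 x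
    have h1 := (hG.2 x s hs).trans hxs
    refine mul_le_mul_of_nonneg_left ((Real.rpow_le_rpow dist_nonneg h1 hα).trans (le_of_eq ?_)) hL
    rw [one_div, Real.inv_rpow (Nat.cast_nonneg n), Real.rpow_neg (Nat.cast_nonneg n)]
  refine ⟨fun s => ?_, fun x a => (hM.1 _ _ a).trans (hd x),
    fun x a B hB => (hM.2 _ _ a B hB).trans (hd x)⟩
  -- A point of the net has itself as a candidate at distance zero, so its nearest neighbour is
  -- unique.
  have := hG.2 s s s.2
  rw [dist_self] at this
  exact Subtype.ext (dist_le_zero.1 this).symm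

end Holder

theorem isApprox_full {X : Type u} {A : Type v} [Fintype X] [MeasurableSpace X] [MeasurableSpace A]
    (M : MDP X A) : (Discretization.full X).IsApprox M 0 :=
  ⟨fun _ => rfl, fun x a => by simp [Discretization.full], fun x a B _ => by
    simp [Discretization.full]⟩

/-- The regret bound for the mesh `n = ⌈T ^ (1 / (D + 2α))⌉`. -/
theorem regret_rate_le {D : ℕ} (hD : 1 ≤ D) {B L α T H S nA δ : ℝ} (hL : 0 ≤ L) (hα : 0 ≤ α)
    (hT : 1 ≤ T) (hH : 1 ≤ H) (hS : 1 ≤ S) (hA : 2 ≤ nA) (hδ : 0 < δ) (hδ1 : δ < 1) {n : ℕ}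
    (hn : n = ⌈T ^ (1 / (D + 2 * α))⌉₊) (hB : S ≤ B * (n : ℝ) ^ D) :
    Real.sqrt (H * S * nA * T * Real.log (H * S * nA / δ)) + H * T * (L * (n : ℝ) ^ (-α)) ≤
      (Real.sqrt (max 1 (|B| * 2 ^ D) * (1 + 2 * Real.log (max 1 (|B| * 2 ^ D)))) + L) *
        (T ^ ((D + α) / (D + 2 * α)) * (H + Real.sqrt (H * nA * Real.log (H * nA * T / δ)))) := by
  -- The factor `2 ^ D` comes from `n ≤ 2E`, the rounding up of the mesh; the maximum with `1` makes
  -- `log b` nonnegative.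
  set b := max 1 (|B| * 2 ^ D) with hb
  have hb1 : 1 ≤ b := le_max_left _ _
  have hT0 : 0 < T := by linarith
  have hDr : (1 : ℝ) ≤ D := by exact_mod_cast hD
  have hden : 0 < (D : ℝ) + 2 * α := by positivity
  set E := T ^ (1 / ((D : ℝ) + 2 * α)) with hE
  have hE1 : 1 ≤ E := Real.one_le_rpow hT (by positivity)
  have hnE : E ≤ n := hn ▸ Nat.le_ceil E
  have hn2 : (n : ℝ) ≤ 2 * E := by
    have := (Nat.ceil_lt_add_one (by linarith : 0 ≤ E)).le
    rw [← hn] at this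
    linarith
  set Z := T ^ (((D : ℝ) + α) / (D + 2 * α)) with hZ
  have hZ0 : 0 < Z := Real.rpow_pos_of_pos hT0 _
  have hED : E ^ D = T ^ ((D : ℝ) / (D + 2 * α)) := by
    rw [hE, ← Real.rpow_natCast, ← Real.rpow_mul hT0.le]
    congr 1; field_simp
  have hEDT : E ^ D ≤ T := by
    rw [hED]
    nth_rewrite 2 [← Real.rpow_one T]
    exact Real.rpow_le_rpow_of_exponent_le hT ((div_le_one hden).2 (by linarith))
  -- This and `T * E ^ (-α) = Z` below express the choice of `n`: the statistical and the
  -- discretisation error then have the same order in `T`.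
  have hEZ : E ^ D * T = Z ^ 2 := by
    rw [hED, hZ, ← Real.rpow_natCast, ← Real.rpow_mul hT0.le]
    nth_rewrite 2 [← Real.rpow_one T]
    rw [← Real.rpow_add hT0]
    congr 1; push_cast; field_simp; ring
  have hSE : S ≤ b * E ^ D := by
    calc S ≤ B * (n : ℝ) ^ D := hB
      _ ≤ |B| * (n : ℝ) ^ D := mul_le_mul_of_nonneg_right (le_abs_self B) (by positivity)
      _ ≤ |B| * (2 * E) ^ D := by gcongr
      _ = |B| * 2 ^ D * E ^ D := by rw [mul_pow]; ring
      _ ≤ _ := mul_le_mul_of_nonneg_right (le_max_right _ _) (by positivity)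
  set l := Real.log (H * nA * T / δ) with hl
  have hHAT : 2 ≤ H * nA * T / δ := by
    rw [le_div_iff₀ hδ]
    have h1 : 2 ≤ H * nA := by nlinarith
    have h2 : H * nA ≤ H * nA * T := le_mul_of_one_le_right (by linarith) hT
    linarith
  have hl2 : Real.log 2 ≤ l := Real.log_le_log (by norm_num) hHAT
  have hlog2 := Real.log_two_gt_d9
  have hl0 : 0 ≤ l := by linarith
  have hlb : 0 ≤ Real.log b := Real.log_nonneg hb1
  -- Since `S ≤ b T`, the size of the net disappears into `log(HAT/δ)`; the additive `log b` becomes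
  -- a factor because `l ≥ log 2 > 1/2`.
  have hlog : Real.log (H * S * nA / δ) ≤ (1 + 2 * Real.log b) * l := by
    have h1 : Real.log (H * S * nA / δ) ≤ Real.log b + l := by
      rw [hl, ← Real.log_mul (by positivity) (by positivity)]
      refine Real.log_le_log (by positivity) ?_
      rw [mul_div_assoc']
      refine div_le_div_of_nonneg_right ?_ hδ.le
      have h2 : S ≤ b * T := hSE.trans (mul_le_mul_of_nonneg_left hEDT (by positivity))
      calc H * S * nA ≤ H * (b * T) * nA := by gcongr
        _ = _ := by ring
    nlinarith
  have hsq : Real.sqrt (H * S * nA * T * Real.log (H * S * nA / δ)) ≤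
      Real.sqrt (b * (1 + 2 * Real.log b)) * (Z * Real.sqrt (H * nA * l)) := by
    have e : Real.sqrt (b * (1 + 2 * Real.log b)) * (Z * Real.sqrt (H * nA * l)) =
        Real.sqrt (b * (1 + 2 * Real.log b) * (Z ^ 2 * (H * nA * l))) := by
      rw [Real.sqrt_mul (show 0 ≤ b * (1 + 2 * Real.log b) by positivity) (Z ^ 2 * (H * nA * l)),
        Real.sqrt_mul (sq_nonneg Z), Real.sqrt_sq hZ0.le]
    rw [e]
    refine Real.sqrt_le_sqrt ?_
    calc H * S * nA * T * Real.log (H * S * nA / δ)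
        ≤ H * S * nA * T * ((1 + 2 * Real.log b) * l) :=
          mul_le_mul_of_nonneg_left hlog (by positivity)
      _ ≤ H * (b * E ^ D) * nA * T * ((1 + 2 * Real.log b) * l) := by gcongr
      _ = b * (1 + 2 * Real.log b) * ((E ^ D * T) * (H * nA * l)) := by ring
      _ = _ := by rw [hEZ]
  have hlin : H * T * (L * (n : ℝ) ^ (-α)) ≤ L * (Z * H) := by
    have h1 : (n : ℝ) ^ (-α) ≤ E ^ (-α) :=
      Real.rpow_le_rpow_of_nonpos (by linarith) hnE (by linarith)
    have h2 : T * E ^ (-α) = Z := by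
      rw [hE, hZ, ← Real.rpow_mul hT0.le]
      nth_rewrite 1 [← Real.rpow_one T]
      rw [← Real.rpow_add hT0]
      congr 1; field_simp; ring
    calc H * T * (L * (n : ℝ) ^ (-α)) ≤ H * T * (L * E ^ (-α)) := by gcongr
      _ = L * (T * E ^ (-α) * H) := by ring
      _ = _ := by rw [h2]
  have hs1 : 0 ≤ Real.sqrt (b * (1 + 2 * Real.log b)) * (Z * H) := by positivity
  have hs2 : 0 ≤ L * (Z * Real.sqrt (H * nA * l)) := by positivity
  calc _ ≤ _ := add_le_add hsq hlin
    _ ≤ Real.sqrt (b * (1 + 2 * Real.log b)) * (Z * Real.sqrt (H * nA * l)) + L * (Z * H) +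
        (Real.sqrt (b * (1 + 2 * Real.log b)) * (Z * H) + L * (Z * Real.sqrt (H * nA * l))) :=
      le_add_of_nonneg_right (add_nonneg hs1 hs2)
    _ = _ := by ring

end

end OnlineMDP

end

/-! ### Assembly of the four claims -/

theorem mainTheorem7 (c : ℝ) (hc : 0 < c) :
    -- compact state space with Hölder continuous data
    (∃ C : ℝ, 0 < C ∧ ∃ q : ℕ,
      ∀ (X : Type u) [MetricSpace X] [CompactSpace X] [MeasurableSpace X] [BorelSpace X]
        (A : Type v) [Fintype A] [Nonempty A] [MeasurableSpace A] [DiscreteMeasurableSpace A]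
        (M : MDP X A) (L α : ℝ), 0 ≤ L → 0 ≤ α → IsHolder M L α →
      ∀ (n : ℕ), 1 ≤ n → ∀ (G : Discretization X), G.IsNearestNeighbour n →
      ∀ (K : ℕ), 1 ≤ K → ∀ (T : ℝ), T = M.H * K → ∀ (δ : ℝ), 0 < δ → δ < 1 →
      ∀ (pol₀ : ℕ → G.net → A)
        (Ω : Type w) [MeasurableSpace Ω] (μ : Measure Ω) [IsProbabilityMeasure μ]
        (answer : ℕ × Call G.net A → Ω → X), IsSamplingOracle μ M G answer →
      ∀ (init : ℕ → Ω → X),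
        μ {ω | C * polyLogLog q T *
              (Real.sqrt (M.H * G.net.card * Fintype.card A * T *
                  Real.log (M.H * G.net.card * Fintype.card A / δ)) +
                M.H * T * L * (n : ℝ) ^ (-α)) <
            regret c M (L * (n : ℝ) ^ (-α)) G K δ pol₀
              (fun k j => answer (k, j) ω) (fun k => init k ω)} ≤ ENNReal.ofReal δ) ∧
    -- the unit cube: nets of size O(n^D) exist, and for them n = T^(1/(D+2α)) gives the rate
    (∀ D : ℕ, 1 ≤ D →
      (∃ B : ℝ, ∀ n : ℕ, 1 ≤ n →
        ∃ net : Finset (unitCube D), IsNet net n ∧ (net.card : ℝ) ≤ B * (n : ℝ) ^ D) ∧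
      ∀ B L : ℝ, 0 ≤ L → ∃ C : ℝ, 0 < C ∧ ∃ q : ℕ,
      ∀ (A : Type v) [Fintype A] [Nonempty A] [MeasurableSpace A] [DiscreteMeasurableSpace A]
        (M : MDP (unitCube D) A) (α : ℝ), 0 ≤ α → IsHolder M L α →
      ∀ (K : ℕ), 1 ≤ K → ∀ (T : ℝ), T = M.H * K →
      ∀ (n : ℕ), n = ⌈T ^ (1 / (D + 2 * α))⌉₊ →
      ∀ (G : Discretization (unitCube D)), G.IsNearestNeighbour n →
        (G.net.card : ℝ) ≤ B * (n : ℝ) ^ D → ∀ (δ : ℝ), 0 < δ → δ < 1 →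
      ∀ (pol₀ : ℕ → G.net → A)
        (Ω : Type w) [MeasurableSpace Ω] (μ : Measure Ω) [IsProbabilityMeasure μ]
        (answer : ℕ × Call G.net A → Ω → unitCube D), IsSamplingOracle μ M G answer →
      ∀ (init : ℕ → Ω → unitCube D),
        μ {ω | C * polyLogLog q T *
              (T ^ ((D + α) / (D + 2 * α)) *
                (M.H + Real.sqrt (M.H * Fintype.card A *
                  Real.log (M.H * Fintype.card A * T / δ)))) <
            regret c M (L * (n : ℝ) ^ (-α)) G K δ pol₀
              (fun k j => answer (k, j) ω) (fun k => init k ω)} ≤ ENNReal.ofReal δ) ∧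
    -- finite state space: every state represents itself and there is no discretisation error
    (∃ C : ℝ, 0 < C ∧ ∃ q : ℕ,
      ∀ (X : Type u) [Fintype X] [MeasurableSpace X] [DiscreteMeasurableSpace X]
        (A : Type v) [Fintype A] [Nonempty A] [MeasurableSpace A] [DiscreteMeasurableSpace A]
        (M : MDP X A) (K : ℕ), 1 ≤ K → ∀ (T : ℝ), T = M.H * K →
      ∀ (δ : ℝ), 0 < δ → δ < 1 →
      ∀ (pol₀ : ℕ → (Discretization.full X).net → A)
        (Ω : Type w) [MeasurableSpace Ω] (μ : Measure Ω) [IsProbabilityMeasure μ]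
        (answer : ℕ × Call (Discretization.full X).net A → Ω → X),
        IsSamplingOracle μ M (Discretization.full X) answer →
      ∀ (init : ℕ → Ω → X),
        μ {ω | C * polyLogLog q T *
              Real.sqrt (M.H * Fintype.card X * Fintype.card A * T *
                Real.log (M.H * Fintype.card X * Fintype.card A / δ)) <
            regret c M 0 (Discretization.full X) K δ pol₀
              (fun k j => answer (k, j) ω) (fun k => init k ω)} ≤ ENNReal.ofReal δ) ∧
    -- number of oracle calls in the generative phase of episode k
    (∃ C : ℝ, 0 < C ∧ ∃ q : ℕ, ∀ (H nS nA K : ℕ) (δ : ℝ),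
      1 ≤ H → 1 ≤ nS → 1 ≤ nA → 0 < δ → δ < 1 → ∀ k : ℕ, 1 ≤ k → k ≤ K →
        ((updateParams c H nS nA K δ k).numCalls : ℝ) ≤
          C * polyLogLog q k *
            (H * k + (H : ℝ) ^ 3 * nS * nA * (1 + Real.log H) * updateLog H nS nA K δ)) := by
  refine ⟨⟨6 * c + 8, by positivity, 1, ?_⟩, fun D hD => ⟨?_, fun B L hL => ?_⟩,
    ⟨6 * c + 8, by positivity, 1, ?_⟩, numCalls_updateParams_le hc⟩
  · intro X _ _ _ _ A _ _ _ _ M L α hL hα hM n _ G hG K hK T hT δ hδ hδ1 pol₀ Ω _ μ _ answer h init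
    have := measure_regret_le hc (isApprox_of_isHolder hL hα hM hG) (by positivity) hK hT hδ hδ1
      pol₀ h init
    simpa only [mul_assoc] using this
  · exact ⟨(2 * D : ℝ) ^ D, fun n hn => exists_isNet_unitCube hD hn⟩
  · have hlb : 0 ≤ Real.log (max 1 (|B| * 2 ^ D)) := Real.log_nonneg (le_max_left _ _)
    have hb : 0 < max 1 (|B| * 2 ^ D) := one_pos.trans_le (le_max_left _ _)
    have hC : 0 < Real.sqrt (max 1 (|B| * 2 ^ D) * (1 + 2 * Real.log (max 1 (|B| * 2 ^ D)))) + L :=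
      add_pos_of_pos_of_nonneg (Real.sqrt_pos.2 (by positivity)) hL
    refine ⟨(6 * c + 8) * (Real.sqrt (max 1 (|B| * 2 ^ D) *
      (1 + 2 * Real.log (max 1 (|B| * 2 ^ D)))) + L), mul_pos (by positivity) hC, 1, ?_⟩
    intro A _ _ _ _ M α hα hM K hK T hT n hn G hG hB δ hδ hδ1 pol₀ Ω _ μ _ answer h init
    have hH1 : (1 : ℝ) ≤ M.H := by exact_mod_cast M.H_pos
    have hK1 : (1 : ℝ) ≤ K := by exact_mod_cast hK
    have hT1 : 1 ≤ T := by rw [hT]; exact one_le_mul_of_one_le_of_one_le hH1 hK1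
    have hp := one_le_polyLogLog_one hT1
    -- The comparison of rates needs two actions to keep its logarithm away from zero, so the
    -- trivial case is separated once more.
    rcases Nat.lt_or_ge (Fintype.card A) 2 with hA | hA
    · have : Subsingleton A := Fintype.card_le_one_iff_subsingleton.1 (by omega)
      refine le_of_eq_of_le ?_ zero_le
      convert measure_empty (μ := μ)
      ext ω
      simp only [Set.mem_ofPred_eq, Set.mem_empty_iff_false, iff_false, not_lt]
      exact (regret_nonpos_of_subsingleton _ _ _).trans (by positivity)
    · have hS : (1 : ℝ) ≤ G.net.card := by
        obtain ⟨ω⟩ := nonempty_of_isProbabilityMeasure μ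
        exact_mod_cast Finset.card_pos.2 ⟨_, (G.quant (init 0 ω)).2⟩
      refine (measure_mono fun ω hω => ?_).trans (measure_regret_le hc
        (isApprox_of_isHolder hL hα hM hG) (by positivity) hK hT hδ hδ1 pol₀ h init)
      rw [Set.mem_ofPred_eq] at hω ⊢
      refine lt_of_le_of_lt ?_ hω
      have hrate := regret_rate_le (nA := (Fintype.card A : ℝ)) hD hL hα hT1 hH1 hS
        (by exact_mod_cast hA) hδ hδ1 hn hB
      have h1 := mul_le_mul_of_nonneg_left hrate
        (show 0 ≤ (6 * c + 8) * polyLogLog 1 T by positivity)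
      calc _ ≤ _ := h1
        _ = _ := by ring
  · intro X _ _ _ A _ _ _ _ M K hK T hT δ hδ hδ1 pol₀ Ω _ μ _ answer h init
    have := measure_regret_le hc (isApprox_full M) le_rfl hK hT hδ hδ1 pol₀ h init
    simpa only [mul_zero, add_zero, Discretization.full, Finset.card_univ] using this
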